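/- Let $\omega=e^{i\pi/4}$ and $\mathbb Z[\omega]=\{a\omega^3+b\omega^2+c\omega+d : a,b,c,d\in\mathbb Z\}\subset\mathbb C=\mathbb R^2$, let $(a\omega^3+b\omega^2+c\omega+d)^\bullet=-a\omega^3+b\omega^2-c\omega+d$, and let $\mathbb D[\omega]=\{u/2^k : u\in\mathbb Z[\omega],\,k\in\mathbb N\}$. For $A,B\subset\mathbb R^2$, the solutions of the two-dimensional grid problem are the $u\in\mathbb Z[\omega]$ with $u\in A$ and $u^\bullet\in B$. For $M>0$, a bounded convex set $A\subset\mathbb R^2$ with non-empty interior is called $M$-upright if $\operatorname{area}(A)\ge M\cdot\operatorname{area}(\mathrm{BBox}(A))$, where $\mathrm{BBox}(A)$ is the smallest rectangle $[x_0,x_1]\times[y_0,y_1]$ containing $A$. A bounded convex set $A$ is given, with quality factor $\kappa$, by: (i) a finite list of points whose convex hull contains $A$ and has area at most $\kappa\operatorname{area}(A)$; (ii) a membership test for points of $\mathbb D[\omega]$; (iii) a procedure which, for $p,q\in\mathbb D[\omega]$ with $q\neq0$, reports whether $S=\{t\in\mathbb R : p+tq\in A\}$ is empty and, if not, returns reals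 $x\le y$ with $S\subseteq[x,y]$ and $y-x\le\kappa\cdot\operatorname{length}(S)$. An algorithm is a finite program with finitely many real registers and integer constants; its elementary steps are addition, subtraction, multiplication, division, exponentiation, logarithm, rounding down to an integer, comparison of two registers, loading a constant, reading a listed vertex or the number of them, one use of (ii) or (iii), and output of an element of $\mathbb Z[\omega]$. **Theorem.** There is an algorithm which, given two bounded convex sets $A,B\subset\mathbb R^2$ with non-empty interior, halts and enumerates all solutions of the two-dimensional grid problem for $A$ and $B$, each exactly once. Moreover, for every $\kappa$ there is a constant $C$ such that, whenever $A$ and $B$ are given with quality factor $\kappa$ by lists of $m$ and $n$ points, respectively, and are both $M$-upright for some $M>0$, the algorithm makes at most $C\,(\log(1/M)+N+m+n)$ elementary steps, where $N$ is the number of solutions. That is, it uses $O(\log(1/M))$ operations overall plus a constant number per solution produced, apart from a constant number per listed vertex for reading the enclosing polygons. -/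

import Mathlib

/-! ## The ring `ℤ[ω]`, its embedding into the plane, and grid problems -/

namespace Grid

/-- `ω = e^{iπ/4}`, a primitive eighth root of unity. -/
noncomputable def omega : ℂ := Complex.exp (Complex.I * Real.pi / 4)

/-- An element `a ω³ + b ω² + c ω + d` of `ℤ[ω]`, given by its integer coefficients
(which are unique, since `1, ω, ω², ω³` are linearly independent over `ℚ`). -/
@[ext]
structure ZOmega where
  a : ℤ
  b : ℤ
  c : ℤ
  d : ℤ

/-- The point of the plane `ℂ = ℝ²` represented by an element of `ℤ[ω]`. -/
noncomputable def ZOmega.toComplex (u : ZOmega) : ℂ :=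
  u.a * omega ^ 3 + u.b * omega ^ 2 + u.c * omega + u.d

/-- The `√2`-conjugation `u ↦ u•`, the automorphism of `ℤ[ω]` with `ω• = -ω`. -/
def ZOmega.bul (u : ZOmega) : ZOmega := ⟨-u.a, u.b, -u.c, u.d⟩

/-- `u` solves the two-dimensional grid problem for `A` and `B`: `u ∈ A` and `u• ∈ B`. -/
def IsSolution (A B : Set ℂ) (u : ZOmega) : Prop :=
  u.toComplex ∈ A ∧ u.bul.toComplex ∈ B

/-- `𝔻[ω]` as a subset of the plane, where `𝔻 = ℤ[1/2]`: the quotients `u / 2^k` with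
`u ∈ ℤ[ω]`, that is, the points `a ω³ + b ω² + c ω + d` with dyadic `a, b, c, d`. -/
def DOmega : Set ℂ := {z | ∃ (u : ZOmega) (k : ℕ), z = u.toComplex / 2 ^ k}

/-! ## Uprightness -/

/-- The bounding box of a (bounded, non-empty) set: the smallest set of the form
`[x₀, x₁] × [y₀, y₁]` that contains it. -/
noncomputable def bbox (A : Set ℂ) : Set ℂ :=
  Set.Icc (sInf (Complex.re '' A)) (sSup (Complex.re '' A)) ×ℂ
    Set.Icc (sInf (Complex.im '' A)) (sSup (Complex.im '' A))

/-- The uprightness of `A`: the area of `A` divided by the area of its bounding box. -/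
noncomputable def uprightness (A : Set ℂ) : ℝ :=
  MeasureTheory.volume.real A / MeasureTheory.volume.real (bbox A)

/-- `A` is `M`-upright. -/
def IsUpright (M : ℝ) (A : Set ℂ) : Prop := M ≤ uprightness A

/-! ## How a convex set is given to an algorithm -/

/-- The parameters `t` at which the line `t ↦ p + t q` is in `A`. -/
def lineSection (A : Set ℂ) (p q : ℂ) : Set ℝ := {t | p + t * q ∈ A}

/-- The data through which an algorithm accesses a convex set: a list of vertices of an
enclosing polygon, a membership test, and a procedure that locates the intersection with the
line `t ↦ p + t q` between two bounds (`none` stands for an empty intersection). -/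
structure SetData where
  vertices : List ℂ
  mem : ℂ → Bool
  line : ℂ → ℂ → Option (ℝ × ℝ)

/-- `D` is a presentation of the set `A` with quality factor `κ`. The polygon is the convex hull
of the listed vertices. Nothing is assumed about the answers of the membership test and of the
line procedure at points and directions outside `𝔻[ω]`. -/
structure SetData.Presents (D : SetData) (κ : ℝ) (A : Set ℂ) : Prop where
  subset_polygon : A ⊆ convexHull ℝ {v | v ∈ D.vertices}
  area_polygon_le : MeasureTheory.volume.real (convexHull ℝ {v | v ∈ D.vertices}) ≤
    κ * MeasureTheory.volume.real A
  mem_iff : ∀ z ∈ DOmega, (D.mem z = true ↔ z ∈ A)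
  line_none_iff : ∀ p ∈ DOmega, ∀ q ∈ DOmega, q ≠ 0 →
    (D.line p q = none ↔ lineSection A p q = ∅)
  line_some : ∀ p ∈ DOmega, ∀ q ∈ DOmega, q ≠ 0 → ∀ x y : ℝ, D.line p q = some (x, y) →
    lineSection A p q ⊆ Set.Icc x y ∧ y - x ≤ κ * Metric.diam (lineSection A p q)

/-! ## The machine model

A program is a finite text over real-valued registers. All constants in it are integers, and
registers can be named only explicitly. Two sets are accessible, indexed by `Fin 2`. -/

/-- The binary arithmetic operations; `pow` is exponentiation `x ^ y`. -/
inductive BinOp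
  | add | sub | mul | div | pow

/-- Values of the binary operations; `none` where an operation is undefined (division by zero,
exponentiation with a base that is not positive). -/
noncomputable def BinOp.eval (op : BinOp) (x y : ℝ) : Option ℝ :=
  open Classical in
  match op with
  | .add => some (x + y)
  | .sub => some (x - y)
  | .mul => some (x * y)
  | .div => if y = 0 then none else some (x / y)
  | .pow => if 0 < x then some (x ^ y) else none

/-- Elementary instructions. All arguments of type `ℕ` are names of registers. -/
inductive Instr
  /-- `r := n` -/
  | const (r : ℕ) (n : ℤ)
  /-- `r := x op y` -/
  | bin (op : BinOp) (r x y : ℕ)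
  /-- `r := log x` (natural logarithm; undefined unless `x > 0`) -/
  | log (r x : ℕ)
  /-- `r := ⌊x⌋`, rounding to an integer -/
  | floor (r x : ℕ)
  /-- `r :=` the number of listed vertices for the set `s` -/
  | size (s : Fin 2) (r : ℕ)
  /-- `(rx, ry) :=` the coordinates of the vertex with number `⌊i⌋` for the set `s`, counted
  from `0` (undefined if there is no such vertex) -/
  | vertex (s : Fin 2) (i rx ry : ℕ)
  /-- `r := 1` if the membership test of the set `s` accepts the point `(x, y)`, else `r := 0` -/
  | member (s : Fin 2) (x y r : ℕ)
  /-- ask the set `s` for bounds for the line through `(px, py)` with direction `(qx, qy)`: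
  `r := 1` and `(ra, rb) :=` the bounds if the answer is not `none`, else `r := 0` -/
  | line (s : Fin 2) (px py qx qy r ra rb : ℕ)
  /-- output `a ω³ + b ω² + c ω + d` (undefined unless the four contents are integers) -/
  | emit (a b c d : ℕ)

/-- Programs: instructions, sequencing, branching on `x < y`, and loops `while x < y`. -/
inductive Prog
  | instr (i : Instr)
  | seq (P Q : Prog)
  | ifLt (x y : ℕ) (P Q : Prog)
  | whileLt (x y : ℕ) (P : Prog)

/-- Contents of the registers, and the list of outputs so far (latest first). -/
structure State where
  reg : ℕ → ℝ
  out : List ZOmega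

/-- Initially all registers are `0` and nothing has been output. -/
def State.init : State := ⟨fun _ => 0, []⟩

/-- `r := v`. -/
def State.set (σ : State) (r : ℕ) (v : ℝ) : State := ⟨Function.update σ.reg r v, σ.out⟩

/-- Effect of an instruction; `none` if it is undefined in the given state. -/
noncomputable def Instr.step (O : Fin 2 → SetData) (i : Instr) (σ : State) : Option State :=
  open Classical in
  match i with
  | .const r n => some (σ.set r n)
  | .bin op r x y => (op.eval (σ.reg x) (σ.reg y)).map (σ.set r)
  | .log r x => if 0 < σ.reg x then some (σ.set r (Real.log (σ.reg x))) else none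
  | .floor r x => some (σ.set r ⌊σ.reg x⌋)
  | .size s r => some (σ.set r (O s).vertices.length)
  | .vertex s i rx ry =>
      ((O s).vertices[⌊σ.reg i⌋₊]?).map fun v => (σ.set rx v.re).set ry v.im
  | .member s x y r => some (σ.set r (if (O s).mem ⟨σ.reg x, σ.reg y⟩ = true then 1 else 0))
  | .line s px py qx qy r ra rb =>
      match (O s).line ⟨σ.reg px, σ.reg py⟩ ⟨σ.reg qx, σ.reg qy⟩ with
      | none => some (σ.set r 0)
      | some (x, y) => some (((σ.set ra x).set rb y).set r 1)
  | .emit a b c d =>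
      if (⌊σ.reg a⌋ : ℝ) = σ.reg a ∧ (⌊σ.reg b⌋ : ℝ) = σ.reg b ∧
          (⌊σ.reg c⌋ : ℝ) = σ.reg c ∧ (⌊σ.reg d⌋ : ℝ) = σ.reg d then
        some ⟨σ.reg, ⟨⌊σ.reg a⌋, ⌊σ.reg b⌋, ⌊σ.reg c⌋, ⌊σ.reg d⌋⟩ :: σ.out⟩
      else none

/-- `Exec O P σ τ n`: started in the state `σ`, the program `P` halts in the state `τ` after `n`
elementary steps. Every instruction and every comparison counts as one step. -/
inductive Exec (O : Fin 2 → SetData) : Prog → State → State → ℕ → Prop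
  | instr {i : Instr} {σ τ : State} (h : i.step O σ = some τ) : Exec O (.instr i) σ τ 1
  | seq {P Q : Prog} {σ τ υ : State} {m n : ℕ} (hP : Exec O P σ τ m) (hQ : Exec O Q τ υ n) :
      Exec O (.seq P Q) σ υ (m + n)
  | ifTrue {x y : ℕ} {P Q : Prog} {σ τ : State} {n : ℕ} (h : σ.reg x < σ.reg y)
      (hP : Exec O P σ τ n) : Exec O (.ifLt x y P Q) σ τ (n + 1)
  | ifFalse {x y : ℕ} {P Q : Prog} {σ τ : State} {n : ℕ} (h : ¬ σ.reg x < σ.reg y)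
      (hQ : Exec O Q σ τ n) : Exec O (.ifLt x y P Q) σ τ (n + 1)
  | whileStep {x y : ℕ} {P : Prog} {σ τ υ : State} {m n : ℕ} (h : σ.reg x < σ.reg y)
      (hP : Exec O P σ τ m) (hL : Exec O (.whileLt x y P) τ υ n) :
      Exec O (.whileLt x y P) σ υ (m + n + 1)
  | whileDone {x y : ℕ} {P : Prog} {σ : State} (h : ¬ σ.reg x < σ.reg y) :
      Exec O (.whileLt x y P) σ σ 1

end Grid

/-! ## Program logic

The registers with even numbers are used as program variables, the ones with odd numbers hold
intermediate results of arithmetic terms. -/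

namespace Grid

/-! `ℤ[ω]` is a free module of rank two over `ℤ[√2]`. Fix a `ℤ[√2]`-basis `e, f` and write a
candidate solution as `u = α e + β f`. This sorts the solutions into lines parallel to `e`, one for
each `β`: the pair `(β, β•)` is a point of `ℤ[√2] ⊂ ℝ²` in a rectangle, and for fixed `β` the pair
`(α, α•)` lies in a product of two intervals. Both levels are thus the same one-dimensional problem,
which is easy. Multiplication by a power of the totally positive unit `3 + 2√2` makes the rectangle
nearly square; then its points are listed in time proportional to its area plus one
(`numRows_add_length_cands_le`), and their number is at least proportional to the area if this is
large (`exists_finset_quad`). Hence the work on one line is proportional to the solutions on it,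
plus one (`lineWork_le`).

Every basis gives a correct enumeration; the choice of `e` only decides how many lines are
fruitless. Enclose `A` and `B` in ellipses of comparable area, level sets of forms `F`, `G` of
determinant one and levels of order `s`, `s'` (`exists_encloses`). The rectangle for `β` has area of
order `√(F(e) G(e•)) √(s s')`. By convexity a positive proportion of the lines meets each set in a
chord of full order of length (`exists_long_lines`), and the product of the two chord lengths is of
order `√(s s') / √(F(e) G(e•))`. If this is large, each of these lines carries a solution. If it is
small and `F(e) G(e•)` is bounded, then the rectangle itself has bounded area. Either way its area
is at most proportional to the number of solutions plus one (`area_le`).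

A vector `e` with `F(e) G(e•)` bounded comes from Gauss–Lagrange reduction over `ℤ[√2]`. Subtract
from `f` the multiple of `e` by a rounded coefficient. The rounding error has norm at most `1/2`, as
in the Euclidean algorithm of `ℤ[√2]` (`exists_nearest_sub`), so the product of the forms at the new
`f` is at most a quarter of that at `e`, up to terms that are bounded unless the latter is small
(`IsBasis.nrm_reduceBy_le`). So either exchanging the vectors more than halves the product, or it is
at most `109`. Started with the better of `1` and `i`, the product is bounded by a multiple of
`1/M²` (`Encloses.mul_le_of_isUpright`), which leaves `O(log (1/M))` rounds.

The program is verified in a small Hoare logic that counts steps (`Runs`): pieces without loops cost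
a constant, loops have an invariant and a variant. -/

/-- Arithmetic terms in the program variables. -/
inductive Arith
  | c (n : ℤ)
  | v (r : ℕ)
  | bin (op : BinOp) (s t : Arith)
  | log (s : Arith)
  | floor (s : Arith)

namespace Arith

instance : Add Arith := ⟨bin .add⟩
instance : Sub Arith := ⟨bin .sub⟩
instance : Mul Arith := ⟨bin .mul⟩
instance : Div Arith := ⟨bin .div⟩
instance : Pow Arith Arith := ⟨bin .pow⟩
instance (n : ℕ) : OfNat Arith n := ⟨c n⟩

end Arith

/-- Total version of `BinOp.eval`. -/
noncomputable def BinOp.val (op : BinOp) (x y : ℝ) : ℝ :=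
  match op with
  | .add => x + y
  | .sub => x - y
  | .mul => x * y
  | .div => x / y
  | .pow => x ^ y

/-- The operation is defined. -/
def BinOp.Ok (op : BinOp) (x y : ℝ) : Prop :=
  match op with
  | .add | .sub | .mul => True
  | .div => y ≠ 0
  | .pow => 0 < x

theorem BinOp.eval_eq {op : BinOp} {x y : ℝ} (h : op.Ok x y) : op.eval x y = some (op.val x y) := by
  cases op <;> simp_all [BinOp.eval, BinOp.val, BinOp.Ok]

namespace Arith

/-- Value of a term. -/
noncomputable def eval (ρ : ℕ → ℝ) : Arith → ℝ
  | c n => n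
  | v r => ρ r
  | bin op s t => op.val (s.eval ρ) (t.eval ρ)
  | log s => Real.log (s.eval ρ)
  | floor s => (⌊s.eval ρ⌋ : ℝ)

/-- All operations in the term are defined. -/
def Ok (ρ : ℕ → ℝ) : Arith → Prop
  | c _ => True
  | v _ => True
  | bin op s t => s.Ok ρ ∧ t.Ok ρ ∧ op.Ok (s.eval ρ) (t.eval ρ)
  | log s => s.Ok ρ ∧ 0 < s.eval ρ
  | floor s => s.Ok ρ

/-- A program that computes the term into the temporary with number `t`. -/
def compile : Arith → ℕ → Prog
  | c n, t => .instr (.const (2 * t + 1) n)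
  -- No instruction copies a register, so a copy is an addition to zero.
  | v r, t => .seq (.instr (.const (2 * t + 1) 0))
      (.instr (.bin .add (2 * t + 1) (2 * r) (2 * t + 1)))
  | bin op a b, t => .seq (a.compile t) (.seq (b.compile (t + 1))
      (.instr (.bin op (2 * t + 1) (2 * t + 1) (2 * (t + 1) + 1))))
  | log a, t => .seq (a.compile t) (.instr (.log (2 * t + 1) (2 * t + 1)))
  | floor a, t => .seq (a.compile t) (.instr (.floor (2 * t + 1) (2 * t + 1)))

variable (ρ : ℕ → ℝ) (s t : Arith) (n : ℕ)

@[simp] theorem eval_v (r : ℕ) : (v r).eval ρ = ρ r := rfl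
@[simp] theorem eval_add : (s + t).eval ρ = s.eval ρ + t.eval ρ := rfl
@[simp] theorem eval_sub : (s - t).eval ρ = s.eval ρ - t.eval ρ := rfl
@[simp] theorem eval_mul : (s * t).eval ρ = s.eval ρ * t.eval ρ := rfl
@[simp] theorem eval_div : (s / t).eval ρ = s.eval ρ / t.eval ρ := rfl
@[simp] theorem eval_pow : (s ^ t).eval ρ = s.eval ρ ^ t.eval ρ := rfl
@[simp] theorem eval_log : (log s).eval ρ = Real.log (s.eval ρ) := rfl
@[simp] theorem eval_floor : (floor s).eval ρ = (⌊s.eval ρ⌋ : ℝ) := rfl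
@[simp] theorem eval_ofNat [n.AtLeastTwo] : (ofNat(n) : Arith).eval ρ = OfNat.ofNat n := by
  exact Int.cast_natCast n
@[simp] theorem eval_zero : (0 : Arith).eval ρ = 0 := by
  change (((0 : ℕ) : ℤ) : ℝ) = _
  simp
@[simp] theorem eval_one : (1 : Arith).eval ρ = 1 := by
  change (((1 : ℕ) : ℤ) : ℝ) = _
  simp

@[simp] theorem ok_ofNat : (ofNat(n) : Arith).Ok ρ := trivial
@[simp] theorem ok_zero : (0 : Arith).Ok ρ := trivial
@[simp] theorem ok_one : (1 : Arith).Ok ρ := trivial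
@[simp] theorem ok_v (r : ℕ) : (v r).Ok ρ := trivial
@[simp] theorem ok_add : (s + t).Ok ρ ↔ s.Ok ρ ∧ t.Ok ρ :=
  ⟨fun h => ⟨h.1, h.2.1⟩, fun h => ⟨h.1, h.2, trivial⟩⟩
@[simp] theorem ok_sub : (s - t).Ok ρ ↔ s.Ok ρ ∧ t.Ok ρ :=
  ⟨fun h => ⟨h.1, h.2.1⟩, fun h => ⟨h.1, h.2, trivial⟩⟩
@[simp] theorem ok_mul : (s * t).Ok ρ ↔ s.Ok ρ ∧ t.Ok ρ :=
  ⟨fun h => ⟨h.1, h.2.1⟩, fun h => ⟨h.1, h.2, trivial⟩⟩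
@[simp] theorem ok_div : (s / t).Ok ρ ↔ s.Ok ρ ∧ t.Ok ρ ∧ t.eval ρ ≠ 0 := Iff.rfl
@[simp] theorem ok_pow : (s ^ t).Ok ρ ↔ s.Ok ρ ∧ t.Ok ρ ∧ 0 < s.eval ρ := Iff.rfl
@[simp] theorem ok_log : (log s).Ok ρ ↔ s.Ok ρ ∧ 0 < s.eval ρ := Iff.rfl
@[simp] theorem ok_floor : (floor s).Ok ρ ↔ s.Ok ρ := Iff.rfl

end Arith

/-- The values of the program variables. -/
def State.view (σ : State) : ℕ → ℝ := fun i => σ.reg (2 * i)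

theorem State.view_set_odd (σ : State) (t : ℕ) (x : ℝ) : (σ.set (2 * t + 1) x).view = σ.view := by
  funext i
  simp only [State.view, State.set]
  rw [Function.update_of_ne (by omega)]

theorem State.view_set_even (σ : State) (r : ℕ) (x : ℝ) :
    (σ.set (2 * r) x).view = Function.update σ.view r x := by
  funext i
  simp only [State.view, State.set, Function.update_apply]
  congr 1
  simp

theorem State.set_reg_self (σ : State) (r : ℕ) (x : ℝ) : (σ.set r x).reg r = x := by
  simp [State.set]

theorem State.set_reg_ne (σ : State) {r i : ℕ} (h : i ≠ r) (x : ℝ) :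
    (σ.set r x).reg i = σ.reg i := by
  simp [State.set, Function.update_of_ne h]

theorem State.set_out (σ : State) (r : ℕ) (x : ℝ) : (σ.set r x).out = σ.out := rfl

variable {O : Fin 2 → SetData}

/-- Only temporaries from `t` on are written. The clause on smaller temporaries is what the
induction needs: the left operand, stored in temporary `t`, must survive the evaluation of the right
one. -/
theorem Arith.exec_compile (a : Arith) (t : ℕ) (σ : State) (h : a.Ok σ.view) :
    ∃ τ n, Exec O (a.compile t) σ τ n ∧ τ.out = σ.out ∧ τ.view = σ.view ∧
      τ.reg (2 * t + 1) = a.eval σ.view ∧ ∀ i < t, τ.reg (2 * i + 1) = σ.reg (2 * i + 1) := by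
  induction a generalizing t σ with
  | c n =>
    refine ⟨_, _, Exec.instr rfl, rfl, State.view_set_odd _ _ _, State.set_reg_self _ _ _, ?_⟩
    intro i hi
    exact State.set_reg_ne _ (by omega) _
  | v r =>
    refine ⟨_, _, Exec.seq (Exec.instr rfl) (Exec.instr rfl), rfl, ?_, ?_, ?_⟩
    · rw [State.view_set_odd, State.view_set_odd]
    · rw [State.set_reg_self, State.set_reg_self, State.set_reg_ne _ (by omega)]
      simp [State.view]
    · intro i hi
      rw [State.set_reg_ne _ (by omega), State.set_reg_ne _ (by omega)]
  | bin op a b iha ihb =>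
    obtain ⟨ha, hb, hop⟩ := h
    obtain ⟨τ, n, h1, h2, h3, h4, h5⟩ := iha t σ ha
    obtain ⟨τ', n', h1', h2', h3', h4', h5'⟩ := ihb (t + 1) τ (by rwa [h3])
    have e1 : τ'.reg (2 * t + 1) = a.eval σ.view := by rw [h5' t (by omega), h4]
    have e2 : τ'.reg (2 * (t + 1) + 1) = b.eval σ.view := by rw [h4', h3]
    refine ⟨τ'.set (2 * t + 1) (op.val (a.eval σ.view) (b.eval σ.view)), _,
      Exec.seq h1 (Exec.seq h1' (Exec.instr ?_)), ?_, ?_, State.set_reg_self _ _ _, ?_⟩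
    · simp only [Instr.step, e1, e2, BinOp.eval_eq hop, Option.map_some]
    · rw [State.set_out, h2', h2]
    · rw [State.view_set_odd, h3', h3]
    · intro i hi
      rw [State.set_reg_ne _ (by omega), h5' i (by omega), h5 i hi]
  | log a iha =>
    obtain ⟨ha, hp⟩ := h
    obtain ⟨τ, n, h1, h2, h3, h4, h5⟩ := iha t σ ha
    refine ⟨τ.set (2 * t + 1) (Real.log (a.eval σ.view)), _, Exec.seq h1 (Exec.instr ?_), h2, ?_,
      State.set_reg_self _ _ _, ?_⟩
    · simp only [Instr.step, h4, if_pos hp]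
    · rw [State.view_set_odd, h3]
    · intro i hi
      rw [State.set_reg_ne _ (by omega), h5 i hi]
  | floor a iha =>
    obtain ⟨τ, n, h1, h2, h3, h4, h5⟩ := iha t σ h
    refine ⟨τ.set (2 * t + 1) (⌊a.eval σ.view⌋ : ℝ), _, Exec.seq h1 (Exec.instr ?_), h2, ?_,
      State.set_reg_self _ _ _, ?_⟩
    · simp only [Instr.step, h4]
    · rw [State.view_set_odd, h3]
    · intro i hi
      rw [State.set_reg_ne _ (by omega), h5 i hi]

/-- Started with values `ρ` of the variables and with outputs `out`, the program `P` halts, and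
`Q` holds for the new values, the new outputs, and the number of steps. -/
def Runs (O : Fin 2 → SetData) (P : Prog) (ρ : ℕ → ℝ) (out : List ZOmega)
    (Q : (ℕ → ℝ) → List ZOmega → ℕ → Prop) : Prop :=
  ∀ σ : State, σ.view = ρ → σ.out = out → ∃ τ n, Exec O P σ τ n ∧ Q τ.view τ.out n

variable {P P' : Prog} {ρ : ℕ → ℝ} {out : List ZOmega} {Q Q' : (ℕ → ℝ) → List ZOmega → ℕ → Prop}

theorem Runs.mono (h : Runs O P ρ out Q) (hQ : ∀ ρ' out' n, Q ρ' out' n → Q' ρ' out' n) :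
    Runs O P ρ out Q' := by
  intro σ h1 h2
  obtain ⟨τ, n, h3, h4⟩ := h σ h1 h2
  exact ⟨τ, n, h3, hQ _ _ _ h4⟩

theorem Runs.seq (h : Runs O P ρ out fun ρ' out' n =>
    Runs O P' ρ' out' fun ρ'' out'' m => Q ρ'' out'' (n + m)) :
    Runs O (.seq P P') ρ out Q := by
  intro σ h1 h2
  obtain ⟨τ, n, h3, h4⟩ := h σ h1 h2
  obtain ⟨τ', n', h5, h6⟩ := h4 τ rfl rfl
  exact ⟨τ', _, Exec.seq h3 h5, h6⟩

/-- A program that does nothing. -/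
def skip : Prog := .instr (.const 1 0)

/-- `P₁; …; Pₙ` -/
def seqs : List Prog → Prog
  | [] => skip
  | P :: l => .seq P (seqs l)

/-- `r := a` -/
def asg (r : ℕ) (a : Arith) : Prog :=
  .seq (a.compile 0) (.seq (.instr (.const 3 0)) (.instr (.bin .add (2 * r) 1 3)))

/-- A sequence of assignments. -/
def asgs : List (ℕ × Arith) → Prog
  | [] => skip
  | p :: l => .seq (asg p.1 p.2) (asgs l)

/-- Branching on `a < b` for terms. -/
def cond (a b : Arith) (P P' : Prog) : Prog :=
  .seq (a.compile 0) (.seq (b.compile 1) (.ifLt 1 3 P P'))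

/-- `while x < y` for variables. -/
def loop (x y : ℕ) (P : Prog) : Prog := .whileLt (2 * x) (2 * y) P

/-- The values after a sequence of assignments. -/
noncomputable def assignAll : List (ℕ × Arith) → (ℕ → ℝ) → ℕ → ℝ
  | [], ρ => ρ
  | p :: l, ρ => assignAll l (Function.update ρ p.1 (p.2.eval ρ))

/-- All terms in the sequence of assignments are defined when they are evaluated. -/
def AssignOk : List (ℕ × Arith) → (ℕ → ℝ) → Prop
  | [], _ => True
  | p :: l, ρ => p.2.Ok ρ ∧ AssignOk l (Function.update ρ p.1 (p.2.eval ρ))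

@[simp] theorem assignAll_nil : assignAll [] ρ = ρ := rfl
@[simp] theorem assignAll_cons (r : ℕ) (a : Arith) (l : List (ℕ × Arith)) :
    assignAll ((r, a) :: l) ρ = assignAll l (Function.update ρ r (a.eval ρ)) := rfl
@[simp] theorem assignOk_nil : AssignOk [] ρ := trivial
@[simp] theorem assignOk_cons (r : ℕ) (a : Arith) (l : List (ℕ × Arith)) :
    AssignOk ((r, a) :: l) ρ ↔ a.Ok ρ ∧ AssignOk l (Function.update ρ r (a.eval ρ)) := Iff.rfl

theorem assignAll_of_notMem {l : List (ℕ × Arith)} {i : ℕ} (h : ∀ p ∈ l, p.1 ≠ i) (ρ : ℕ → ℝ) :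
    assignAll l ρ i = ρ i := by
  induction l generalizing ρ with
  | nil => rfl
  | cons p l ih =>
    rw [assignAll, ih fun q hq => h q (List.mem_cons_of_mem _ hq)]
    exact Function.update_of_ne (h p List.mem_cons_self).symm _ _

theorem runs_skip (h : Q ρ out 1) : Runs O skip ρ out Q := by
  intro σ h1 h2
  refine ⟨_, _, Exec.instr rfl, ?_⟩
  have := State.view_set_odd σ 0 ((0 : ℤ) : ℝ)
  rw [State.set_out, h2]
  change Q ((σ.set (2 * 0 + 1) ((0 : ℤ) : ℝ)).view) out 1
  rwa [this, h1]

theorem runs_seqs_nil (h : Q ρ out 1) : Runs O (seqs []) ρ out Q := runs_skip h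

theorem runs_seqs_cons {l : List Prog} (h : Runs O P ρ out fun ρ' out' n =>
    Runs O (seqs l) ρ' out' fun ρ'' out'' m => Q ρ'' out'' (n + m)) :
    Runs O (seqs (P :: l)) ρ out Q := Runs.seq h

theorem runs_asg {r : ℕ} {a : Arith} (ha : a.Ok ρ)
    (h : ∀ n, Q (Function.update ρ r (a.eval ρ)) out n) : Runs O (asg r a) ρ out Q := by
  intro σ h1 h2
  obtain ⟨τ, n, h3, h4, h5, h6, -⟩ := a.exec_compile (O := O) 0 σ (by rwa [h1])
  refine ⟨_, _, Exec.seq h3 (Exec.seq (Exec.instr rfl) (Exec.instr rfl)), ?_⟩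
  rw [State.view_set_even, State.set_out, State.set_out, h4, h2, State.set_reg_self,
    State.set_reg_ne _ (by norm_num)]
  have := State.view_set_odd τ 1 ((0 : ℤ) : ℝ)
  norm_num at this h6 ⊢
  rw [this, h5, h1, h6, h1]
  exact h _

theorem runs_asgs {l : List (ℕ × Arith)} (hl : AssignOk l ρ)
    (h : ∀ n, Q (assignAll l ρ) out n) : Runs O (asgs l) ρ out Q := by
  induction l generalizing ρ Q with
  | nil => exact runs_skip (h _)
  | cons p l ih => exact Runs.seq (runs_asg hl.1 fun n => ih hl.2 fun m => h _)

/-- Loops with an invariant `I`, in which the number of steps made so far occurs, and a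
variant `V`. -/
theorem runs_loop {x y : ℕ} (I : (ℕ → ℝ) → List ZOmega → ℕ → Prop) (V : (ℕ → ℝ) → ℕ)
    (hI : I ρ out 0)
    (hstep : ∀ ρ out t, I ρ out t → ρ x < ρ y →
      Runs O P ρ out fun ρ' out' n => I ρ' out' (t + n + 1) ∧ V ρ' < V ρ) :
    Runs O (loop x y P) ρ out fun ρ' out' n =>
      ∃ t, n = t + 1 ∧ I ρ' out' t ∧ ¬ ρ' x < ρ' y := by
  -- Strong induction on the variant, from an arbitrary state in which `t` steps are already spent.
  -- The `- 1` takes off the final, failing comparison, which the invariant does not count.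
  suffices H : ∀ k ρ out t, V ρ = k → I ρ out t → Runs O (loop x y P) ρ out fun ρ' out' n =>
      I ρ' out' (t + n - 1) ∧ ¬ ρ' x < ρ' y ∧ 1 ≤ n by
    refine (H _ ρ out 0 rfl hI).mono fun ρ' out' n h => ⟨n - 1, by omega, ?_, h.2.1⟩
    simpa using h.1
  intro k
  induction k using Nat.strong_induction_on with
  | _ k ih =>
    intro ρ out t hV hI σ h1 h2
    by_cases hlt : ρ x < ρ y
    · obtain ⟨τ, n, h3, h4, h5⟩ := hstep ρ out t hI hlt σ h1 h2
      obtain ⟨υ, m, h6, h7, h8, h9⟩ := ih _ (hV ▸ h5) _ _ _ rfl h4 τ rfl rfl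
      refine ⟨υ, _, Exec.whileStep (by rw [← h1] at hlt; exact hlt) h3 h6, ?_, h8, by omega⟩
      convert h7 using 1
      omega
    · refine ⟨σ, 1, Exec.whileDone (by rw [← h1] at hlt; exact hlt), ?_, by rwa [h1], le_rfl⟩
      rw [h1, h2]
      exact hI

/-- Number of steps of programs without loops. -/
def size : Prog → ℕ
  | .instr _ => 1
  | .seq P Q => size P + size Q
  | .ifLt _ _ P Q => size P + size Q + 1
  | .whileLt _ _ _ => 0

/-- There is no loop in the program. -/
def LoopFree : Prog → Prop
  | .instr _ => True
  | .seq P Q => LoopFree P ∧ LoopFree Q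
  | .ifLt _ _ P Q => LoopFree P ∧ LoopFree Q
  | .whileLt _ _ _ => False

/-- An upper bound only, as `size` adds up both branches of a conditional. It is independent of the
state, so the cost of a loop-free piece is a constant that can be carried along unevaluated. -/
theorem LoopFree.exec_le {P : Prog} (hP : LoopFree P) {σ τ : State} {n : ℕ}
    (h : Exec O P σ τ n) : n ≤ size P := by
  induction h with
  | instr _ => exact le_rfl
  | seq _ _ ih1 ih2 => exact add_le_add (ih1 hP.1) (ih2 hP.2)
  | ifTrue _ _ ih => have := ih hP.1; simp only [size]; omega
  | ifFalse _ _ ih => have := ih hP.2; simp only [size]; omega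
  | whileStep => exact hP.elim
  | whileDone => exact hP.elim

theorem Runs.and_size (h : Runs O P ρ out Q) (hP : LoopFree P) :
    Runs O P ρ out fun ρ' out' n => Q ρ' out' n ∧ n ≤ size P := by
  intro σ h1 h2
  obtain ⟨τ, n, h3, h4⟩ := h σ h1 h2
  exact ⟨τ, n, h3, h4, hP.exec_le h3⟩

theorem loopFree_compile (a : Arith) (t : ℕ) : LoopFree (a.compile t) := by
  induction a generalizing t with
  | c => trivial
  | v => exact ⟨trivial, trivial⟩
  | bin op a b iha ihb => exact ⟨iha _, ihb _, trivial⟩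
  | log a ih => exact ⟨ih _, trivial⟩
  | floor a ih => exact ⟨ih _, trivial⟩

theorem loopFree_asg (r : ℕ) (a : Arith) : LoopFree (asg r a) :=
  ⟨loopFree_compile _ _, trivial, trivial⟩

theorem loopFree_asgs (l : List (ℕ × Arith)) : LoopFree (asgs l) := by
  induction l with
  | nil => trivial
  | cons p l ih => exact ⟨loopFree_asg _ _, ih⟩

theorem loopFree_cond {a b : Arith} (h : LoopFree P) (h' : LoopFree P') :
    LoopFree (cond a b P P') := ⟨loopFree_compile _ _, loopFree_compile _ _, h, h'⟩

theorem loopFree_seqs {l : List Prog} (h : ∀ P ∈ l, LoopFree P) : LoopFree (seqs l) := by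
  induction l with
  | nil => trivial
  | cons P l ih => exact ⟨h P List.mem_cons_self, ih fun P' hP' => h P' (List.mem_cons_of_mem _ hP')⟩

theorem runs_asgs_size {l : List (ℕ × Arith)} (hl : AssignOk l ρ)
    (h : ∀ n ≤ size (asgs l), Q (assignAll l ρ) out n) : Runs O (asgs l) ρ out Q := by
  refine ((runs_asgs (Q := fun ρ' out' _ => ρ' = assignAll l ρ ∧ out' = out) hl
    fun _ => ⟨rfl, rfl⟩).and_size (loopFree_asgs l)).mono ?_
  rintro _ _ n ⟨⟨rfl, rfl⟩, hn⟩
  exact h n hn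

/-- The cost `m` of evaluating the terms and comparing them is not computed; the postcondition is
required for all values up to the bound. -/
theorem runs_cond_size {a b : Arith} (ha : a.Ok ρ) (hb : b.Ok ρ)
    (ht : a.eval ρ < b.eval ρ → Runs O P ρ out fun ρ' out' n =>
      ∀ m ≤ size (a.compile 0) + size (b.compile 1) + 1, Q ρ' out' (m + n))
    (hf : ¬ a.eval ρ < b.eval ρ → Runs O P' ρ out fun ρ' out' n =>
      ∀ m ≤ size (a.compile 0) + size (b.compile 1) + 1, Q ρ' out' (m + n)) :
    Runs O (cond a b P P') ρ out Q := by
  intro σ h1 h2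
  obtain ⟨τ, n, h3, h4, h5, h6, -⟩ := a.exec_compile (O := O) 0 σ (by rwa [h1])
  obtain ⟨υ, m, k3, k4, k5, k6, k7⟩ := b.exec_compile (O := O) 1 τ (by rwa [h5, h1])
  have e1 : υ.reg 1 = a.eval ρ := by
    have := k7 0 (by norm_num)
    norm_num at this h6
    rw [this, h6, h1]
  have e3 : υ.reg 3 = b.eval ρ := by
    norm_num at k6
    rw [k6, h5, h1]
  by_cases hlt : a.eval ρ < b.eval ρ
  · obtain ⟨τ', n', h7, h8⟩ := ht hlt υ (by rw [k5, h5, h1]) (by rw [k4, h4, h2])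
    refine ⟨τ', _, Exec.seq h3 (Exec.seq k3 (Exec.ifTrue (by rwa [e1, e3]) h7)), ?_⟩
    have := h8 (n + m + 1) (by
      have := (loopFree_compile a 0).exec_le h3
      have := (loopFree_compile b 1).exec_le k3
      omega)
    convert this using 1
    omega
  · obtain ⟨τ', n', h7, h8⟩ := hf hlt υ (by rw [k5, h5, h1]) (by rw [k4, h4, h2])
    refine ⟨τ', _, Exec.seq h3 (Exec.seq k3 (Exec.ifFalse (by rwa [e1, e3]) h7)), ?_⟩
    have := h8 (n + m + 1) (by
      have := (loopFree_compile a 0).exec_le h3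
      have := (loopFree_compile b 1).exec_le k3
      omega)
    convert this using 1
    omega

/-- For postconditions that ignore the number of steps; the cost is then recovered from
`Runs.and_size`. -/
theorem runs_cond {a b : Arith} (ha : a.Ok ρ) (hb : b.Ok ρ)
    (ht : a.eval ρ < b.eval ρ → Runs O P ρ out fun ρ' out' n => ∀ m, Q ρ' out' (m + n))
    (hf : ¬ a.eval ρ < b.eval ρ → Runs O P' ρ out fun ρ' out' n => ∀ m, Q ρ' out' (m + n)) :
    Runs O (cond a b P P') ρ out Q :=
  runs_cond_size ha hb (fun h => (ht h).mono fun _ _ _ h' m _ => h' m)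
    fun h => (hf h).mono fun _ _ _ h' m _ => h' m

/-! ### Access to the sets -/

/-- Read the number of vertices. -/
def askSize (s : Fin 2) (r : ℕ) : Prog := .instr (.size s (2 * r))

/-- Read a vertex. -/
def askVertex (s : Fin 2) (i rx ry : ℕ) : Prog := .instr (.vertex s (2 * i) (2 * rx) (2 * ry))

/-- Membership test. -/
def askMember (s : Fin 2) (x y r : ℕ) : Prog := .instr (.member s (2 * x) (2 * y) (2 * r))

/-- Line query. -/
def askLine (s : Fin 2) (px py qx qy r ra rb : ℕ) : Prog :=
  .instr (.line s (2 * px) (2 * py) (2 * qx) (2 * qy) (2 * r) (2 * ra) (2 * rb))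

/-- Output. -/
def output (a b c d : ℕ) : Prog := .instr (.emit (2 * a) (2 * b) (2 * c) (2 * d))

theorem runs_askSize {s : Fin 2} {r : ℕ}
    (h : Q (Function.update ρ r (O s).vertices.length) out 1) : Runs O (askSize s r) ρ out Q := by
  intro σ h1 h2
  refine ⟨_, _, Exec.instr rfl, ?_⟩
  rw [State.view_set_even, State.set_out, h1, h2]
  exact h

theorem runs_askVertex {s : Fin 2} {i rx ry k : ℕ} (hk : ρ i = k)
    (hlt : k < (O s).vertices.length)
    (h : Q (Function.update (Function.update ρ rx ((O s).vertices[k].re)) ry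
      ((O s).vertices[k].im)) out 1) : Runs O (askVertex s i rx ry) ρ out Q := by
  intro σ h1 h2
  have e : σ.reg (2 * i) = k := by rw [← hk, ← h1]; rfl
  refine ⟨_, _, Exec.instr (τ := (σ.set (2 * rx) (O s).vertices[k].re).set (2 * ry)
    (O s).vertices[k].im) ?_, ?_⟩
  · simp [Instr.step, e, hlt]
  · rw [State.view_set_even, State.view_set_even, State.set_out, State.set_out, h1, h2]
    exact h

open Classical in
theorem runs_askMember {s : Fin 2} {x y r : ℕ}
    (h : Q (Function.update ρ r (if (O s).mem ⟨ρ x, ρ y⟩ = true then 1 else 0)) out 1) :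
    Runs O (askMember s x y r) ρ out Q := by
  intro σ h1 h2
  refine ⟨_, _, Exec.instr rfl, ?_⟩
  rw [State.view_set_even, State.set_out, h1, h2]
  subst h1
  exact h

theorem runs_askLine {s : Fin 2} {px py qx qy r ra rb : ℕ}
    (h₀ : (O s).line ⟨ρ px, ρ py⟩ ⟨ρ qx, ρ qy⟩ = none → Q (Function.update ρ r 0) out 1)
    (h₁ : ∀ x y, (O s).line ⟨ρ px, ρ py⟩ ⟨ρ qx, ρ qy⟩ = some (x, y) →
      Q (Function.update (Function.update (Function.update ρ ra x) rb y) r 1) out 1) :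
    Runs O (askLine s px py qx qy r ra rb) ρ out Q := by
  intro σ h1 h2
  subst h1
  cases hl : (O s).line ⟨σ.view px, σ.view py⟩ ⟨σ.view qx, σ.view qy⟩ with
  | none =>
    refine ⟨σ.set (2 * r) 0, _, Exec.instr ?_, ?_⟩
    · simp only [State.view] at hl
      simp only [Instr.step, hl]
    · rw [State.view_set_even, State.set_out, h2]
      exact h₀ hl
  | some xy =>
    obtain ⟨x, y⟩ := xy
    refine ⟨((σ.set (2 * ra) x).set (2 * rb) y).set (2 * r) 1, _, Exec.instr ?_, ?_⟩
    · simp only [State.view] at hl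
      simp only [Instr.step, hl]
    · rw [State.view_set_even, State.view_set_even, State.view_set_even, State.set_out,
        State.set_out, State.set_out, h2]
      exact h₁ x y hl

theorem runs_output {a b c d : ℕ} {u : ZOmega} (ha : ρ a = u.a) (hb : ρ b = u.b)
    (hc : ρ c = u.c) (hd : ρ d = u.d) (h : Q ρ (u :: out) 1) :
    Runs O (output a b c d) ρ out Q := by
  intro σ h1 h2
  subst h1
  simp only [State.view] at ha hb hc hd
  refine ⟨⟨σ.reg, u :: σ.out⟩, _, Exec.instr ?_, ?_⟩
  · simp [Instr.step, ha, hb, hc, hd]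
  · rw [h2]
    exact h

end Grid

/-! ## Arithmetic of `ℤ[√2]` and `ℤ[ω]` -/

namespace Grid

open Real

/-- `ℤ[√2]`, embedded by `α ↦ (α, α•)`. -/
def quad : Subring (ℝ × ℝ) where
  carrier := {p | ∃ m n : ℤ, p = (m + n * √2, m - n * √2)}
  mul_mem' := by
    rintro _ _ ⟨m, n, rfl⟩ ⟨m', n', rfl⟩
    refine ⟨m * m' + 2 * n * n', m * n' + n * m', ?_⟩
    have h : √2 * √2 = 2 := Real.mul_self_sqrt (by norm_num)
    ext
    · push_cast
      simp only [Prod.fst_mul]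
      linear_combination (n * n' : ℝ) * h
    · push_cast
      simp only [Prod.snd_mul]
      linear_combination (n * n' : ℝ) * h
  one_mem' := ⟨1, 0, by ext <;> simp⟩
  add_mem' := by
    rintro _ _ ⟨m, n, rfl⟩ ⟨m', n', rfl⟩
    refine ⟨m + m', n + n', ?_⟩
    ext <;> push_cast <;> simp only [Prod.fst_add, Prod.snd_add] <;> ring
  zero_mem' := ⟨0, 0, by ext <;> simp⟩
  neg_mem' := by
    rintro _ ⟨m, n, rfl⟩
    refine ⟨-m, -n, ?_⟩
    ext <;> push_cast <;> simp only [Prod.fst_neg, Prod.snd_neg] <;> ring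

theorem mem_quad {p : ℝ × ℝ} : p ∈ quad ↔ ∃ m n : ℤ, p = (m + n * √2, m - n * √2) := Iff.rfl

theorem sqrt2_mul : √2 * √2 = 2 := Real.mul_self_sqrt (by norm_num)

/-- The totally positive unit `3 + 2√2`. -/
noncomputable def unit : ℝ := 3 + 2 * √2

theorem unit_pos : 0 < unit := by unfold unit; positivity

theorem one_lt_unit : 1 < unit := by
  have := Real.sqrt_nonneg 2
  unfold unit
  linarith

theorem unit_inv : unit⁻¹ = 3 - 2 * √2 := by
  refine inv_eq_of_mul_eq_one_right ?_
  unfold unit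
  linear_combination (-4 : ℝ) * sqrt2_mul

theorem unit_sq_lt : unit ^ 2 < 34 := by
  have h : √2 < 1.415 := by
    rw [Real.sqrt_lt' (by norm_num)]
    norm_num
  have := Real.sqrt_nonneg 2
  unfold unit
  nlinarith

/-- The unit has norm one, so conjugation inverts it. Since it is totally positive, its powers
stretch one coordinate and shrink the other without reflections, and so map rectangles to rectangles
of the same area. -/
theorem unit_zpow_mem (k : ℤ) : (unit ^ k, (unit ^ k)⁻¹) ∈ quad := by
  have h1 : (unit, unit⁻¹) ∈ quad :=
    ⟨3, 2, by rw [unit_inv]; unfold unit; ext <;> push_cast <;> ring⟩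
  have h2 : (unit⁻¹, unit) ∈ quad :=
    ⟨3, -2, by rw [unit_inv]; unfold unit; ext <;> push_cast <;> ring⟩
  cases k with
  | ofNat n =>
    have := pow_mem h1 n
    simpa [Prod.pow_def, zpow_natCast, inv_pow] using this
  | negSucc n =>
    have := pow_mem h2 (n + 1)
    simpa [Prod.pow_def, zpow_negSucc, inv_pow] using this

/-- The power of the unit for which `θ² ≤ x < (3 + 2√2)² θ²`. -/
noncomputable def scale (x : ℝ) : ℝ := unit ^ ⌊Real.log x / (2 * Real.log unit)⌋

theorem scale_pos (x : ℝ) : 0 < scale x := zpow_pos unit_pos _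

theorem scale_mem (x : ℝ) : (scale x, (scale x)⁻¹) ∈ quad := unit_zpow_mem _

theorem scale_mem' (x : ℝ) : ((scale x)⁻¹, scale x) ∈ quad := by
  have := unit_zpow_mem (-⌊Real.log x / (2 * Real.log unit)⌋)
  simpa [scale, zpow_neg] using this

theorem log_unit_pos : 0 < Real.log unit := Real.log_pos one_lt_unit

/-- After taking logarithms this, like `lt_scale_sq`, is an inequality for the floor in the
exponent. Together they approximate `x` by a square of a unit up to a factor below `unit ^ 2 < 34`.
-/
theorem scale_sq_le {x : ℝ} (hx : 0 < x) : scale x ^ 2 ≤ x := by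
  rw [← Real.log_le_log_iff (pow_pos (scale_pos x) 2) hx, Real.log_pow, scale, Real.log_zpow]
  have h := Int.floor_le (Real.log x / (2 * Real.log unit))
  rw [le_div_iff₀ (by have := log_unit_pos; positivity)] at h
  push_cast
  linarith

theorem lt_scale_sq {x : ℝ} (hx : 0 < x) : x < unit ^ 2 * scale x ^ 2 := by
  have := scale_pos x
  have := unit_pos
  rw [← Real.log_lt_log_iff hx (by positivity), Real.log_mul (by positivity) (by positivity),
    Real.log_pow, Real.log_pow, scale, Real.log_zpow]
  have h := Int.lt_floor_add_one (Real.log x / (2 * Real.log unit))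
  rw [div_lt_iff₀ (by have := log_unit_pos; positivity)] at h
  push_cast
  linarith

/-! ### `ℤ[ω]` in coordinates, as a module over `ℤ[√2]` -/

theorem omega_eq : omega = ⟨√2 / 2, √2 / 2⟩ := by
  have : Complex.I * Real.pi / 4 = ((Real.pi / 4 : ℝ) : ℂ) * Complex.I := by
    push_cast
    ring
  rw [omega, this]
  apply Complex.ext
  · rw [Complex.exp_ofReal_mul_I_re, Real.cos_pi_div_four]
  · rw [Complex.exp_ofReal_mul_I_im, Real.sin_pi_div_four]

theorem omega_sq : omega ^ 2 = Complex.I := by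
  have h := sqrt2_mul
  rw [omega_eq, pow_two]
  apply Complex.ext
  · simp
  · simp
    linear_combination h / 2

theorem omega_cube : omega ^ 3 = ⟨-(√2 / 2), √2 / 2⟩ := by
  rw [pow_succ, omega_sq, omega_eq]
  apply Complex.ext <;> simp

theorem ZOmega.toComplex_eq (u : ZOmega) :
    u.toComplex = ⟨u.d + (u.c - u.a) * (√2 / 2), u.b + (u.a + u.c) * (√2 / 2)⟩ := by
  rw [ZOmega.toComplex, omega_cube, omega_sq, omega_eq]
  apply Complex.ext <;> simp <;> ring

/-- `u ↦ (u, u•)` -/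
noncomputable def ZOmega.emb (u : ZOmega) : ℂ × ℂ := (u.toComplex, u.bul.toComplex)

theorem pair_ext {z w : ℂ × ℂ} (h1 : z.1.re = w.1.re) (h2 : z.1.im = w.1.im)
    (h3 : z.2.re = w.2.re) (h4 : z.2.im = w.2.im) : z = w :=
  Prod.ext (Complex.ext h1 h2) (Complex.ext h3 h4)

/-- `ℤ[ω]`, embedded by `u ↦ (u, u•)`. -/
def zomega : Set (ℂ × ℂ) := Set.range ZOmega.emb

/-- Componentwise scalar multiplication. -/
noncomputable def act (α : ℝ × ℝ) (z : ℂ × ℂ) : ℂ × ℂ := (α.1 • z.1, α.2 • z.2)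

@[simp] theorem act_fst (α : ℝ × ℝ) (z : ℂ × ℂ) : (act α z).1 = α.1 • z.1 := rfl
@[simp] theorem act_snd (α : ℝ × ℝ) (z : ℂ × ℂ) : (act α z).2 = α.2 • z.2 := rfl

theorem add_mem_zomega {z w : ℂ × ℂ} (hz : z ∈ zomega) (hw : w ∈ zomega) : z + w ∈ zomega := by
  obtain ⟨u, rfl⟩ := hz
  obtain ⟨v, rfl⟩ := hw
  refine ⟨⟨u.a + v.a, u.b + v.b, u.c + v.c, u.d + v.d⟩, ?_⟩
  simp only [ZOmega.emb, ZOmega.toComplex_eq, ZOmega.bul]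
  apply pair_ext <;> push_cast <;> simp <;> ring

theorem neg_mem_zomega {z : ℂ × ℂ} (hz : z ∈ zomega) : -z ∈ zomega := by
  obtain ⟨u, rfl⟩ := hz
  refine ⟨⟨-u.a, -u.b, -u.c, -u.d⟩, ?_⟩
  simp only [ZOmega.emb, ZOmega.toComplex_eq, ZOmega.bul]
  apply pair_ext <;> push_cast <;> simp <;> ring

theorem act_mem_zomega {α : ℝ × ℝ} {z : ℂ × ℂ} (hα : α ∈ quad) (hz : z ∈ zomega) :
    act α z ∈ zomega := by
  obtain ⟨u, rfl⟩ := hz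
  obtain ⟨m, n, rfl⟩ := hα
  have h := sqrt2_mul
  -- From `√2 = ω - ω³`: multiplication by `√2` sends `(a, b, c, d)` to `(b - d, a + c, b + d, c -
  -- a)`.
  refine ⟨⟨m * u.a + n * (u.b - u.d), m * u.b + n * (u.a + u.c), m * u.c + n * (u.b + u.d),
    m * u.d + n * (u.c - u.a)⟩, ?_⟩
  simp only [ZOmega.emb, ZOmega.toComplex_eq, ZOmega.bul]
  apply pair_ext <;> push_cast <;> simp
  · linear_combination -(n * (u.c - u.a) / 2 : ℝ) * h
  · linear_combination -(n * (u.c + u.a) / 2 : ℝ) * h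
  · linear_combination -(n * (u.c - u.a) / 2 : ℝ) * h
  · linear_combination -(n * (u.c + u.a) / 2 : ℝ) * h

/-- The determinant of two vectors of the plane. -/
def cdet (z w : ℂ) : ℝ := z.re * w.im - z.im * w.re

/-- Determinants of elements of `ℤ[ω]` have at worst the denominator `√2`. The sign in the second
entry appears because conjugation also acts on the factor `√2`. -/
theorem cdet_mem_quad {z w : ℂ × ℂ} (hz : z ∈ zomega) (hw : w ∈ zomega) :
    (√2 * cdet z.1 w.1, -(√2 * cdet z.2 w.2)) ∈ quad := by
  obtain ⟨u, rfl⟩ := hz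
  obtain ⟨v, rfl⟩ := hw
  have h := sqrt2_mul
  refine ⟨u.d * (v.a + v.c) + (u.c - u.a) * v.b - u.b * (v.c - v.a) - (u.a + u.c) * v.d,
    u.d * v.b - u.b * v.d + u.c * v.a - u.a * v.c, ?_⟩
  simp only [ZOmega.emb, ZOmega.toComplex_eq, ZOmega.bul, cdet]
  ext
  · push_cast
    linear_combination (u.d * (v.a + v.c) + (u.c - u.a) * v.b - u.b * (v.c - v.a)
      - (u.a + u.c) * v.d + √2 * (u.c * v.a - u.a * v.c)) / 2 * h
  · push_cast
    linear_combination (u.d * (v.a + v.c) + (u.c - u.a) * v.b - u.b * (v.c - v.a)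
      - (u.a + u.c) * v.d - √2 * (u.c * v.a - u.a * v.c)) / 2 * h

/-- The coefficients of the element `u` with `(u, u•) = z`. -/
noncomputable def decode (z : ℂ × ℂ) : ZOmega :=
  ⟨⌊((z.1.im - z.2.im) - (z.1.re - z.2.re)) / (2 * √2)⌋, ⌊(z.1.im + z.2.im) / 2⌋,
    ⌊((z.1.im - z.2.im) + (z.1.re - z.2.re)) / (2 * √2)⌋, ⌊(z.1.re + z.2.re) / 2⌋⟩

/-- Conjugation changes the sign of the odd powers of `ω`, so sums of the two embeddings isolate `b,
d` and differences isolate `a, c`. On `zomega` the floors in `decode` are therefore taken of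
integers. -/
theorem ZOmega.emb_coeff (u : ZOmega) :
    ((u.emb.1.im - u.emb.2.im) - (u.emb.1.re - u.emb.2.re)) / (2 * √2) = u.a ∧
    (u.emb.1.im + u.emb.2.im) / 2 = u.b ∧
    ((u.emb.1.im - u.emb.2.im) + (u.emb.1.re - u.emb.2.re)) / (2 * √2) = u.c ∧
    (u.emb.1.re + u.emb.2.re) / 2 = u.d := by
  have h : (0 : ℝ) < 2 * √2 := by positivity
  simp only [ZOmega.emb, ZOmega.toComplex_eq, ZOmega.bul]
  push_cast
  refine ⟨?_, by ring, ?_, by ring⟩ <;> rw [div_eq_iff h.ne'] <;> ring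

theorem decode_emb (u : ZOmega) : decode u.emb = u := by
  obtain ⟨h1, h2, h3, h4⟩ := u.emb_coeff
  simp [decode, h1, h2, h3, h4]

theorem emb_decode {z : ℂ × ℂ} (hz : z ∈ zomega) : (decode z).emb = z := by
  obtain ⟨u, rfl⟩ := hz
  rw [decode_emb]

theorem decode_coeff {z : ℂ × ℂ} (hz : z ∈ zomega) :
    ((z.1.im - z.2.im) - (z.1.re - z.2.re)) / (2 * √2) = (decode z).a ∧
    (z.1.im + z.2.im) / 2 = (decode z).b ∧
    ((z.1.im - z.2.im) + (z.1.re - z.2.re)) / (2 * √2) = (decode z).c ∧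
    (z.1.re + z.2.re) / 2 = (decode z).d := by
  have := (decode z).emb_coeff
  rwa [emb_decode hz] at this

theorem mem_DOmega_fst {z : ℂ × ℂ} (hz : z ∈ zomega) : z.1 ∈ DOmega := by
  obtain ⟨u, rfl⟩ := hz
  exact ⟨u, 0, by simp [ZOmega.emb]⟩

theorem mem_DOmega_snd {z : ℂ × ℂ} (hz : z ∈ zomega) : z.2 ∈ DOmega := by
  obtain ⟨u, rfl⟩ := hz
  exact ⟨u.bul, 0, by simp [ZOmega.emb]⟩

/-- A `ℤ[√2]`-basis of `ℤ[ω]` with positive orientation. -/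
structure IsBasis (e f : ℂ × ℂ) : Prop where
  left : e ∈ zomega
  right : f ∈ zomega
  det_fst : √2 * cdet e.1 f.1 = 1
  det_snd : √2 * cdet e.2 f.2 = -1

namespace IsBasis

variable {e f : ℂ × ℂ} (h : IsBasis e f)

include h

theorem swap : IsBasis f (-e) := by
  refine ⟨h.right, neg_mem_zomega h.left, ?_, ?_⟩
  · rw [← h.det_fst]
    simp [cdet]
    ring
  · rw [← h.det_snd]
    simp [cdet]
    ring

theorem sub_act {α : ℝ × ℝ} (hα : α ∈ quad) : IsBasis e (f - act α e) := by
  refine ⟨h.left, ?_, ?_, ?_⟩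
  · rw [sub_eq_add_neg]
    exact add_mem_zomega h.right (neg_mem_zomega (act_mem_zomega hα h.left))
  · rw [← h.det_fst]
    simp [cdet]
    ring
  · rw [← h.det_snd]
    simp [cdet]
    ring

theorem ne_zero_fst : e.1 ≠ 0 := by
  intro h0
  have := h.det_fst
  simp [cdet, h0] at this

theorem ne_zero_snd : e.2 ≠ 0 := by
  intro h0
  have := h.det_snd
  simp [cdet, h0] at this

/-- Cramer's rule with determinant `1 / √2`. In the conjugate plane the determinant is `-1 / √2`,
hence the signs in `eq_snd`. -/
theorem eq_fst (z : ℂ) : (√2 * cdet z f.1) • e.1 + (√2 * cdet e.1 z) • f.1 = z := by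
  have := h.det_fst
  simp only [cdet] at *
  apply Complex.ext
  · simp
    linear_combination z.re * this
  · simp
    linear_combination z.im * this

theorem eq_snd (z : ℂ) : (-(√2 * cdet z f.2)) • e.2 + (-(√2 * cdet e.2 z)) • f.2 = z := by
  have := h.det_snd
  simp only [cdet] at *
  apply Complex.ext
  · simp
    linear_combination -z.re * this
  · simp
    linear_combination -z.im * this

theorem coeff_fst (α β : ℝ) : √2 * cdet e.1 (α • e.1 + β • f.1) = β ∧
    √2 * cdet (α • e.1 + β • f.1) f.1 = α := by
  have := h.det_fst
  simp only [cdet] at *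
  constructor
  · simp
    linear_combination β * this
  · simp
    linear_combination α * this

theorem coeff_snd (α β : ℝ) : -(√2 * cdet e.2 (α • e.2 + β • f.2)) = β ∧
    -(√2 * cdet (α • e.2 + β • f.2) f.2) = α := by
  have := h.det_snd
  simp only [cdet] at *
  constructor
  · simp
    linear_combination -β * this
  · simp
    linear_combination -α * this

theorem comb_mem {α β : ℝ × ℝ} (hα : α ∈ quad) (hβ : β ∈ quad) :
    act α e + act β f ∈ zomega :=
  add_mem_zomega (act_mem_zomega hα h.left) (act_mem_zomega hβ h.right)

/-- The coefficients given by Cramer's rule in the two planes are conjugate, and `cdet_mem_quad`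
puts them in `ℤ[√2]`. So the determinant condition alone makes `e, f` a basis. -/
theorem exists_comb {z : ℂ × ℂ} (hz : z ∈ zomega) :
    ∃ α ∈ quad, ∃ β ∈ quad, act α e + act β f = z :=
  ⟨_, cdet_mem_quad hz h.right, _, cdet_mem_quad h.left hz,
    Prod.ext (h.eq_fst z.1) (h.eq_snd z.2)⟩

theorem comb_inj {α β α' β' : ℝ × ℝ} (hc : act α e + act β f = act α' e + act β' f) :
    α = α' ∧ β = β' := by
  have h1 := congrArg Prod.fst hc
  have h2 := congrArg Prod.snd hc
  simp only [Prod.fst_add, Prod.snd_add, act_fst, act_snd] at h1 h2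
  refine ⟨Prod.ext ?_ ?_, Prod.ext ?_ ?_⟩
  · rw [← (h.coeff_fst α.1 β.1).2, h1, (h.coeff_fst _ _).2]
  · rw [← (h.coeff_snd α.2 β.2).2, h2, (h.coeff_snd _ _).2]
  · rw [← (h.coeff_fst α.1 β.1).1, h1, (h.coeff_fst _ _).1]
  · rw [← (h.coeff_snd α.2 β.2).1, h2, (h.coeff_snd _ _).1]

end IsBasis

theorem isBasis_one : IsBasis (1, 1) (omega, -omega) := by
  have h := sqrt2_mul
  refine ⟨⟨⟨0, 0, 0, 1⟩, ?_⟩, ⟨⟨0, 0, 1, 0⟩, ?_⟩, ?_, ?_⟩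
  · simp [ZOmega.emb, ZOmega.toComplex, ZOmega.bul]
  · simp [ZOmega.emb, ZOmega.toComplex, ZOmega.bul]
  · simp [cdet, omega_eq]
    linear_combination h / 2
  · simp [cdet, omega_eq]
    linear_combination h / 2

theorem isBasis_I : IsBasis (Complex.I, Complex.I) (-omega, omega) := by
  have h := sqrt2_mul
  refine ⟨⟨⟨0, 1, 0, 0⟩, ?_⟩, ⟨⟨0, 0, -1, 0⟩, ?_⟩, ?_, ?_⟩
  · simp [ZOmega.emb, ZOmega.toComplex, ZOmega.bul, omega_sq]
  · simp [ZOmega.emb, ZOmega.toComplex, ZOmega.bul]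
  · simp [cdet, omega_eq]
    linear_combination h / 2
  · simp [cdet, omega_eq]
    linear_combination h / 2

/-! ## Binary quadratic forms -/

/-- A positive definite form `p x² + 2 q x y + r y²` of determinant one. -/
structure Form where
  p : ℝ
  q : ℝ
  r : ℝ
  pos : 0 < p
  disc : p * r - q ^ 2 = 1

namespace Form

variable (F G : Form)

/-- The value of the form. -/
def val (z : ℂ) : ℝ := F.p * z.re ^ 2 + 2 * F.q * z.re * z.im + F.r * z.im ^ 2

/-- The associated bilinear form. -/
def bil (z w : ℂ) : ℝ :=
  F.p * z.re * w.re + F.q * (z.re * w.im + z.im * w.re) + F.r * z.im * w.im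

/-- Lagrange's identity; determinant one means that `cdet` is also the area form of the inner
product `F.bil`. Dropping the first square leaves Hadamard's inequality `cdet_sq_le`. -/
theorem val_mul (z w : ℂ) : F.val z * F.val w = F.bil z w ^ 2 + cdet z w ^ 2 := by
  have := F.disc
  simp only [val, bil, cdet]
  linear_combination ((z.re * w.im - z.im * w.re) ^ 2) * this

theorem val_nonneg (z : ℂ) : 0 ≤ F.val z := by
  have h : F.p * F.val z = (F.p * z.re + F.q * z.im) ^ 2 + z.im ^ 2 := by
    have := F.disc
    simp only [val]
    linear_combination z.im ^ 2 * this
  by_contra hn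
  push Not at hn
  nlinarith [F.pos, sq_nonneg (F.p * z.re + F.q * z.im), sq_nonneg z.im]

theorem cdet_sq_le (z w : ℂ) : cdet z w ^ 2 ≤ F.val z * F.val w := by
  rw [val_mul]
  nlinarith [sq_nonneg (F.bil z w)]

theorem val_sub_le (z w : ℂ) : F.val (z - w) ≤ 2 * F.val z + 2 * F.val w := by
  have := F.val_nonneg (z + w)
  simp only [val, Complex.sub_re, Complex.sub_im, Complex.add_re, Complex.add_im] at *
  linarith

theorem val_smul (t : ℝ) (z : ℂ) : F.val (t • z) = t ^ 2 * F.val z := by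
  simp [val]
  ring

theorem val_sub_smul (t : ℝ) (z w : ℂ) :
    F.val (w - t • z) = F.val w - 2 * t * F.bil z w + t ^ 2 * F.val z := by
  simp [val, bil]
  ring

/-- Pythagoras for `F`: the component of `w` orthogonal to `z` contributes the first term whatever
`t` is, and rounding the coefficient along `z` affects only the second. -/
theorem val_sub_smul' {z w : ℂ} (hz : 0 < F.val z) (t : ℝ) :
    F.val (w - t • z) = cdet z w ^ 2 / F.val z + (F.bil z w / F.val z - t) ^ 2 * F.val z := by
  have h := F.val_mul z w
  rw [val_sub_smul]
  field_simp
  linear_combination h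

theorem r_pos : 0 < F.r := by
  have := F.disc
  by_contra h
  push Not at h
  nlinarith [F.pos, sq_nonneg F.q]

theorem val_one : F.val 1 = F.p := by simp [val]

theorem val_I : F.val Complex.I = F.r := by simp [val]

end Form

/-! ### The product of two forms on a basis, and its reduction -/

theorem IsBasis.val_fst_pos {e f : ℂ × ℂ} (h : IsBasis e f) (F : Form) : 0 < F.val e.1 := by
  refine (F.val_nonneg _).lt_of_ne' fun h0 => ?_
  have h1 := F.cdet_sq_le e.1 f.1
  have h2 := h.det_fst
  rw [h0, zero_mul] at h1
  have : cdet e.1 f.1 = 0 := by nlinarith [sq_nonneg (cdet e.1 f.1)]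
  rw [this] at h2
  simp at h2

theorem IsBasis.val_snd_pos {e f : ℂ × ℂ} (h : IsBasis e f) (F : Form) : 0 < F.val e.2 := by
  refine (F.val_nonneg _).lt_of_ne' fun h0 => ?_
  have h1 := F.cdet_sq_le e.2 f.2
  have h2 := h.det_snd
  rw [h0, zero_mul] at h1
  have : cdet e.2 f.2 = 0 := by nlinarith [sq_nonneg (cdet e.2 f.2)]
  rw [this] at h2
  simp at h2

theorem IsBasis.cdet_fst_sq {e f : ℂ × ℂ} (h : IsBasis e f) : cdet e.1 f.1 ^ 2 = 1 / 2 := by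
  have := h.det_fst
  have := sqrt2_mul
  have h3 : (√2 * cdet e.1 f.1) ^ 2 = 2 * cdet e.1 f.1 ^ 2 := by
    linear_combination cdet e.1 f.1 ^ 2 * this
  rw [h.det_fst] at h3
  linarith

theorem IsBasis.cdet_snd_sq {e f : ℂ × ℂ} (h : IsBasis e f) : cdet e.2 f.2 ^ 2 = 1 / 2 := by
  have := h.det_snd
  have := sqrt2_mul
  have h3 : (√2 * cdet e.2 f.2) ^ 2 = 2 * cdet e.2 f.2 ^ 2 := by
    linear_combination cdet e.2 f.2 ^ 2 * this
  rw [h.det_snd] at h3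
  linarith

/-- The product of the two forms on the two components. -/
def nrm (F G : Form) (z : ℂ × ℂ) : ℝ := F.val z.1 * G.val z.2

theorem IsBasis.nrm_pos {e f : ℂ × ℂ} (h : IsBasis e f) (F G : Form) : 0 < nrm F G e :=
  mul_pos (h.val_fst_pos F) (h.val_snd_pos G)

/-- Hadamard's inequality in both planes. It keeps the larger of the two products away from zero,
which bounds the length of the descent (`floor_logb_lt`). -/
theorem IsBasis.quarter_le {e f : ℂ × ℂ} (h : IsBasis e f) (F G : Form) :
    1 / 4 ≤ nrm F G e * nrm F G f := by
  have h1 := F.cdet_sq_le e.1 f.1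
  have h2 := G.cdet_sq_le e.2 f.2
  rw [h.cdet_fst_sq] at h1
  rw [h.cdet_snd_sq] at h2
  have := mul_le_mul h1 h2 (by norm_num) (by linarith)
  unfold nrm
  linarith

/-- An element of `ℤ[√2]` near to `(x, y)`, on the scale `θ`. -/
noncomputable def nearest (θ x y : ℝ) : ℝ × ℝ :=
  (θ * (⌊(x / θ + y * θ) / 2 + 1 / 2⌋ + ⌊(x / θ - y * θ) / (2 * √2) + 1 / 2⌋ * √2),
    (⌊(x / θ + y * θ) / 2 + 1 / 2⌋ - ⌊(x / θ - y * θ) / (2 * √2) + 1 / 2⌋ * √2) / θ)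

theorem nearest_mem (t x y : ℝ) : nearest (scale t) x y ∈ quad := by
  have := quad.mul_mem (scale_mem t) (mem_quad.2 ⟨⌊(x / scale t + y * scale t) / 2 + 1 / 2⌋,
    ⌊(x / scale t - y * scale t) / (2 * √2) + 1 / 2⌋, rfl⟩)
  convert this using 1
  ext
  · rfl
  · simp [nearest, div_eq_mul_inv, mul_comm]

theorem abs_sub_floor_half (x : ℝ) : |x - ⌊x + 1 / 2⌋| ≤ 1 / 2 := by
  have h1 := Int.floor_le (x + 1 / 2)
  have h2 := Int.lt_floor_add_one (x + 1 / 2)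
  rw [abs_le]
  constructor <;> linarith

/-- After rescaling by `θ`, the rational and the irrational coefficient are rounded with errors `ξ,
ζ` of size at most `1/2`. Then `P, P' = ξ ± ζ √2`, and `P P' = ξ² - 2 ζ²` lies in `[-1/2, 1/4]`.
This norm bound is much better than the product of the bounds for `P` and `P'`, and the reduction
rests on it. -/
theorem exists_nearest_sub {θ : ℝ} (hθ : 0 < θ) (x y : ℝ) : ∃ P P' : ℝ,
    x - (nearest θ x y).1 = θ * P ∧ y - (nearest θ x y).2 = P' / θ ∧
    P ^ 2 ≤ 3 / 2 ∧ P' ^ 2 ≤ 3 / 2 ∧ (P * P') ^ 2 ≤ 1 / 4 := by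
  have h2 := sqrt2_mul
  have h0 := Real.sqrt_nonneg 2
  have h3 : √2 < 1.415 := by
    rw [Real.sqrt_lt' (by norm_num)]
    norm_num
  set a := (x / θ + y * θ) / 2 with ha
  set b := (x / θ - y * θ) / (2 * √2) with hb
  have hξ := abs_le.1 (abs_sub_floor_half a)
  have hζ := abs_le.1 (abs_sub_floor_half b)
  set ξ := a - ⌊a + 1 / 2⌋ with hξd
  set ζ := b - ⌊b + 1 / 2⌋ with hζd
  have hs : 0 < √2 := by positivity
  have hbs : b * √2 = (x / θ - y * θ) / 2 := by
    rw [hb]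
    field_simp
  have e1 : ξ ^ 2 ≤ 1 / 4 := by nlinarith
  have e2 : ζ ^ 2 ≤ 1 / 4 := by nlinarith
  have e3 : ξ * ζ ≤ 1 / 4 := by nlinarith [sq_nonneg (ξ - ζ)]
  have e4 : -(1 / 4) ≤ ξ * ζ := by nlinarith [sq_nonneg (ξ + ζ)]
  refine ⟨ξ + ζ * √2, ξ - ζ * √2, ?_, ?_, ?_, ?_, ?_⟩
  · have : x = θ * (a + b * √2) := by
      rw [hbs, ha]
      field_simp
      ring
    simp only [nearest]
    rw [hξd, hζd, ← ha, ← hb]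
    linear_combination this
  · have : y = (a - b * √2) / θ := by
      rw [hbs, ha]
      field_simp
      ring
    simp only [nearest]
    rw [hξd, hζd, ← ha, ← hb]
    linear_combination this
  · nlinarith
  · nlinarith
  · have : (ξ + ζ * √2) * (ξ - ζ * √2) = ξ ^ 2 - 2 * ζ ^ 2 := by linear_combination -ζ ^ 2 * h2
    rw [this]
    nlinarith [sq_nonneg ξ, sq_nonneg ζ]

/-- The reduction of the second basis vector by the first one. -/
noncomputable def reduceBy (F G : Form) (e f : ℂ × ℂ) : ℂ × ℂ :=
  f - act (nearest (scale (G.val e.2 / F.val e.1)) (F.bil e.1 f.1 / F.val e.1)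
    (G.bil e.2 f.2 / G.val e.2)) e

theorem IsBasis.reduceBy {e f : ℂ × ℂ} (h : IsBasis e f) (F G : Form) :
    IsBasis e (reduceBy F G e f) := h.sub_act (nearest_mem _ _ _)

/-- With `a = F(e)` and `b = G(e•)`, the product of two sums as in `Form.val_sub_smul'` is
multiplied out. The orthogonal parts give `1 / (4ab)`, the norm of the rounding error gives `ab /
4`. The mixed terms contain `θ² a / b` and its inverse; the choice `θ² ≈ b / a` bounds these by `1`
and `34`, so the mixed terms are at most `(3/2 + 51) / 2 < 27`. -/
theorem IsBasis.nrm_reduceBy_le {e f : ℂ × ℂ} (h : IsBasis e f) (F G : Form) :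
    nrm F G (Grid.reduceBy F G e f) ≤ 1 / (4 * nrm F G e) + 27 + nrm F G e / 4 := by
  have ha := h.val_fst_pos F
  have hb := h.val_snd_pos G
  have hθ := scale_pos (G.val e.2 / F.val e.1)
  have h1 := scale_sq_le (div_pos hb ha)
  have h2 := lt_scale_sq (div_pos hb ha)
  obtain ⟨P, P', e1, e2, e3, e4, e5⟩ := exists_nearest_sub hθ (F.bil e.1 f.1 / F.val e.1)
    (G.bil e.2 f.2 / G.val e.2)
  simp only [nrm, Grid.reduceBy, Prod.fst_sub, Prod.snd_sub, act_fst, act_snd]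
  rw [F.val_sub_smul' ha, G.val_sub_smul' hb, e1, e2, h.cdet_fst_sq, h.cdet_snd_sq]
  generalize scale (G.val e.2 / F.val e.1) = θ at *
  generalize F.val e.1 = a at *
  generalize G.val e.2 = b at *
  have k1 : θ ^ 2 * a / b ≤ 1 := by
    rw [div_le_one hb]
    rwa [le_div_iff₀ ha] at h1
  have k2 : b / (a * θ ^ 2) ≤ 34 := by
    rw [div_le_iff₀ (by positivity)]
    rw [div_lt_iff₀ ha] at h2
    have := unit_sq_lt
    have h5 : unit ^ 2 * θ ^ 2 * a ≤ 34 * θ ^ 2 * a := by gcongr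
    linarith
  have k3 : 0 ≤ θ ^ 2 * a / b := by positivity
  have k4 : 0 ≤ b / (a * θ ^ 2) := by positivity
  have key : (1 / 2 / a + (θ * P) ^ 2 * a) * (1 / 2 / b + (P' / θ) ^ 2 * b) =
      1 / (4 * (a * b)) + (P ^ 2 * (θ ^ 2 * a / b) + P' ^ 2 * (b / (a * θ ^ 2))) / 2 +
      (P * P') ^ 2 * (a * b) := by
    field_simp
    ring
  rw [key]
  have l1 : P ^ 2 * (θ ^ 2 * a / b) ≤ 3 / 2 * 1 := by gcongr
  have l2 : P' ^ 2 * (b / (a * θ ^ 2)) ≤ 3 / 2 * 34 := by gcongr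
  have l3 : (P * P') ^ 2 * (a * b) ≤ 1 / 4 * (a * b) := by gcongr
  linarith

/-- For `x = nrm F G e ≥ 1` the hypothesis yields `x ≤ 2 (1/4 + 27 + x/4)`, that is, `x ≤ 109`. The
coefficient `1/4` being below `1/2` is essential. -/
theorem IsBasis.nrm_le_of_reduced {e f : ℂ × ℂ} (h : IsBasis e f) (F G : Form)
    (hle : nrm F G e ≤ 2 * nrm F G (Grid.reduceBy F G e f)) : nrm F G e ≤ 109 := by
  have h1 := h.nrm_reduceBy_le F G
  have h0 := h.nrm_pos F G
  by_contra hc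
  push Not at hc
  have : 1 / (4 * nrm F G e) ≤ 1 / 4 := by
    rw [div_le_div_iff₀ (by positivity) (by norm_num)]
    linarith
  linarith

end Grid

/-! ## Points of `ℤ[√2]` in rectangles -/

namespace Grid

open Real

/-- The sides of a rectangle that contains a rectangle with sides `a` and `b` and has area
between `1` and `a * b + 1`. -/
noncomputable def widen (a b : ℝ) : ℝ × ℝ :=
  open Classical in
  if 0 < b then (a + 1 / b, b) else if 0 < a then (a, 1 / a) else (1, 1)

/-- Positive sides make the ratio meaningful that determines the scale, also for degenerate
rectangles; an area of at least one absorbs the additive constants in the counting. -/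
theorem widen_spec {a b : ℝ} (ha : 0 ≤ a) (hb : 0 ≤ b) :
    a ≤ (widen a b).1 ∧ b ≤ (widen a b).2 ∧ 0 < (widen a b).1 ∧ 0 < (widen a b).2 ∧
      1 ≤ (widen a b).1 * (widen a b).2 ∧ (widen a b).1 * (widen a b).2 ≤ a * b + 1 := by
  unfold widen
  split_ifs with h1 h2
  · have e : (a + 1 / b) * b = a * b + 1 := by field_simp
    have : 0 < 1 / b := by positivity
    have : 0 ≤ a * b := by positivity
    simp only [e]
    exact ⟨by linarith, le_rfl, by linarith, h1, by linarith, le_rfl⟩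
  · have hb0 : b = 0 := by linarith
    have e : a * (1 / a) = 1 := by field_simp
    simp only [e, hb0]
    exact ⟨le_rfl, by positivity, h2, by positivity, le_rfl, by simp⟩
  · have hb0 : b = 0 := by linarith
    have ha0 : a = 0 := by linarith
    simp [ha0, hb0]

/-- The integers `n` with `n₀ ≤ n < y`, in descending order. -/
noncomputable def intsFrom (n₀ : ℤ) (y : ℝ) : List ℤ :=
  -- Descending, because the outputs are recorded with the latest first.
  (List.range ⌈y - n₀⌉₊).reverse.map fun i : ℕ => n₀ + i

theorem mem_intsFrom {n₀ n : ℤ} {y : ℝ} : n ∈ intsFrom n₀ y ↔ n₀ ≤ n ∧ (n : ℝ) < y := by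
  simp only [intsFrom, List.mem_map, List.mem_reverse, List.mem_range, Nat.lt_ceil]
  constructor
  · rintro ⟨i, hi, rfl⟩
    push_cast
    exact ⟨by omega, by linarith⟩
  · rintro ⟨h1, h2⟩
    obtain ⟨i, rfl⟩ := Int.le.dest h1
    refine ⟨i, ?_, rfl⟩
    push_cast at h2
    linarith

theorem nodup_intsFrom (n₀ : ℤ) (y : ℝ) : (intsFrom n₀ y).Nodup := by
  refine List.Nodup.map (fun i j h => ?_) (List.nodup_reverse.2 List.nodup_range)
  simpa using h

theorem length_intsFrom_le {n₀ : ℤ} {y B : ℝ} (hB : 0 ≤ B) (h : y - n₀ ≤ B) :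
    ((intsFrom n₀ y).length : ℝ) ≤ B + 1 := by
  simp only [intsFrom, List.length_map, List.length_reverse, List.length_range]
  have h1 := Nat.ceil_lt_add_one hB
  have h2 : ⌈y - n₀⌉₊ ≤ ⌈B⌉₊ := Nat.ceil_le_ceil h
  have h3 : ((⌈y - n₀⌉₊ : ℕ) : ℝ) ≤ ⌈B⌉₊ := by exact_mod_cast h2
  linarith

/-- The second coordinates that occur in the enumeration of a rescaled rectangle. -/
noncomputable def rows (Y A Y' B : ℝ) : List ℤ :=
  -- The difference of `m + n √2` and `m - n √2` is `2 n √2`. The floor gives the loop an integer to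
  -- start from, and the `+ 1` makes up for its strict upper bound.
  intsFrom ⌊(Y - Y' - B) / (2 * √2)⌋ ((Y - Y' + A) / (2 * √2) + 1)

/-- The first coordinates that occur together with `n`. -/
noncomputable def row (Y' B : ℝ) (n : ℤ) : List ℤ :=
  intsFrom ⌊Y' + n * √2⌋ (Y' + B + n * √2 + 1)

/-- `θ (m + n √2)` and its conjugate. -/
noncomputable def quadPoint (θ : ℝ) (n m : ℤ) : ℝ × ℝ :=
  (θ * (m + n * √2), (m - n * √2) / θ)

theorem quadPoint_mem (t : ℝ) (n m : ℤ) : quadPoint (scale t) n m ∈ quad := by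
  have := quad.mul_mem (scale_mem t) (mem_quad.2 ⟨m, n, rfl⟩)
  convert this using 1
  ext
  · rfl
  · simp [quadPoint, div_eq_mul_inv, mul_comm]

theorem quadPoint_inj {θ : ℝ} (hθ : 0 < θ) {n m n' m' : ℤ}
    (h : quadPoint θ n m = quadPoint θ n' m') : n = n' ∧ m = m' := by
  have h1 := congrArg Prod.fst h
  have h2 := congrArg Prod.snd h
  simp only [quadPoint] at h1 h2
  have h1 := mul_left_cancel₀ hθ.ne' h1
  rw [div_left_inj' hθ.ne'] at h2
  have hs : (0 : ℝ) < √2 := by positivity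
  have e1 : (m : ℝ) = m' := by linarith
  have e2 : (n : ℝ) * √2 = n' * √2 := by linarith
  have e3 := mul_right_cancel₀ hs.ne' e2
  exact ⟨by exact_mod_cast e3, by exact_mod_cast e1⟩

/-- A list of points of `ℤ[√2]` that contains all points in `[X, X + A] × [X', X' + B]`. -/
noncomputable def scaledCands (θ X A X' B : ℝ) : List (ℝ × ℝ) :=
  (rows (X / θ) (A / θ) (X' * θ) (B * θ)).flatMap fun n =>
    (row (X' * θ) (B * θ) n).map (quadPoint θ n)

/-- The number of rows in `cands`. -/
noncomputable def numRows (X a X' b : ℝ) : ℕ :=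
  (rows (X / scale ((widen a b).1 / (widen a b).2))
    ((widen a b).1 / scale ((widen a b).1 / (widen a b).2))
    (X' * scale ((widen a b).1 / (widen a b).2))
    ((widen a b).2 * scale ((widen a b).1 / (widen a b).2))).length

/-- A list of points of `ℤ[√2]` that contains all points in `[X, X + a] × [X', X' + b]`. -/
noncomputable def cands (X a X' b : ℝ) : List (ℝ × ℝ) :=
  scaledCands (scale ((widen a b).1 / (widen a b).2)) X (widen a b).1 X' (widen a b).2

theorem cands_subset_quad {X a X' b : ℝ} {p : ℝ × ℝ} (h : p ∈ cands X a X' b) : p ∈ quad := by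
  simp only [cands, scaledCands, List.mem_flatMap, List.mem_map] at h
  obtain ⟨n, -, m, -, rfl⟩ := h
  exact quadPoint_mem _ _ _

theorem nodup_scaledCands {θ : ℝ} (hθ : 0 < θ) (X A X' B : ℝ) :
    (scaledCands θ X A X' B).Nodup := by
  refine List.nodup_flatMap.2 ⟨fun n _ => ?_, ?_⟩
  · exact (nodup_intsFrom _ _).map fun m m' h => (quadPoint_inj hθ h).2
  · refine (nodup_intsFrom _ _).imp fun {n n'} hne => ?_
    rw [Function.onFun, List.disjoint_left]
    intro p h1 h2
    obtain ⟨m, -, rfl⟩ := List.mem_map.1 h1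
    obtain ⟨m', -, h3⟩ := List.mem_map.1 h2
    exact hne (quadPoint_inj hθ h3).1.symm

theorem nodup_cands (X a X' b : ℝ) : (cands X a X' b).Nodup :=
  nodup_scaledCands (scale_pos _) _ _ _ _

/-- Dividing `p` by the unit `θ` gives a point `m + n √2` of `ℤ[√2]` in the rescaled rectangle. The
difference of its coordinates confines `n`, the second coordinate then confines `m`. The list may
contain points outside the rectangle. -/
theorem mem_cands {X a X' b : ℝ} (ha : 0 ≤ a) (hb : 0 ≤ b) {p : ℝ × ℝ} (hp : p ∈ quad)
    (h1 : p.1 ∈ Set.Icc X (X + a)) (h2 : p.2 ∈ Set.Icc X' (X' + b)) : p ∈ cands X a X' b := by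
  obtain ⟨wa, wb, -, -, -, -⟩ := widen_spec ha hb
  simp only [cands, scaledCands, List.mem_flatMap, List.mem_map]
  generalize (widen a b).1 = A at *
  generalize (widen a b).2 = B at *
  have hθ := scale_pos (A / B)
  obtain ⟨m, n, hmn⟩ := quad.mul_mem (scale_mem' (A / B)) hp
  generalize scale (A / B) = θ at *
  have e1 := congrArg Prod.fst hmn
  have e2 := congrArg Prod.snd hmn
  simp only [Prod.fst_mul, Prod.snd_mul] at e1 e2
  have hs : (0 : ℝ) < √2 := by positivity
  have k1 : X / θ ≤ m + n * √2 := by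
    rw [← e1, div_eq_inv_mul]
    have := h1.1
    gcongr
  have k2 : m + n * √2 ≤ X / θ + A / θ := by
    rw [← e1, ← add_div, div_eq_inv_mul]
    have := h1.2
    gcongr
    linarith
  have k3 : X' * θ ≤ m - n * √2 := by
    rw [← e2, mul_comm]
    have := h2.1
    gcongr
  have k4 : m - n * √2 ≤ X' * θ + B * θ := by
    rw [← e2, ← add_mul, mul_comm]
    have := h2.2
    gcongr
    linarith
  refine ⟨n, ?_, m, ?_, ?_⟩
  · rw [rows, mem_intsFrom]
    constructor
    · rw [← Int.cast_le (R := ℝ)]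
      refine (Int.floor_le _).trans ?_
      rw [div_le_iff₀ (by positivity)]
      linarith
    · refine lt_of_le_of_lt ?_ (lt_add_one _)
      rw [le_div_iff₀ (by positivity)]
      linarith
  · rw [row, mem_intsFrom]
    constructor
    · rw [← Int.cast_le (R := ℝ)]
      refine (Int.floor_le _).trans ?_
      linarith
    · linarith
  · ext
    · simp only [quadPoint]
      rw [← e1]
      field_simp
    · simp only [quadPoint]
      rw [← e2]
      field_simp

theorem length_row_le {Y' B : ℝ} (hB : 0 ≤ B) (n : ℤ) : ((row Y' B n).length : ℝ) ≤ B + 3 := by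
  have h := Int.lt_floor_add_one (Y' + n * √2)
  have := length_intsFrom_le (n₀ := ⌊Y' + n * √2⌋) (y := Y' + B + n * √2 + 1) (B := B + 2)
    (by linarith) (by linarith)
  rw [row]
  linarith

theorem length_rows_le {Y A Y' B : ℝ} (hA : 0 ≤ A) (hB : 0 ≤ B) :
    ((rows Y A Y' B).length : ℝ) ≤ (A + B) / 2 + 3 := by
  have h := Int.lt_floor_add_one ((Y - Y' - B) / (2 * √2))
  have h1 : 1 ≤ √2 := Real.one_le_sqrt.2 (by norm_num)
  have h2 : (Y - Y' + A) / (2 * √2) - (Y - Y' - B) / (2 * √2) ≤ (A + B) / 2 := by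
    rw [← sub_div, show Y - Y' + A - (Y - Y' - B) = A + B by ring]
    exact div_le_div_of_nonneg_left (by linarith) (by norm_num) (by linarith)
  have := length_intsFrom_le (n₀ := ⌊(Y - Y' - B) / (2 * √2)⌋)
    (y := (Y - Y' + A) / (2 * √2) + 1) (B := (A + B) / 2 + 2) (by linarith) (by linarith)
  rw [rows]
  linarith

theorem length_flatMap_le {α β : Type*} (l : List α) (f : α → List β) {c : ℝ}
    (h : ∀ x ∈ l, ((f x).length : ℝ) ≤ c) : ((l.flatMap f).length : ℝ) ≤ l.length * c := by
  induction l with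
  | nil => simp
  | cons x l ih =>
    have h1 := h x List.mem_cons_self
    have h2 := ih fun y hy => h y (List.mem_cons_of_mem _ hy)
    simp only [List.flatMap_cons, List.length_append, List.length_cons]
    push_cast
    linarith

/-- The enumeration takes constant time per unit of area. -/
theorem numRows_add_length_cands_le {X a X' b : ℝ} (ha : 0 ≤ a) (hb : 0 ≤ b) :
    (numRows X a X' b : ℝ) + (cands X a X' b).length ≤ 120 * (a * b + 1) := by
  obtain ⟨-, -, hA, hB, h1, h2⟩ := widen_spec ha hb
  simp only [numRows, cands, scaledCands]
  generalize (widen a b).1 = A at *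
  generalize (widen a b).2 = B at *
  have hθ := scale_pos (A / B)
  have s1 := scale_sq_le (div_pos hA hB)
  have s2 := lt_scale_sq (div_pos hA hB)
  generalize scale (A / B) = θ at *
  have hBA : B * θ ≤ A / θ := by
    rw [le_div_iff₀ hθ]
    rw [le_div_iff₀ hB] at s1
    linarith
  have hAB : A / θ ≤ 34 * (B * θ) := by
    rw [div_le_iff₀ hθ]
    rw [div_lt_iff₀ hB] at s2
    have := unit_sq_lt
    have h5 : unit ^ 2 * θ ^ 2 * B ≤ 34 * θ ^ 2 * B := by gcongr
    linarith
  have hS : A / θ * (B * θ) = A * B := by field_simp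
  have hA' : 0 < A / θ := by positivity
  have hB' : 0 < B * θ := by positivity
  have l1 := length_rows_le (Y := X / θ) (Y' := X' * θ) hA'.le hB'.le
  have l2 := length_flatMap_le (rows (X / θ) (A / θ) (X' * θ) (B * θ))
    (fun n => (row (X' * θ) (B * θ) n).map (quadPoint θ n)) (c := B * θ + 3)
    fun n _ => by simpa using length_row_le hB'.le n
  generalize A / θ = A' at *
  generalize B * θ = B' at *
  generalize ((rows (X / θ) A' (X' * θ) B').length : ℝ) = k at *
  -- The rescaled sides satisfy `B' ≤ A' ≤ 34 B'` and `A' B' = A B ≥ 1`, so `B'²`, `B'` and `1` are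
  -- all at most `A B`; these are the terms in (number of rows) × (length of a row).
  have q1 : B' * B' ≤ A * B := by nlinarith
  have q2 : B' ≤ A * B := by nlinarith
  have q3 : k ≤ 35 / 2 * B' + 3 := by linarith
  have q4 : k * (B' + 3) ≤ (35 / 2 * B' + 3) * (B' + 3) := by gcongr
  nlinarith

/-- A rectangle contains a number of points of `ℤ[√2]` that is at least proportional to its
area, if the area is large. -/
theorem exists_finset_quad {x y x' y' : ℝ} (h : x < y) (h' : x' < y') :
    ∃ s : Finset (ℝ × ℝ), (∀ p ∈ s, p ∈ quad ∧ p.1 ∈ Set.Icc x y ∧ p.2 ∈ Set.Icc x' y') ∧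
      (y - x) * (y' - x') ≤ 2000 * (s.card + 1) := by
  have hL : 0 < y - x := by linarith
  have hL' : 0 < y' - x' := by linarith
  have hθ := scale_pos ((y - x) / (y' - x'))
  have s1 := scale_sq_le (div_pos hL hL')
  have s2 := lt_scale_sq (div_pos hL hL')
  have hmem := nearest_mem ((y - x) / (y' - x')) ((x + y) / 2) ((x' + y') / 2)
  have hpt := quadPoint_mem ((y - x) / (y' - x'))
  generalize scale ((y - x) / (y' - x')) = θ at *
  set A := (y - x) / θ with hA
  set B := (y' - x') * θ with hB
  have hBA : B ≤ A := by
    rw [le_div_iff₀ hθ]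
    rw [le_div_iff₀ hL'] at s1
    linarith
  have hAB : A ≤ 34 * B := by
    rw [div_le_iff₀ hθ]
    rw [div_lt_iff₀ hL'] at s2
    have := unit_sq_lt
    have h5 : unit ^ 2 * θ ^ 2 * (y' - x') ≤ 34 * θ ^ 2 * (y' - x') := by gcongr
    linarith
  have hS : (y - x) * (y' - x') = A * B := by
    rw [hA, hB]
    field_simp
  have hBpos : 0 < B := by positivity
  rw [hS]
  -- In this case the area is at most `34 B² < 2000`, and no point is needed.
  by_cases hB25 : B < 5 / 2
  · refine ⟨∅, by simp, ?_⟩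
    simp only [Finset.card_empty]
    push_cast
    nlinarith
  push Not at hB25
  -- For `|m|, |n| ≤ K`, the point `m + n √2` added to a lattice point near the centre is off the
  -- centre by at most `2.415 K + 1.23 ≤ B / 2` in both rescaled coordinates.
  obtain ⟨K, hK⟩ : ∃ K : ℕ, K = ⌊B / 5 - 1 / 2⌋₊ := ⟨_, rfl⟩
  have hK1 : (K : ℝ) ≤ B / 5 - 1 / 2 := by
    rw [hK]
    exact Nat.floor_le (by linarith)
  have hK2 : B / 5 - 1 / 2 < K + 1 := by
    rw [hK]
    exact Nat.lt_floor_add_one _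
  have hr2 : √2 < 1.415 := by
    rw [Real.sqrt_lt' (by norm_num)]
    norm_num
  have hr0 := Real.sqrt_nonneg 2
  obtain ⟨P, P', e1, e2, e3, e4, -⟩ := exists_nearest_sub hθ ((x + y) / 2) ((x' + y') / 2)
  have hP : |P| ≤ 1.23 := abs_le_of_sq_le_sq (by norm_num at e3 ⊢; linarith) (by norm_num)
  have hP' : |P'| ≤ 1.23 := abs_le_of_sq_le_sq (by norm_num at e4 ⊢; linarith) (by norm_num)
  rw [abs_le] at hP hP'
  refine ⟨(Finset.Icc (-(K : ℤ)) K ×ˢ Finset.Icc (-(K : ℤ)) K).image fun k =>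
    nearest θ ((x + y) / 2) ((x' + y') / 2) + quadPoint θ k.1 k.2, ?_, ?_⟩
  · intro p hp
    obtain ⟨⟨n, m⟩, hk, rfl⟩ := Finset.mem_image.1 hp
    simp only [Finset.mem_product, Finset.mem_Icc] at hk
    obtain ⟨⟨n1, n2⟩, m1, m2⟩ := hk
    have n1 : -(K : ℝ) ≤ n := by exact_mod_cast n1
    have n2 : (n : ℝ) ≤ K := by exact_mod_cast n2
    have m1 : -(K : ℝ) ≤ m := by exact_mod_cast m1
    have m2 : (m : ℝ) ≤ K := by exact_mod_cast m2
    have hn1 : -(1.415 * (K : ℝ)) ≤ n * √2 := by nlinarith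
    have hn2 : n * √2 ≤ 1.415 * (K : ℝ) := by nlinarith
    refine ⟨quad.add_mem hmem (hpt n m), ?_, ?_⟩
    · have e : (nearest θ ((x + y) / 2) ((x' + y') / 2) + quadPoint θ n m).1 =
          (x + y) / 2 + θ * (m + n * √2 - P) := by
        simp only [Prod.fst_add, quadPoint]
        linarith
      have hyx : y - x = θ * A := by rw [hA]; field_simp
      rw [e, Set.mem_Icc]
      have b1 : -(A / 2) ≤ m + n * √2 - P := by linarith
      have b2 : m + n * √2 - P ≤ A / 2 := by linarith
      have c1 := mul_le_mul_of_nonneg_left b1 hθ.le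
      have c2 := mul_le_mul_of_nonneg_left b2 hθ.le
      constructor <;> linarith
    · have e : (nearest θ ((x + y) / 2) ((x' + y') / 2) + quadPoint θ n m).2 =
          (x' + y') / 2 + (m - n * √2 - P') / θ := by
        simp only [Prod.snd_add, quadPoint]
        rw [sub_div _ P']
        linarith
      have hyx : y' - x' = B / θ := by rw [hB]; field_simp
      rw [e, Set.mem_Icc]
      have b1 : -(B / 2) ≤ m - n * √2 - P' := by linarith
      have b2 : m - n * √2 - P' ≤ B / 2 := by linarith
      have c1 := div_le_div_of_nonneg_right b1 hθ.le
      have c2 := div_le_div_of_nonneg_right b2 hθ.le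
      rw [neg_div, div_right_comm] at c1
      rw [div_right_comm B] at c2
      constructor <;> linarith
  · rw [Finset.card_image_of_injective]
    · rw [Finset.card_product, Int.card_Icc]
      have e : ((K : ℤ) + 1 - -(K : ℤ)).toNat = 2 * K + 1 := by omega
      rw [e]
      push_cast
      have hK0 : (0 : ℝ) ≤ K := by positivity
      nlinarith
    · rintro ⟨n, m⟩ ⟨n', m'⟩ hh
      obtain ⟨h1, h2⟩ := quadPoint_inj hθ (add_left_cancel hh)
      exact Prod.ext h1 h2

end Grid

/-! ## Areas of convex sets and lengths of their sections -/

namespace Grid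

open MeasureTheory Real

theorem volume_le_of_sub_le {S : Set ℝ} {l : ℝ} (h : ∀ t ∈ S, ∀ t' ∈ S, t' - t ≤ l) :
    volume S ≤ ENNReal.ofReal l := by
  refine (Real.volume_le_diam S).trans (Metric.ediam_le fun t ht t' ht' => ?_)
  rw [edist_dist, Real.dist_eq]
  refine ENNReal.ofReal_le_ofReal (abs_le.2 ⟨?_, ?_⟩)
  · have := h t ht t' ht'
    linarith
  · exact h t' ht' t ht

theorem exists_sub_le_of_le_volume {S : Set ℝ} {l : ℝ} (hl : 0 < l)
    (h : ENNReal.ofReal l ≤ volume S) : ∃ t ∈ S, ∃ t' ∈ S, l / 2 ≤ t' - t := by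
  by_contra hc
  push Not at hc
  have h1 := volume_le_of_sub_le (l := l / 2) fun t ht t' ht' => (hc t ht t' ht').le
  have h2 := h.trans h1
  rw [ENNReal.ofReal_le_ofReal_iff (by linarith)] at h2
  linarith

/-- Change of variables for the linear map with columns `e, f`, from `ℝ × ℝ`, where Fubini's theorem
is available. -/
theorem volume_coord {e f : ℂ} (hδ : cdet e f ≠ 0) {U : Set ℂ} (hU : MeasurableSet U) :
    volume U = ENNReal.ofReal |cdet e f| *
      volume {p : ℝ × ℝ | p.1 • e + p.2 • f ∈ U} := by
  set T := Matrix.toLin (Module.Basis.finTwoProd ℝ) (Module.Basis.finTwoProd ℝ)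
    !![e.re, f.re; e.im, f.im] with hT
  have hdet : LinearMap.det T = cdet e f := by
    rw [hT, LinearMap.det_toLin, Matrix.det_fin_two_of, cdet]
    ring
  have h1 := Complex.volume_preserving_equiv_real_prod.symm.measure_preimage
    hU.nullMeasurableSet
  have h2 := Measure.addHaar_preimage_linearMap (volume : Measure (ℝ × ℝ)) (f := T)
    (by rwa [hdet]) (Complex.measurableEquivRealProd.symm ⁻¹' U)
  have h3 : T ⁻¹' (Complex.measurableEquivRealProd.symm ⁻¹' U) =
      {p : ℝ × ℝ | p.1 • e + p.2 • f ∈ U} := by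
    ext p
    rw [Set.mem_preimage, Set.mem_preimage, Set.mem_ofPred_eq]
    have : Complex.measurableEquivRealProd.symm (T p) = p.1 • e + p.2 • f := by
      apply Complex.ext <;>
        simp [hT, Matrix.toLin_finTwoProd_apply, Complex.measurableEquivRealProd] <;> ring
    rw [this]
  rw [h3, h1, hdet, abs_inv] at h2
  rw [h2, ← mul_assoc, ← ENNReal.ofReal_mul (abs_nonneg _),
    mul_inv_cancel₀ (abs_ne_zero.2 hδ), ENNReal.ofReal_one, one_mul]

/-- The lines in the direction `e`, given by their parameter in the direction `f`, on which `A`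
has two points of distance more than `l`, in the units of `e`. -/
def longLines (A : Set ℂ) (e f : ℂ) (l : ℝ) : Set ℝ :=
  {β | ∃ t t' : ℝ, t • e + β • f ∈ A ∧ t' • e + β • f ∈ A ∧ l < t' - t}

/-- Convex combinations of two parallel chords are chords, and the lengths combine linearly. So the
long lines form an interval, and a lower bound for their measure yields an interval all of whose
lines are long. -/
theorem convex_longLines {A : Set ℂ} (hA : Convex ℝ A) (e f : ℂ) (l : ℝ) :
    Convex ℝ (longLines A e f l) := by
  rintro β ⟨t, t', h1, h2, h3⟩ β' ⟨u, u', k1, k2, k3⟩ a b ha hb hab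
  refine ⟨a * t + b * u, a * t' + b * u', ?_, ?_, ?_⟩
  · convert hA h1 k1 ha hb hab using 1
    simp only [smul_add, smul_smul, smul_eq_mul]
    module
  · convert hA h2 k2 ha hb hab using 1
    simp only [smul_add, smul_smul, smul_eq_mul]
    module
  · have : a * l + b * l = l := by rw [← add_mul, hab, one_mul]
    rcases ha.eq_or_lt with rfl | ha
    · nlinarith
    · nlinarith

/-- Fubini along the lines parallel to `e`: a long line contributes at most `l₁`, any other line
that meets the set at most `l₀`. -/
theorem volume_le_of_sections {A : Set ℂ} (hA : Convex ℝ A) {e f : ℂ} (hδ : cdet e f ≠ 0)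
    {b₀ b₁ l₀ l₁ : ℝ}
    (hI : ∀ z ∈ A, ∀ t β : ℝ, t • e + β • f = z → β ∈ Set.Icc b₀ b₁)
    (hl₁ : ∀ t t' β : ℝ, t • e + β • f ∈ A → t' • e + β • f ∈ A → t' - t ≤ l₁) :
    volume A ≤ ENNReal.ofReal |cdet e f| * (ENNReal.ofReal l₁ * volume (longLines A e f l₀) +
      ENNReal.ofReal l₀ * ENNReal.ofReal (b₁ - b₀)) := by
  -- The frontier of a convex set is a null set; passing to the interior provides measurability.
  have h0 : volume A ≤ volume (interior A) := by
    have h : A ⊆ interior A ∪ frontier A :=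
      subset_closure.trans (closure_eq_interior_union_frontier A).subset
    refine (measure_mono h).trans ((measure_union_le _ _).trans ?_)
    rw [hA.addHaar_frontier volume, add_zero]
  refine h0.trans ?_
  rw [volume_coord hδ isOpen_interior.measurableSet]
  gcongr
  have hm : MeasurableSet {p : ℝ × ℝ | p.1 • e + p.2 • f ∈ interior A} := by
    refine (isOpen_interior.preimage (f := fun p : ℝ × ℝ => p.1 • e + p.2 • f) ?_).measurableSet
    fun_prop
  have hJ : MeasurableSet (longLines A e f l₀) :=
    (convex_longLines hA e f l₀).ordConnected.measurableSet
  rw [Measure.volume_eq_prod, Measure.prod_apply_symm hm]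
  calc ∫⁻ β, volume ((fun t => (t, β)) ⁻¹' {p : ℝ × ℝ | p.1 • e + p.2 • f ∈ interior A})
      ≤ ∫⁻ β, ((longLines A e f l₀).indicator (fun _ => ENNReal.ofReal l₁) β +
        (Set.Icc b₀ b₁).indicator (fun _ => ENNReal.ofReal l₀) β) := by
        refine lintegral_mono fun β => ?_
        by_cases hβ : β ∈ longLines A e f l₀
        · rw [Set.indicator_of_mem hβ]
          refine le_add_right (volume_le_of_sub_le fun t ht t' ht' => ?_)
          exact hl₁ t t' β (interior_subset ht) (interior_subset ht')
        · refine le_add_left ?_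
          by_cases hb : β ∈ Set.Icc b₀ b₁
          · rw [Set.indicator_of_mem hb]
            refine volume_le_of_sub_le fun t ht t' ht' => ?_
            by_contra hc
            exact hβ ⟨t, t', interior_subset ht, interior_subset ht', not_le.1 hc⟩
          · rw [Set.indicator_of_notMem hb]
            have : (fun t => (t, β)) ⁻¹' {p : ℝ × ℝ | p.1 • e + p.2 • f ∈ interior A} = ∅ := by
              refine Set.eq_empty_of_forall_notMem fun t ht => hb ?_
              exact hI _ (interior_subset ht) t β rfl
            rw [this, measure_empty]
    _ = _ := by
        rw [lintegral_add_left (measurable_const.indicator hJ), lintegral_indicator_const hJ,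
          lintegral_indicator_const measurableSet_Icc, Real.volume_Icc]

/-- The set `A` lies in an ellipse with centre `v` whose area is at most proportional to the area
of `A`. -/
structure Encloses (F : Form) (v : ℂ) (s κ : ℝ) (A : Set ℂ) : Prop where
  pos : 0 < s
  val_le : ∀ z ∈ A, F.val (z - v) ≤ 2 * s
  le_area : s ≤ 4 * κ * volume.real A

namespace Encloses

variable {F : Form} {v : ℂ} {s κ : ℝ} {A : Set ℂ}

/-- The parallelogram law bounds `F((t' - t) e)` by `8 s`; replacing `8` by `9` gives the factor
`3`. -/
theorem sub_le (h : Encloses F v s κ A) {e f : ℂ} (he : 0 < F.val e) {t t' β : ℝ}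
    (h1 : t • e + β • f ∈ A) (h2 : t' • e + β • f ∈ A) : t' - t ≤ 3 * (√s / √(F.val e)) := by
  have h3 := F.val_sub_le (t' • e + β • f - v) (t • e + β • f - v)
  have e1 : t' • e + β • f - v - (t • e + β • f - v) = (t' - t) • e := by module
  rw [e1, F.val_smul] at h3
  have h4 := h.val_le _ h1
  have h5 := h.val_le _ h2
  rw [← Real.sqrt_div h.pos.le]
  refine (le_abs_self _).trans (abs_le_of_sq_le_sq ?_ (by positivity))
  rw [mul_pow, Real.sq_sqrt (div_nonneg h.pos.le he.le), ← mul_div_assoc, le_div_iff₀ he]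
  linarith [h.pos]

/-- Hadamard's inequality for `e` and `z - v`: the width of the ellipse across the direction `e`. -/
theorem coord_mem (h : Encloses F v s κ A) {e z : ℂ} (hz : z ∈ A) :
    |cdet e z - cdet e v| ≤ √2 * (√(F.val e) * √s) := by
  have h1 := F.cdet_sq_le e (z - v)
  have h2 := h.val_le z hz
  have e1 : cdet e (z - v) = cdet e z - cdet e v := by
    simp [cdet]
    ring
  rw [← e1]
  refine abs_le_of_sq_le_sq ?_ (by positivity)
  rw [mul_pow, mul_pow, Real.sq_sqrt (by norm_num), Real.sq_sqrt (F.val_nonneg e),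
    Real.sq_sqrt h.pos.le]
  refine h1.trans ?_
  have := mul_le_mul_of_nonneg_left h2 (F.val_nonneg e)
  linarith

theorem cdet_comb (e f : ℂ) (t β : ℝ) : cdet e (t • e + β • f) = β * cdet e f := by
  simp [cdet]
  ring

theorem volume_le (h : Encloses F v s κ A) (hA : Convex ℝ A) {e f : ℂ} (he : 0 < F.val e)
    (hδ : cdet e f ^ 2 = 1 / 2) {l₀ : ℝ} (hl₀ : 0 ≤ l₀) :
    volume A ≤ ENNReal.ofReal (3 * (√s / √(F.val e))) * volume (longLines A e f l₀) +
      ENNReal.ofReal (3 * l₀ * (√(F.val e) * √s)) := by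
  have hδ0 : cdet e f ≠ 0 := by
    intro h0
    rw [h0] at hδ
    norm_num at hδ
  have habs : |cdet e f| ≤ 1 := by
    refine abs_le_of_sq_le_sq ?_ zero_le_one
    rw [hδ]
    norm_num
  have hr2 : √2 ≤ 3 / 2 := by
    rw [Real.sqrt_le_left (by norm_num)]
    norm_num
  set R := √2 * (√(F.val e) * √s) / |cdet e f| with hR
  have hpos : 0 < |cdet e f| := abs_pos.2 hδ0
  have key := volume_le_of_sections hA hδ0 (b₀ := cdet e v / cdet e f - R)
    (b₁ := cdet e v / cdet e f + R) (l₀ := l₀) (l₁ := 3 * (√s / √(F.val e))) (by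
      rintro z hz t β rfl
      have h1 := h.coord_mem (e := e) hz
      rw [cdet_comb] at h1
      have h2 : |β - cdet e v / cdet e f| ≤ R := by
        rw [hR, le_div_iff₀ hpos, ← abs_mul]
        have e1 : (β - cdet e v / cdet e f) * cdet e f = β * cdet e f - cdet e v := by field_simp
        rwa [e1]
      rw [abs_le] at h2
      constructor <;> linarith) fun t t' β h1 h2 => h.sub_le he h1 h2
  refine key.trans ?_
  rw [mul_add]
  refine add_le_add ?_ ?_
  · rw [← mul_assoc]
    gcongr
    refine mul_le_of_le_one_left (by positivity) ?_
    rw [← ENNReal.ofReal_one]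
    exact ENNReal.ofReal_le_ofReal habs
  · rw [← ENNReal.ofReal_mul hl₀, ← ENNReal.ofReal_mul hpos.le]
    refine ENNReal.ofReal_le_ofReal ?_
    have e1 : |cdet e f| * (l₀ * (cdet e v / cdet e f + R - (cdet e v / cdet e f - R))) =
        2 * l₀ * (√2 * (√(F.val e) * √s)) := by
      rw [hR]
      field_simp
      ring
    rw [e1]
    have : √2 * (√(F.val e) * √s) ≤ 3 / 2 * (√(F.val e) * √s) := by gcongr
    nlinarith

/-- A positive proportion of the lines in the direction `e` meet `A` in a long segment. -/
theorem exists_long_lines (h : Encloses F v s κ A) (hA : Convex ℝ A) (hκ : 0 < κ) {e f : ℂ}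
    (he : 0 < F.val e) (hδ : cdet e f ^ 2 = 1 / 2) :
    ∃ β₁ β₂ : ℝ, √(F.val e) * √s / (48 * κ) ≤ β₂ - β₁ ∧ ∀ β ∈ Set.Icc β₁ β₂, ∃ t t' : ℝ,
      t • e + β • f ∈ A ∧ t' • e + β • f ∈ A ∧ √s / √(F.val e) / (32 * κ) ≤ t' - t := by
  have hsa : 0 < √(F.val e) := Real.sqrt_pos.2 he
  have hss : 0 < √s := Real.sqrt_pos.2 h.pos
  have hs2 : √s * √s = s := Real.mul_self_sqrt h.pos.le
  set J := longLines A e f (√s / √(F.val e) / (32 * κ)) with hJ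
  have h1 := h.volume_le hA he hδ (l₀ := √s / √(F.val e) / (32 * κ)) (by positivity)
  have e1 : 3 * (√s / √(F.val e) / (32 * κ)) * (√(F.val e) * √s) = 3 * s / (32 * κ) := by
    field_simp
    linear_combination hs2
  rw [e1, ← hJ] at h1
  have h2 : ENNReal.ofReal (s / (4 * κ)) ≤ volume A := by
    have : s / (4 * κ) ≤ volume.real A := by
      rw [div_le_iff₀ (by positivity)]
      linarith [h.le_area]
    refine (ENNReal.ofReal_le_ofReal this).trans ?_
    exact ENNReal.ofReal_toReal_le
  -- In units of `s / (32 κ)`, the area of `A` is at least `8`, while the short chords account for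
  -- at most `3`. If the long lines had smaller measure than claimed, they would add at most `4`.
  have h3 : ENNReal.ofReal (√(F.val e) * √s / (24 * κ)) ≤ volume J := by
    by_contra hc
    push Not at hc
    have h4 := h2.trans h1
    have h5 : ENNReal.ofReal (3 * (√s / √(F.val e))) * volume J ≤
        ENNReal.ofReal (3 * (√s / √(F.val e)) * (√(F.val e) * √s / (24 * κ))) := by
      rw [ENNReal.ofReal_mul (p := 3 * (√s / √(F.val e))) (by positivity)]
      gcongr
    have h6 := h4.trans (add_le_add h5 le_rfl)
    rw [← ENNReal.ofReal_add (by positivity) (by have := h.pos; positivity),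
      ENNReal.ofReal_le_ofReal_iff (by have := h.pos; positivity)] at h6
    have e2 : 3 * (√s / √(F.val e)) * (√(F.val e) * √s / (24 * κ)) = s / (8 * κ) := by
      field_simp
      linear_combination 24 * hs2
    rw [e2] at h6
    have e3 : s / (4 * κ) = 8 * (s / (32 * κ)) := by field_simp; ring
    have e4 : s / (8 * κ) = 4 * (s / (32 * κ)) := by field_simp; ring
    have e5 : 3 * s / (32 * κ) = 3 * (s / (32 * κ)) := by ring
    have : 0 < s / (32 * κ) := by have := h.pos; positivity
    linarith
  -- The endpoints of the interval of long lines need not belong to it; settling for half its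
  -- measure gives the `48`.
  obtain ⟨β₁, hβ₁, β₂, hβ₂, h4⟩ := exists_sub_le_of_le_volume (by positivity) h3
  refine ⟨β₁, β₂, ?_, fun β hβ => ?_⟩
  · refine le_trans (le_of_eq ?_) h4
    field_simp
    norm_num
  · have := (convex_longLines hA e f _).ordConnected.out hβ₁ hβ₂ hβ
    obtain ⟨t, t', k1, k2, k3⟩ := this
    exact ⟨t, t', k1, k2, k3.le⟩

end Encloses

/-! ### Bounding boxes, and what uprightness says about an enclosing ellipse -/

theorem volume_real_bbox (A : Set ℂ) : volume.real (bbox A) =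
    volume.real (Set.Icc (sInf (Complex.re '' A)) (sSup (Complex.re '' A))) *
    volume.real (Set.Icc (sInf (Complex.im '' A)) (sSup (Complex.im '' A))) := by
  have h1 := Complex.volume_preserving_equiv_real_prod.measure_preimage
    (s := Set.Icc (sInf (Complex.re '' A)) (sSup (Complex.re '' A)) ×ˢ
    Set.Icc (sInf (Complex.im '' A)) (sSup (Complex.im '' A)))
    (measurableSet_Icc.prod measurableSet_Icc).nullMeasurableSet
  have h2 : Complex.measurableEquivRealProd ⁻¹'
    (Set.Icc (sInf (Complex.re '' A)) (sSup (Complex.re '' A)) ×ˢ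
    Set.Icc (sInf (Complex.im '' A)) (sSup (Complex.im '' A))) = bbox A := rfl
  rw [h2, Measure.volume_eq_prod, Measure.prod_prod] at h1
  simp only [Measure.real, h1, ENNReal.toReal_mul]

theorem volume_real_le_of_sections {A : Set ℂ} (hA : Convex ℝ A) {e f : ℂ} (hδ : |cdet e f| = 1)
    {b₀ b₁ l₁ : ℝ} (h01 : b₀ ≤ b₁) (hl : 0 ≤ l₁)
    (hI : ∀ z ∈ A, ∀ t β : ℝ, t • e + β • f = z → β ∈ Set.Icc b₀ b₁)
    (hl₁ : ∀ t t' β : ℝ, t • e + β • f ∈ A → t' • e + β • f ∈ A → t' - t ≤ l₁) :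
    volume.real A ≤ l₁ * (b₁ - b₀) := by
  have h1 := volume_le_of_sections hA (l₀ := l₁)
    (by intro h0; rw [h0] at hδ; simp at hδ) hI hl₁
  have h2 : longLines A e f l₁ = ∅ := by
    refine Set.eq_empty_of_forall_notMem ?_
    rintro β ⟨t, t', k1, k2, k3⟩
    exact absurd (hl₁ t t' β k1 k2) (not_le.2 k3)
  rw [h2, measure_empty, mul_zero, zero_add, hδ, ENNReal.ofReal_one, one_mul,
    ← ENNReal.ofReal_mul hl] at h1
  exact ENNReal.toReal_le_of_le_ofReal (mul_nonneg hl (sub_nonneg.2 h01)) h1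

section upright

variable {A : Set ℂ} (hb : Bornology.IsBounded A)

include hb

theorem re_mem_Icc {z : ℂ} (hz : z ∈ A) :
    z.re ∈ Set.Icc (sInf (Complex.re '' A)) (sSup (Complex.re '' A)) := by
  obtain ⟨C, hC⟩ := hb.exists_norm_le
  have h : ∀ z ∈ A, |z.re| ≤ C := fun z hz => (Complex.abs_re_le_norm z).trans (hC z hz)
  constructor
  · refine csInf_le ⟨-C, ?_⟩ ⟨z, hz, rfl⟩
    rintro _ ⟨w, hw, rfl⟩
    exact (abs_le.1 (h w hw)).1
  · refine le_csSup ⟨C, ?_⟩ ⟨z, hz, rfl⟩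
    rintro _ ⟨w, hw, rfl⟩
    exact (abs_le.1 (h w hw)).2

theorem im_mem_Icc {z : ℂ} (hz : z ∈ A) :
    z.im ∈ Set.Icc (sInf (Complex.im '' A)) (sSup (Complex.im '' A)) := by
  obtain ⟨C, hC⟩ := hb.exists_norm_le
  have h : ∀ z ∈ A, |z.im| ≤ C := fun z hz => (Complex.abs_im_le_norm z).trans (hC z hz)
  constructor
  · refine csInf_le ⟨-C, ?_⟩ ⟨z, hz, rfl⟩
    rintro _ ⟨w, hw, rfl⟩
    exact (abs_le.1 (h w hw)).1
  · refine le_csSup ⟨C, ?_⟩ ⟨z, hz, rfl⟩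
    rintro _ ⟨w, hw, rfl⟩
    exact (abs_le.1 (h w hw)).2

theorem uprightness_le_one : uprightness A ≤ 1 := by
  refine div_le_one_of_le₀ ?_ measureReal_nonneg
  refine measureReal_mono (fun z hz => ⟨re_mem_Icc hb hz, im_mem_Icc hb hz⟩) ?_
  have : IsCompact (bbox A) := isCompact_Icc.reProdIm isCompact_Icc
  exact this.measure_lt_top.ne

/-- Horizontal chords have length at most `3 √s / √p`, so the area of `A` is at most this times the
height of the box; likewise for vertical chords with `r` and the width. Multiplying the two
estimates gives `area² ≤ 9 s · area(BBox) / √(p r)`, and `s ≤ 4 κ area` with `M · area(BBox) ≤ area`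
leaves `√(p r) ≤ 36 κ / M`. -/
theorem Encloses.mul_le_of_isUpright {F : Form} {v : ℂ} {s κ M : ℝ} (h : Encloses F v s κ A)
    (hA : Convex ℝ A) (hκ : 0 < κ) (hM : 0 < M) (hu : IsUpright M A) :
    F.p * F.r ≤ (36 * κ / M) ^ 2 := by
  have harea : 0 < volume.real A := by
    have h1 := h.le_area
    have h2 := h.pos
    by_contra hc
    push Not at hc
    nlinarith
  obtain ⟨z, hz⟩ : A.Nonempty := by
    rw [Set.nonempty_iff_ne_empty]
    rintro rfl
    simp at harea
  have hx := re_mem_Icc hb hz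
  have hy := im_mem_Icc hb hz
  set x₀ := sInf (Complex.re '' A)
  set x₁ := sSup (Complex.re '' A)
  set y₀ := sInf (Complex.im '' A)
  set y₁ := sSup (Complex.im '' A)
  have hx01 : x₀ ≤ x₁ := hx.1.trans hx.2
  have hy01 : y₀ ≤ y₁ := hy.1.trans hy.2
  have hp : 0 < F.p := F.pos
  have hr : 0 < F.r := F.r_pos
  have hs := h.pos
  have a1 : volume.real A ≤ 3 * (√s / √F.p) * (y₁ - y₀) := by
    refine volume_real_le_of_sections hA (e := 1) (f := Complex.I) (by simp [cdet]) hy01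
      (by positivity) ?_ ?_
    · rintro z hz t β rfl
      have := im_mem_Icc hb hz
      simpa using this
    · intro t t' β h1 h2
      have := h.sub_le (by rw [F.val_one]; exact hp) h1 h2
      rwa [F.val_one] at this
  have a2 : volume.real A ≤ 3 * (√s / √F.r) * (x₁ - x₀) := by
    refine volume_real_le_of_sections hA (e := Complex.I) (f := 1) (by simp [cdet]) hx01
      (by positivity) ?_ ?_
    · rintro z hz t β rfl
      have := re_mem_Icc hb hz
      simpa using this
    · intro t t' β h1 h2
      have := h.sub_le (by rw [F.val_I]; exact hr) h1 h2
      rwa [F.val_I] at this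
  have hbox : volume.real (bbox A) = (x₁ - x₀) * (y₁ - y₀) := by
    rw [volume_real_bbox, Real.volume_real_Icc_of_le hx01, Real.volume_real_Icc_of_le hy01]
  have hXY : 0 < (x₁ - x₀) * (y₁ - y₀) := by
    refine (mul_nonneg (by linarith) (by linarith)).lt_of_ne' fun h0 => ?_
    rw [IsUpright, uprightness, hbox, h0, div_zero] at hu
    linarith
  have hu' : M * ((x₁ - x₀) * (y₁ - y₀)) ≤ volume.real A := by
    rw [IsUpright, uprightness, hbox, le_div_iff₀ hXY] at hu
    exact hu
  have hsp : 0 < √F.p := Real.sqrt_pos.2 hp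
  have hsr : 0 < √F.r := Real.sqrt_pos.2 hr
  have hss : √s * √s = s := Real.mul_self_sqrt hs.le
  have a3 := mul_le_mul a1 a2 harea.le (harea.le.trans a1)
  have e3 : 3 * (√s / √F.p) * (y₁ - y₀) * (3 * (√s / √F.r) * (x₁ - x₀)) =
      9 * s * ((x₁ - x₀) * (y₁ - y₀)) / (√F.p * √F.r) := by
    field_simp
    linear_combination 9 * (x₁ - x₀) * (y₁ - y₀) * hss
  rw [e3, le_div_iff₀ (by positivity)] at a3
  have a4 : √F.p * √F.r ≤ 36 * κ / M := by
    rw [le_div_iff₀ hM]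
    have k1 : volume.real A * (volume.real A * (√F.p * √F.r * M)) ≤
        volume.real A * (volume.real A * (36 * κ)) := by
      calc _ = (volume.real A * volume.real A * (√F.p * √F.r)) * M := by ring
        _ ≤ 9 * s * ((x₁ - x₀) * (y₁ - y₀)) * M := by gcongr
        _ = 9 * s * (M * ((x₁ - x₀) * (y₁ - y₀))) := by ring
        _ ≤ 9 * (4 * κ * volume.real A) * volume.real A := by
          have := h.le_area
          gcongr
        _ = _ := by ring
    exact le_of_mul_le_mul_left (le_of_mul_le_mul_left k1 harea) harea
  calc F.p * F.r = (√F.p * √F.r) ^ 2 := by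
        rw [mul_pow, Real.sq_sqrt hp.le, Real.sq_sqrt hr.le]
    _ ≤ _ := by gcongr

end upright

end Grid

/-! ## The enumeration of solutions, line by line -/

namespace Grid

open Real

open Classical in
/-- The output for the point `(α, α•) e + (β, β•) f`. -/
noncomputable def pointOutput (D E : SetData) (e f : ℂ × ℂ) (β α : ℝ × ℝ) : List ZOmega :=
  if D.mem (act α e + act β f).1 = true ∧ E.mem (act α e + act β f).2 = true then
    [decode (act α e + act β f)] else []

/-- The solutions on the line with parameter `β`. -/
noncomputable def linePoints (D E : SetData) (e f : ℂ × ℂ) (β : ℝ × ℝ) : List ZOmega :=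
  match D.line (β.1 • f.1) e.1, E.line (β.2 • f.2) e.2 with
  | some (x, y), some (x', y') =>
    (cands x (y - x) x' (y' - x')).flatMap (pointOutput D E e f β)
  | _, _ => []

/-- The number of loop iterations for the line with parameter `β`. -/
noncomputable def lineWork (D E : SetData) (e f : ℂ × ℂ) (β : ℝ × ℝ) : ℕ :=
  match D.line (β.1 • f.1) e.1, E.line (β.2 • f.2) e.2 with
  | some (x, y), some (x', y') =>
    numRows x (y - x) x' (y' - x') + (cands x (y - x) x' (y' - x')).length
  | _, _ => 0

theorem mem_lineSection {A : Set ℂ} {p q : ℂ} {t : ℝ} : t ∈ lineSection A p q ↔ t • q + p ∈ A := by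
  rw [lineSection, Set.mem_ofPred_eq, Complex.real_smul, add_comm]

theorem convex_lineSection {A : Set ℂ} (hA : Convex ℝ A) (p q : ℂ) :
    Convex ℝ (lineSection A p q) := by
  intro t ht t' ht' a b ha hb hab
  rw [mem_lineSection] at *
  convert hA ht ht' ha hb hab using 1
  have : p = (a + b) • p := by rw [hab, one_smul]
  nth_rw 1 [this]
  simp only [smul_eq_mul]
  module

theorem exists_half_diam_le {S : Set ℝ} (h : 0 < Metric.diam S) :
    ∃ t ∈ S, ∃ t' ∈ S, Metric.diam S / 2 ≤ t' - t := by
  by_contra hc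
  push Not at hc
  have : Metric.diam S ≤ Metric.diam S / 2 := by
    refine Metric.diam_le_of_forall_dist_le (by linarith) fun t ht t' ht' => ?_
    rw [Real.dist_eq, abs_le]
    have h1 := hc t ht t' ht'
    have h2 := hc t' ht' t ht
    constructor <;> linarith
  linarith

theorem card_le_length {α β : Type*} {s : Finset α} {l : List β} (g : α → β)
    (hg : ∀ x ∈ s, g x ∈ l) (hinj : ∀ x ∈ s, ∀ y ∈ s, g x = g y → x = y) :
    s.card ≤ l.length := by
  classical
  refine (Finset.card_le_card_of_injOn g (t := l.toFinset) (fun x hx => ?_)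
    fun x hx y hy => hinj x hx y hy).trans (List.toFinset_card_le l)
  simpa using hg x hx

section

variable {A B : Set ℂ} {D E : SetData} {κ : ℝ} {e f : ℂ × ℂ}
  (hD : D.Presents κ A) (hE : E.Presents κ B) (h : IsBasis e f)

include h in
theorem decode_comb_inj {α β α' β' : ℝ × ℝ} (hα : α ∈ quad) (hβ : β ∈ quad) (hα' : α' ∈ quad)
    (hβ' : β' ∈ quad) (heq : decode (act α e + act β f) = decode (act α' e + act β' f)) :
    α = α' ∧ β = β' := by
  refine h.comb_inj ?_
  rw [← emb_decode (h.comb_mem hα hβ), heq, emb_decode (h.comb_mem hα' hβ')]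

include hD hE h in
theorem pointOutput_eq {α β : ℝ × ℝ} (hα : α ∈ quad) (hβ : β ∈ quad) {u : ZOmega} :
    u ∈ pointOutput D E e f β α ↔ u = decode (act α e + act β f) ∧
      (act α e + act β f).1 ∈ A ∧ (act α e + act β f).2 ∈ B := by
  have hz := h.comb_mem hα hβ
  rw [← hD.mem_iff _ (mem_DOmega_fst hz), ← hE.mem_iff _ (mem_DOmega_snd hz), pointOutput]
  split_ifs with hif
  · rw [List.mem_singleton]
    exact ⟨fun h => ⟨h, hif⟩, And.left⟩
  · simp only [List.not_mem_nil, false_iff]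
    exact fun h => hif h.2

include hD hE h in
-- Both the base point `β f` and the direction `e` come from `ℤ[ω]`, so the answers of the line
-- procedures are reliable and bound `α` and `α•`. Superfluous candidates are discarded by the
-- membership tests.
theorem mem_linePoints {β : ℝ × ℝ} (hβ : β ∈ quad) {u : ZOmega} :
    u ∈ linePoints D E e f β ↔ ∃ α ∈ quad, u = decode (act α e + act β f) ∧
      (act α e + act β f).1 ∈ A ∧ (act α e + act β f).2 ∈ B := by
  have hf := act_mem_zomega hβ h.right
  have hf1 : β.1 • f.1 ∈ DOmega := mem_DOmega_fst hf
  have hf2 : β.2 • f.2 ∈ DOmega := mem_DOmega_snd hf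
  constructor
  · intro hu
    unfold linePoints at hu
    split at hu
    · obtain ⟨α, hα, hu⟩ := List.mem_flatMap.1 hu
      have hα := cands_subset_quad hα
      exact ⟨α, hα, (pointOutput_eq hD hE h hα hβ).1 hu⟩
    · simp at hu
  · rintro ⟨α, hα, hu, h1, h2⟩
    have hs1 : α.1 ∈ lineSection A (β.1 • f.1) e.1 := mem_lineSection.2 h1
    have hs2 : α.2 ∈ lineSection B (β.2 • f.2) e.2 := mem_lineSection.2 h2
    cases hl1 : D.line (β.1 • f.1) e.1 with
    | none =>
      rw [hD.line_none_iff _ hf1 _ (mem_DOmega_fst h.left) h.ne_zero_fst] at hl1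
      rw [hl1] at hs1
      exact hs1.elim
    | some xy =>
    cases hl2 : E.line (β.2 • f.2) e.2 with
    | none =>
      rw [hE.line_none_iff _ hf2 _ (mem_DOmega_snd h.left) h.ne_zero_snd] at hl2
      rw [hl2] at hs2
      exact hs2.elim
    | some xy' =>
    obtain ⟨x, y⟩ := xy
    obtain ⟨x', y'⟩ := xy'
    have k1 := (hD.line_some _ hf1 _ (mem_DOmega_fst h.left) h.ne_zero_fst
      x y hl1).1 hs1
    have k2 := (hE.line_some _ hf2 _ (mem_DOmega_snd h.left) h.ne_zero_snd
      x' y' hl2).1 hs2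
    simp only [linePoints, hl1, hl2, List.mem_flatMap]
    refine ⟨α, mem_cands (by linarith [k1.1, k1.2]) (by linarith [k2.1, k2.2]) hα ?_ ?_,
      (pointOutput_eq hD hE h hα hβ).2 ⟨hu, h1, h2⟩⟩
    · exact ⟨k1.1, by linarith [k1.2]⟩
    · exact ⟨k2.1, by linarith [k2.2]⟩

include h in
theorem nodup_linePoints {β : ℝ × ℝ} (hβ : β ∈ quad) : (linePoints D E e f β).Nodup := by
  unfold linePoints
  split
  · refine List.nodup_flatMap.2 ⟨fun α _ => ?_, ?_⟩
    · unfold pointOutput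
      split_ifs <;> simp
    · refine (nodup_cands _ _ _ _).imp_of_mem fun {α α'} hα hα' hne => ?_
      rw [Function.onFun, List.disjoint_left]
      intro u hu hu'
      unfold pointOutput at hu hu'
      split_ifs at hu hu' <;> simp at hu hu'
      exact hne (decode_comb_inj h (cands_subset_quad hα) hβ (cands_subset_quad hα') hβ
        (hu.symm.trans hu')).1
  · exact List.nodup_nil

include hD hE h in
-- The work is governed by the product of the returned interval lengths, which is at most `κ²` times
-- that of the section lengths. By convexity every point of `ℤ[√2]` in a rectangle spanned by points
-- of the two sections is a solution, and `exists_finset_quad` supplies enough of them.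
theorem lineWork_le (hA : Convex ℝ A) (hB : Convex ℝ B) {β : ℝ × ℝ} (hβ : β ∈ quad)
    (hκ : 0 < κ) : (lineWork D E e f β : ℝ) ≤
      120 * (8000 * κ ^ 2 + 1) * ((linePoints D E e f β).length + 1) := by
  have hf := act_mem_zomega hβ h.right
  have hf1 : β.1 • f.1 ∈ DOmega := mem_DOmega_fst hf
  have hf2 : β.2 • f.2 ∈ DOmega := mem_DOmega_snd hf
  cases hl1 : D.line (β.1 • f.1) e.1 with
  | none =>
    simp only [lineWork, hl1]
    push_cast
    positivity
  | some xy =>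
  cases hl2 : E.line (β.2 • f.2) e.2 with
  | none =>
    simp only [lineWork, hl1, hl2]
    push_cast
    positivity
  | some xy' =>
  obtain ⟨x, y⟩ := xy
  obtain ⟨x', y'⟩ := xy'
  obtain ⟨k1, k1'⟩ := hD.line_some _ hf1 _ (mem_DOmega_fst h.left)
    h.ne_zero_fst x y hl1
  obtain ⟨k2, k2'⟩ := hE.line_some _ hf2 _ (mem_DOmega_snd h.left)
    h.ne_zero_snd x' y' hl2
  obtain ⟨t₀, ht₀⟩ : (lineSection A (β.1 • f.1) e.1).Nonempty := by
    rw [Set.nonempty_iff_ne_empty, ne_eq, ← hD.line_none_iff _ hf1 _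
      (mem_DOmega_fst h.left) h.ne_zero_fst]
    rw [hl1]
    exact Option.some_ne_none _
  obtain ⟨t₀', ht₀'⟩ : (lineSection B (β.2 • f.2) e.2).Nonempty := by
    rw [Set.nonempty_iff_ne_empty, ne_eq, ← hE.line_none_iff _ hf2 _
      (mem_DOmega_snd h.left) h.ne_zero_snd]
    rw [hl2]
    exact Option.some_ne_none _
  have hxy : 0 ≤ y - x := by linarith [(k1 ht₀).1, (k1 ht₀).2]
  have hxy' : 0 ≤ y' - x' := by linarith [(k2 ht₀').1, (k2 ht₀').2]
  have hw : (lineWork D E e f β : ℝ) ≤ 120 * ((y - x) * (y' - x') + 1) := by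
    simp only [lineWork, hl1, hl2]
    push_cast
    exact numRows_add_length_cands_le hxy hxy'
  have hn : ∀ t ∈ lineSection A (β.1 • f.1) e.1, ∀ t' ∈ lineSection A (β.1 • f.1) e.1,
      ∀ u ∈ lineSection B (β.2 • f.2) e.2, ∀ u' ∈ lineSection B (β.2 • f.2) e.2,
      t < t' → u < u' →
      (t' - t) * (u' - u) ≤ 2000 * ((linePoints D E e f β).length + 1) := by
    intro t ht t' ht' u hu u' hu' htt huu
    obtain ⟨s, hs, hcard⟩ := exists_finset_quad htt huu
    have : s.card ≤ (linePoints D E e f β).length := by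
      refine card_le_length (fun α => decode (act α e + act β f)) (fun α hα => ?_)
        fun α hα α' hα' heq => ?_
      · obtain ⟨q1, q2, q3⟩ := hs α hα
        refine (mem_linePoints hD hE h hβ).2 ⟨α, q1, rfl, ?_, ?_⟩
        · exact mem_lineSection.1 ((convex_lineSection hA _ _).ordConnected.out ht ht' q2)
        · exact mem_lineSection.1 ((convex_lineSection hB _ _).ordConnected.out hu hu' q3)
      · exact (decode_comb_inj h (hs α hα).1 hβ (hs α' hα').1 hβ heq).1
    have : (s.card : ℝ) ≤ (linePoints D E e f β).length := by exact_mod_cast this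
    linarith
  set L := Metric.diam (lineSection A (β.1 • f.1) e.1) with hL
  set L' := Metric.diam (lineSection B (β.2 • f.2) e.2) with hL'
  have hL0 : 0 ≤ L := Metric.diam_nonneg
  have hL0' : 0 ≤ L' := Metric.diam_nonneg
  -- The diameters may not be attained, so points at half of each are used; this costs a factor `4`
  -- over `2000`.
  have hLL : L * L' ≤ 8000 * ((linePoints D E e f β).length + 1) := by
    rcases hL0.eq_or_lt with h0 | h0
    · rw [← h0, zero_mul]
      positivity
    rcases hL0'.eq_or_lt with h0' | h0'
    · rw [← h0', mul_zero]
      positivity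
    obtain ⟨t, ht, t', ht', h3⟩ := exists_half_diam_le h0
    obtain ⟨u, hu, u', hu', h4⟩ := exists_half_diam_le h0'
    have h5 := hn t ht t' ht' u hu u' hu' (by linarith) (by linarith)
    have h6 : L / 2 * (L' / 2) ≤ (t' - t) * (u' - u) :=
      mul_le_mul h3 h4 (by linarith) (by linarith)
    linarith
  have h7 : (y - x) * (y' - x') ≤ κ * L * (κ * L') := mul_le_mul k1' k2' hxy' (by positivity)
  have h8 : κ ^ 2 * (L * L') ≤ κ ^ 2 * (8000 * ((linePoints D E e f β).length + 1)) := by gcongr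
  have h9 : (0 : ℝ) ≤ (linePoints D E e f β).length := by positivity
  nlinarith

/-- All solutions, given lower bounds for the parameters `(β, β•)` of lines and lengths of the
intervals that contain them. -/
noncomputable def enumerate (D E : SetData) (e f : ℂ × ℂ) (X a X' b : ℝ) : List ZOmega :=
  (cands X a X' b).flatMap (linePoints D E e f)

/-- The number of loop iterations in the enumeration of all solutions. -/
noncomputable def work (D E : SetData) (e f : ℂ × ℂ) (X a X' b : ℝ) : ℕ :=
  numRows X a X' b + ((cands X a X' b).map fun β => lineWork D E e f β + 1).sum

include hD hE h in
theorem mem_enumerate {X a X' b : ℝ} (ha : 0 ≤ a) (hb : 0 ≤ b)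
    (hX : ∀ z ∈ A, √2 * cdet e.1 z ∈ Set.Icc X (X + a))
    (hX' : ∀ z ∈ B, -(√2 * cdet e.2 z) ∈ Set.Icc X' (X' + b)) {u : ZOmega} :
    u ∈ enumerate D E e f X a X' b ↔ IsSolution A B u := by
  simp only [enumerate, List.mem_flatMap]
  constructor
  · rintro ⟨β, hβ, hu⟩
    have hβ := cands_subset_quad hβ
    obtain ⟨α, hα, rfl, h1, h2⟩ := (mem_linePoints hD hE h hβ).1 hu
    rw [← emb_decode (h.comb_mem hα hβ)] at h1 h2
    exact ⟨h1, h2⟩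
  · rintro ⟨h1, h2⟩
    obtain ⟨α, hα, β, hβ, hu⟩ := h.exists_comb (z := u.emb) ⟨u, rfl⟩
    have e1 : (act α e + act β f).1 = u.toComplex := by rw [hu]; rfl
    have e2 : (act α e + act β f).2 = u.bul.toComplex := by rw [hu]; rfl
    refine ⟨β, mem_cands ha hb hβ ?_ ?_, (mem_linePoints hD hE h hβ).2
      ⟨α, hα, by rw [hu, decode_emb], by rwa [e1], by rwa [e2]⟩⟩
    · rw [← (h.coeff_fst α.1 β.1).1]
      rw [← e1] at h1
      exact hX _ h1
    · rw [← (h.coeff_snd α.2 β.2).1]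
      rw [← e2] at h2
      exact hX' _ h2

include hD hE h in
theorem nodup_enumerate (X a X' b : ℝ) : (enumerate D E e f X a X' b).Nodup := by
  refine List.nodup_flatMap.2 ⟨fun β hβ => nodup_linePoints h (cands_subset_quad hβ), ?_⟩
  refine (nodup_cands _ _ _ _).imp_of_mem fun {β β'} hβ hβ' hne => ?_
  rw [Function.onFun, List.disjoint_left]
  intro u hu hu'
  have hβ := cands_subset_quad hβ
  have hβ' := cands_subset_quad hβ'
  obtain ⟨α, hα, rfl, -⟩ := (mem_linePoints hD hE h hβ).1 hu
  obtain ⟨α', hα', heq, -⟩ := (mem_linePoints hD hE h hβ').1 hu'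
  exact hne (decode_comb_inj h hα hβ hα' hβ' heq).2

include hD hE h in
-- Summing `lineWork_le` over the lines gives the number of solutions plus the number of lines, and
-- the latter is controlled by the area `a * b` of the rectangle of parameters.
theorem work_le_of_area (hA : Convex ℝ A) (hB : Convex ℝ B) (hκ : 0 < κ) {X a X' b c : ℝ}
    (ha : 0 ≤ a) (hb : 0 ≤ b)
    (hab : a * b ≤ c * ((enumerate D E e f X a X' b).length + 1)) :
    (work D E e f X a X' b : ℝ) ≤ (120 * (c + 1) + 120 * (8000 * κ ^ 2 + 1) *
      (120 * (c + 1) + 1)) * ((enumerate D E e f X a X' b).length + 1) := by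
  have h1 := numRows_add_length_cands_le (X := X) (X' := X') ha hb
  have h2 : (((cands X a X' b).map fun β => lineWork D E e f β + 1).sum : ℝ) ≤
      (cands X a X' b).length + 120 * (8000 * κ ^ 2 + 1) *
        ((enumerate D E e f X a X' b).length + (cands X a X' b).length) := by
    have key : ∀ l : List (ℝ × ℝ), (∀ β ∈ l, β ∈ quad) →
        ((l.map fun β => lineWork D E e f β + 1).sum : ℝ) ≤ l.length + 120 * (8000 * κ ^ 2 + 1) *
          ((l.flatMap (linePoints D E e f)).length + l.length) := by
      intro l hl
      induction l with
      | nil => simp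
      | cons β l ih =>
        have h3 := lineWork_le hD hE h hA hB (hl β List.mem_cons_self) hκ
        have h4 := ih fun β' hβ' => hl β' (List.mem_cons_of_mem _ hβ')
        simp only [List.map_cons, List.sum_cons, List.flatMap_cons, List.length_append,
          List.length_cons]
        push_cast at h4 ⊢
        linarith
    exact key _ fun β hβ => cands_subset_quad hβ
  simp only [work]
  push_cast at h2 ⊢
  set N : ℝ := ((enumerate D E e f X a X' b).length : ℝ) with hN
  have hN0 : 0 ≤ N := by rw [hN]; positivity
  set n : ℝ := ((cands X a X' b).length : ℝ) with hn
  have hn0 : 0 ≤ n := by rw [hn]; positivity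
  have hr : (0 : ℝ) ≤ numRows X a X' b := by positivity
  have h5 : numRows X a X' b + n ≤ 120 * (c + 1) * (N + 1) := by nlinarith
  have h6 : N + n ≤ (120 * (c + 1) + 1) * (N + 1) := by linarith
  have h7 : 120 * (8000 * κ ^ 2 + 1) * (N + n) ≤
      120 * (8000 * κ ^ 2 + 1) * ((120 * (c + 1) + 1) * (N + 1)) := by gcongr
  nlinarith

include h in
/-- If the direction `e` of the lines is a short vector, then the number of lines is at most
proportional to the number of solutions. -/
theorem area_le (hA : Convex ℝ A) (hB : Convex ℝ B) (hκ : 0 < κ) {F G : Form} {v v' : ℂ}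
    {s s' : ℝ} (hF : Encloses F v s κ A) (hG : Encloses G v' s' κ B)
    (hshort : nrm F G e ≤ 109) {l : List ZOmega} (hl : ∀ u, u ∈ l ↔ IsSolution A B u) :
    4 * (√(F.val e.1) * √s) * (4 * (√(G.val e.2) * √s')) ≤
      4000000000 * κ ^ 2 * (l.length + 1) := by
  have ha := h.val_fst_pos F
  have hb := h.val_snd_pos G
  obtain ⟨β₁, β₂, h1, h2⟩ := hF.exists_long_lines hA hκ ha h.cdet_fst_sq
  obtain ⟨β₁', β₂', h1', h2'⟩ := hG.exists_long_lines hB hκ hb h.cdet_snd_sq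
  have hsa : 0 < √(F.val e.1) := Real.sqrt_pos.2 ha
  have hsb : 0 < √(G.val e.2) := Real.sqrt_pos.2 hb
  have hss : 0 < √s := Real.sqrt_pos.2 hF.pos
  have hss' : 0 < √s' := Real.sqrt_pos.2 hG.pos
  have hab : √(F.val e.1) * √(G.val e.2) * (√(F.val e.1) * √(G.val e.2)) ≤ 109 := by
    have e1 : √(F.val e.1) * √(G.val e.2) * (√(F.val e.1) * √(G.val e.2)) = nrm F G e := by
      rw [nrm, mul_mul_mul_comm, Real.mul_self_sqrt ha.le, Real.mul_self_sqrt hb.le]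
    rwa [e1]
  generalize √(F.val e.1) = a at *
  generalize √(G.val e.2) = b at *
  generalize √s = σ at *
  generalize √s' = σ' at *
  have hn0 : (0 : ℝ) ≤ l.length := by positivity
  -- When the long chords are too short to guarantee a solution, `σ σ'` is at most a multiple of `κ²
  -- a b`, so the area is at most a multiple of `κ² (a b)²`. Only here the bound `109` enters, and
  -- it makes this a constant.
  by_cases hP : σ / a / (32 * κ) * (σ' / b / (32 * κ)) ≤ 2000
  · have e1 : σ / a / (32 * κ) * (σ' / b / (32 * κ)) = σ * σ' / (a * b * (1024 * κ ^ 2)) := by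
      field_simp
      norm_num
    rw [e1, div_le_iff₀ (by positivity)] at hP
    have e2 : 4 * (a * σ) * (4 * (b * σ')) = 16 * (a * b) * (σ * σ') := by ring
    rw [e2]
    calc 16 * (a * b) * (σ * σ') ≤ 16 * (a * b) * (2000 * (a * b * (1024 * κ ^ 2))) := by gcongr
      _ = 16 * 2000 * 1024 * κ ^ 2 * (a * b * (a * b)) := by ring
      _ ≤ 16 * 2000 * 1024 * κ ^ 2 * 109 := by gcongr
      _ ≤ _ := by nlinarith [sq_nonneg κ, mul_nonneg (sq_nonneg κ) hn0]
  · push Not at hP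
    have hpos : 0 < a * σ / (48 * κ) := by positivity
    have hpos' : 0 < b * σ' / (48 * κ) := by positivity
    obtain ⟨S, hS, hcard⟩ := exists_finset_quad (x := β₁) (y := β₂) (x' := β₁') (y' := β₂')
      (by linarith) (by linarith)
    -- The product of the two chord lengths exceeds `2000`, so `exists_finset_quad` yields a
    -- non-empty set. One solution on each line is enough, as different lines have different
    -- solutions.
    have hex : ∀ β ∈ S, ∃ α ∈ quad, decode (act α e + act β f) ∈ l := by
      intro β hβ
      obtain ⟨q1, q2, q3⟩ := hS β hβ
      obtain ⟨t, t', r1, r2, r3⟩ := h2 _ q2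
      obtain ⟨u, u', r1', r2', r3'⟩ := h2' _ q3
      have hp1 : 0 < σ / a / (32 * κ) := by positivity
      have hp2 : 0 < σ' / b / (32 * κ) := by positivity
      obtain ⟨R, hR, hRcard⟩ := exists_finset_quad (x := t) (y := t') (x' := u) (y' := u')
        (by linarith) (by linarith)
      have h3 : σ / a / (32 * κ) * (σ' / b / (32 * κ)) ≤ (t' - t) * (u' - u) :=
        mul_le_mul r3 r3' hp2.le (by linarith)
      have h4 : (0 : ℝ) < R.card := by linarith
      obtain ⟨α, hα⟩ : R.Nonempty := Finset.card_pos.1 (by exact_mod_cast h4)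
      obtain ⟨w1, w2, w3⟩ := hR α hα
      refine ⟨α, w1, (hl _).2 ?_⟩
      have m1 : (act α e + act β f).1 ∈ A := mem_lineSection.1
        ((convex_lineSection hA _ _).ordConnected.out (mem_lineSection.2 r1)
          (mem_lineSection.2 r2) w2)
      have m2 : (act α e + act β f).2 ∈ B := mem_lineSection.1
        ((convex_lineSection hB _ _).ordConnected.out (mem_lineSection.2 r1')
          (mem_lineSection.2 r2') w3)
      rw [← emb_decode (h.comb_mem w1 q1)] at m1 m2
      exact ⟨m1, m2⟩
    choose! g hg1 hg2 using hex
    have hle : S.card ≤ l.length := card_le_length (fun β => decode (act (g β) e + act β f)) hg2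
      fun β hβ β' hβ' heq =>
        (decode_comb_inj h (hg1 β hβ) (hS β hβ).1 (hg1 β' hβ') (hS β' hβ').1 heq).2
    have hle : (S.card : ℝ) ≤ l.length := by exact_mod_cast hle
    have h3 : a * σ / (48 * κ) * (b * σ' / (48 * κ)) ≤ (β₂ - β₁) * (β₂' - β₁') :=
      mul_le_mul h1 h1' hpos'.le (by linarith)
    have e1 : a * σ / (48 * κ) * (b * σ' / (48 * κ)) = a * σ * (b * σ') / (2304 * κ ^ 2) := by
      field_simp
      norm_num
    have h4 : a * σ * (b * σ') / (2304 * κ ^ 2) ≤ 2000 * (l.length + 1) := by linarith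
    rw [div_le_iff₀ (by positivity)] at h4
    have : 0 ≤ κ ^ 2 * (l.length + 1 : ℝ) := by positivity
    linarith

end

end Grid

/-! ## Loops over integers and over points of `ℤ[√2]` -/

namespace Grid

open Real

namespace Arith

/-- `√2` -/
def sqrtTwo : Arith := 2 ^ (1 / 2 : Arith)

/-- `3 + 2 √2` -/
def unitTerm : Arith := 3 + 2 * sqrtTwo

/-- The power of the unit that is used for rescaling. -/
def scaleTerm (a : Arith) : Arith := unitTerm ^ floor (log a / (2 * log unitTerm))

variable (ρ : ℕ → ℝ)

@[simp] theorem eval_sqrtTwo : sqrtTwo.eval ρ = √2 := by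
  simp [sqrtTwo, Real.sqrt_eq_rpow]

@[simp] theorem ok_sqrtTwo : sqrtTwo.Ok ρ := by
  simp [sqrtTwo]

@[simp] theorem eval_unitTerm : unitTerm.eval ρ = Grid.unit := by
  simp [unitTerm, Grid.unit]

@[simp] theorem ok_unitTerm : unitTerm.Ok ρ := by
  simp [unitTerm]

@[simp] theorem eval_scaleTerm (a : Arith) : (scaleTerm a).eval ρ = Grid.scale (a.eval ρ) := by
  simp [scaleTerm, Grid.scale]

@[simp] theorem ok_scaleTerm (a : Arith) : (scaleTerm a).Ok ρ ↔ a.Ok ρ ∧ 0 < a.eval ρ := by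
  have h1 := log_unit_pos.ne'
  have h2 := unit_pos
  simp only [scaleTerm, ok_pow, ok_floor, ok_div, ok_log, ok_mul, ok_ofNat, ok_unitTerm, eval_unitTerm,
    eval_mul, eval_ofNat, eval_log]
  simp [h1, h2]

end Arith

open Arith

/-- `for x = ⌊x⌋, ⌊x⌋ + 1, … while x < y`, where `x` is an integer. -/
def forLoop (x y : ℕ) (P : Prog) : Prog := loop x y (seqs [P, asgs [(x, v x + 1)]])

/-- The first `k` integers from `n₀` on, in descending order. -/
def intsUpTo (n₀ : ℤ) (k : ℕ) : List ℤ := (List.range k).reverse.map fun i : ℕ => n₀ + i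

theorem intsUpTo_succ (n₀ : ℤ) (k : ℕ) :
    intsUpTo n₀ (k + 1) = (n₀ + k) :: intsUpTo n₀ k := by
  simp [intsUpTo, List.range_succ]

variable {O : Fin 2 → SetData} {ρ : ℕ → ℝ} {out : List ZOmega}

/-- Variables from `b` on are scratch space for the body. The `9` consists of `7` steps for the
increment, one for the empty end of the sequence and one comparison. -/
theorem runs_forLoop {x y b : ℕ} {P : Prog} (hx : x < b) (hy : y < b) (hxy : x ≠ y) {n₀ : ℤ}
    (hn₀ : ρ x = n₀) (g : ℤ → List ZOmega) (c : ℤ → ℕ)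
    (hP : ∀ n ∈ intsFrom n₀ (ρ y), ∀ (ρ' : ℕ → ℝ) (out' : List ZOmega), ρ' x = n → (∀ i < b, i ≠ x → ρ' i = ρ i) →
      Runs O P ρ' out' fun ρ'' out'' k =>
        (∀ i < b, ρ'' i = ρ' i) ∧ out'' = g n ++ out' ∧ k ≤ c n) :
    Runs O (forLoop x y P) ρ out fun ρ' out' k => (∀ i < b, i ≠ x → ρ' i = ρ i) ∧
      out' = (intsFrom n₀ (ρ y)).flatMap g ++ out ∧
      k ≤ ((intsFrom n₀ (ρ y)).map fun n => c n + 9).sum + 1 := by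
  have hfrom : intsFrom n₀ (ρ y) = intsUpTo n₀ ⌈ρ y - n₀⌉₊ := rfl
  refine (runs_loop (fun ρ' out' t => ∃ k : ℕ, ρ' x = (n₀ : ℝ) + k ∧ (∀ i < b, i ≠ x → ρ' i = ρ i) ∧
    out' = (intsUpTo n₀ k).flatMap g ++ out ∧
    t ≤ ((intsUpTo n₀ k).map fun n => c n + 9).sum ∧ k ≤ ⌈ρ y - n₀⌉₊)
    (fun ρ' => ⌈ρ' y - ρ' x⌉₊) ?_ ?_).mono ?_
  · exact ⟨0, by simp [hn₀], fun _ _ _ => rfl, by simp [intsUpTo], by simp, by simp⟩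
  · rintro ρ' out' t ⟨k, h1, h2, h3, h4, h5⟩ hlt
    have hρy := h2 y hy hxy.symm
    have hmem : n₀ + (k : ℤ) ∈ intsFrom n₀ (ρ y) := by
      rw [mem_intsFrom]
      push_cast
      exact ⟨by omega, by rw [← h1, ← hρy]; exact hlt⟩
    refine runs_seqs_cons ((hP _ hmem ρ' out' (by rw [h1]; push_cast; rfl) h2).mono ?_)
    rintro ρ₁ out₁ m ⟨k1, rfl, k3⟩
    refine runs_seqs_cons (runs_asgs_size (by simp) fun m' hm' => runs_seqs_nil ⟨⟨k + 1, ?_, ?_, ?_,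
      ?_, ?_⟩, ?_⟩)
    · simp [k1 x hx, h1, add_assoc]
    · intro i hi hix
      simp [Function.update_of_ne hix, k1 i hi, h2 i hi hix]
    · rw [intsUpTo_succ, List.flatMap_cons, List.append_assoc, h3]
    · rw [intsUpTo_succ, List.map_cons, List.sum_cons]
      have : size (asgs [(x, v x + 1)]) = 7 := rfl
      omega
    · rw [mem_intsFrom] at hmem
      have := hmem.2
      push_cast at this
      rw [Nat.succ_le_iff, Nat.lt_ceil]
      linarith
    · have e1 : assignAll [(x, v x + 1)] ρ₁ y = ρ' y := by
        simp [Function.update_of_ne hxy.symm, k1 y hy]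
      have e2 : assignAll [(x, v x + 1)] ρ₁ x = ρ' x + 1 := by simp [k1 x hx]
      rw [e1, e2, Nat.lt_ceil]
      by_cases h0 : 0 ≤ ρ' y - (ρ' x + 1)
      · have := Nat.ceil_lt_add_one h0
        linarith
      · rw [Nat.ceil_eq_zero.2 (not_le.1 h0).le]
        push_cast
        linarith
  · rintro ρ' out' n ⟨t, rfl, ⟨k, h1, h2, h3, h4, h5⟩, hlt⟩
    have hk : k = ⌈ρ y - n₀⌉₊ := by
      refine le_antisymm h5 (Nat.ceil_le.2 ?_)
      rw [h1, h2 y hy hxy.symm] at hlt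
      linarith [not_lt.1 hlt]
    rw [hfrom, ← hk]
    exact ⟨h2, h3, by omega⟩

/-- Preparation of the enumeration of points in a rectangle: its lower left corner is in `b` and
`b + 2`, its sides are in `b + 1` and `b + 3`. -/
def prepare (b : ℕ) : Prog := seqs
  [cond 0 (v (b + 3)) (asgs [(b + 1, v (b + 1) + 1 / v (b + 3))])
    (cond 0 (v (b + 1)) (asgs [(b + 3, 1 / v (b + 1))]) (asgs [(b + 1, 1), (b + 3, 1)])),
  asgs [(b + 4, scaleTerm (v (b + 1) / v (b + 3))), (b, v b / v (b + 4)),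
    (b + 1, v (b + 1) / v (b + 4)), (b + 2, v (b + 2) * v (b + 4)),
    (b + 3, v (b + 3) * v (b + 4)),
    (b + 5, floor ((v b - v (b + 2) - v (b + 3)) / (2 * sqrtTwo))),
    (b + 6, (v b - v (b + 2) + v (b + 1)) / (2 * sqrtTwo) + 1)]]

/-- Bounds for the second loop. -/
def prepareRow (b : ℕ) : Prog := asgs [(b + 7, floor (v (b + 2) + v (b + 5) * sqrtTwo)),
  (b + 8, v (b + 2) + v (b + 3) + v (b + 5) * sqrtTwo + 1)]

/-- The point of `ℤ[√2]` for the current values of the two loop variables. -/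
def preparePoint (b : ℕ) : Prog := asgs
  [(b + 9, v (b + 4) * (v (b + 7) + v (b + 5) * sqrtTwo)),
    (b + 10, (v (b + 7) - v (b + 5) * sqrtTwo) / v (b + 4))]

/-- Run the program `P` for all points in a list that contains the points of `ℤ[√2]` in a
rectangle. -/
def forEach (b : ℕ) (P : Prog) : Prog := seqs
  [prepare b, forLoop (b + 5) (b + 6) (seqs
    [prepareRow b, forLoop (b + 7) (b + 8) (seqs [preparePoint b, P])])]

theorem loopFree_prepare (b : ℕ) : LoopFree (prepare b) := by
  refine loopFree_seqs fun P hP => ?_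
  simp only [List.mem_cons, List.not_mem_nil, or_false] at hP
  rcases hP with rfl | rfl
  · exact loopFree_cond (loopFree_asgs _) (loopFree_cond (loopFree_asgs _) (loopFree_asgs _))
  · exact loopFree_asgs _

theorem runs_prepare (b : ℕ) (ha : 0 ≤ ρ (b + 1)) (hb : 0 ≤ ρ (b + 3)) {w w' θ : ℝ}
    (hw : w = (widen (ρ (b + 1)) (ρ (b + 3))).1) (hw' : w' = (widen (ρ (b + 1)) (ρ (b + 3))).2)
    (hθ : θ = scale (w / w')) :
    Runs O (prepare b) ρ out fun ρ' out' n => ((∀ i < b, ρ' i = ρ i) ∧ ρ' b = ρ b / θ ∧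
      ρ' (b + 1) = w / θ ∧ ρ' (b + 2) = ρ (b + 2) * θ ∧ ρ' (b + 3) = w' * θ ∧ ρ' (b + 4) = θ ∧
      ρ' (b + 5) = ⌊(ρ b / θ - ρ (b + 2) * θ - w' * θ) / (2 * √2)⌋ ∧
      ρ' (b + 6) = (ρ b / θ - ρ (b + 2) * θ + w / θ) / (2 * √2) + 1 ∧ out' = out) ∧
      n ≤ size (prepare b) := by
  refine Runs.and_size (runs_seqs_cons ?_) (loopFree_prepare b)
  suffices H : Runs O (cond 0 (v (b + 3)) (asgs [(b + 1, v (b + 1) + 1 / v (b + 3))])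
      (cond 0 (v (b + 1)) (asgs [(b + 3, 1 / v (b + 1))]) (asgs [(b + 1, 1), (b + 3, 1)]))) ρ out
      fun ρ' out' _ => (∀ i, i ≠ b + 1 → i ≠ b + 3 → ρ' i = ρ i) ∧ ρ' (b + 1) = w ∧
        ρ' (b + 3) = w' ∧ out' = out by
    obtain ⟨-, -, hwp, hwp', -, -⟩ := widen_spec ha hb
    rw [← hw] at hwp
    rw [← hw'] at hwp'
    have hθp : 0 < θ := hθ ▸ scale_pos _
    have hs : (√2 : ℝ) ≠ 0 := by positivity
    refine H.mono ?_
    rintro ρ₁ out₁ n ⟨h1, h2, h3, rfl⟩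
    have h0 : ρ₁ b = ρ b := h1 b (by omega) (by omega)
    have h02 : ρ₁ (b + 2) = ρ (b + 2) := h1 _ (by omega) (by omega)
    refine runs_seqs_cons (runs_asgs ?_ fun m => runs_seqs_nil ?_)
    · simp [h2, h3, ← hθ, hθp.ne', div_pos hwp hwp', hwp'.ne']
    · refine ⟨fun i hi => ?_, ?_⟩
      · rw [assignAll_of_notMem, h1 i (by omega) (by omega)]
        simp
        omega
      · simp [h2, h3, ← hθ, h0, h02]
  refine runs_cond (by simp) (by simp) (fun h => ?_) (fun h => runs_cond (by simp) (by simp)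
    (fun h' => ?_) (fun h' => ?_))
  · simp at h
    refine runs_asgs (by simp [h.ne']) fun n m => ⟨fun i hi hi' => ?_, ?_⟩
    · simp [Function.update_of_ne hi]
    · simp [hw, hw', widen, h]
  · simp at h h'
    refine runs_asgs (by simp [h'.ne']) fun n m m' => ⟨fun i hi hi' => ?_, ?_⟩
    · simp [Function.update_of_ne hi']
    · simp [hw, hw', widen, h', not_lt.2 h]
  · simp at h h'
    refine runs_asgs (by simp) fun n m m' => ⟨fun i hi hi' => ?_, ?_⟩
    · simp [Function.update_of_ne hi', Function.update_of_ne hi]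
    · simp [hw, hw', widen, not_lt.2 h', not_lt.2 h]

/-- Bound for the number of steps in `forEach` that are not in its body, per iteration. -/
def overhead (b : ℕ) : ℕ := size (prepare b) + size (prepareRow b) + size (preparePoint b) + 20

/-- The loops produce exactly the list `cands`, in its order. The construct occupies the variables
from `b` to `b + 10` and leaves those above to the body, so it can be nested: `b = 22` for the lines
and `b = 43` for the points on a line. -/
theorem runs_forEach {b : ℕ} {P : Prog} (ha : 0 ≤ ρ (b + 1)) (hb : 0 ≤ ρ (b + 3))
    (g : ℝ × ℝ → List ZOmega) (c : ℝ × ℝ → ℕ)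
    (hP : ∀ p ∈ cands (ρ b) (ρ (b + 1)) (ρ (b + 2)) (ρ (b + 3)), ∀ ρ' out',
      (∀ i < b, ρ' i = ρ i) → ρ' (b + 9) = p.1 → ρ' (b + 10) = p.2 →
      Runs O P ρ' out' fun ρ'' out'' k =>
        (∀ i < b + 11, ρ'' i = ρ' i) ∧ out'' = g p ++ out' ∧ k ≤ c p) :
    Runs O (forEach b P) ρ out fun ρ' out' k => (∀ i < b, ρ' i = ρ i) ∧
      out' = (cands (ρ b) (ρ (b + 1)) (ρ (b + 2)) (ρ (b + 3))).flatMap g ++ out ∧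
      k ≤ overhead b * (numRows (ρ b) (ρ (b + 1)) (ρ (b + 2)) (ρ (b + 3)) + 1) +
        ((cands (ρ b) (ρ (b + 1)) (ρ (b + 2)) (ρ (b + 3))).map fun p => c p + overhead b).sum := by
  obtain ⟨w, hw⟩ : ∃ w, w = (widen (ρ (b + 1)) (ρ (b + 3))).1 := ⟨_, rfl⟩
  obtain ⟨w', hw'⟩ : ∃ w', w' = (widen (ρ (b + 1)) (ρ (b + 3))).2 := ⟨_, rfl⟩
  obtain ⟨θ, hθ⟩ : ∃ θ, θ = scale (w / w') := ⟨_, rfl⟩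
  have hθp : 0 < θ := hθ ▸ scale_pos _
  have hcands : cands (ρ b) (ρ (b + 1)) (ρ (b + 2)) (ρ (b + 3)) =
      (rows (ρ b / θ) (w / θ) (ρ (b + 2) * θ) (w' * θ)).flatMap fun n =>
        (row (ρ (b + 2) * θ) (w' * θ) n).map (quadPoint θ n) := by
    rw [cands, scaledCands, ← hw, ← hw', ← hθ]
  have hnum : numRows (ρ b) (ρ (b + 1)) (ρ (b + 2)) (ρ (b + 3)) =
      (rows (ρ b / θ) (w / θ) (ρ (b + 2) * θ) (w' * θ)).length := by
    rw [numRows, ← hw, ← hw', ← hθ]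
  rw [hnum]
  rw [hcands] at hP ⊢
  refine runs_seqs_cons ((runs_prepare b ha hb hw hw' hθ).mono ?_)
  rintro ρ₁ out₁ n₁ ⟨⟨h1, h2, h3, h4, h5, h6, h7, h8, hout⟩, hn₁⟩
  subst hout
  have hrows : rows (ρ b / θ) (w / θ) (ρ (b + 2) * θ) (w' * θ) =
      intsFrom ⌊(ρ b / θ - ρ (b + 2) * θ - w' * θ) / (2 * √2)⌋ (ρ₁ (b + 6)) := by
    rw [rows, h8]
  have main := runs_forLoop (O := O) (ρ := ρ₁) (out := out₁) (x := b + 5) (y := b + 6) (b := b + 7)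
    (P := seqs [prepareRow b, forLoop (b + 7) (b + 8) (seqs [preparePoint b, P])])
    (by omega) (by omega) (by omega) h7
    (fun n => (row (ρ (b + 2) * θ) (w' * θ) n).flatMap fun m => g (quadPoint θ n m))
    (fun n => ((row (ρ (b + 2) * θ) (w' * θ) n).map fun m =>
      c (quadPoint θ n m) + size (preparePoint b) + 10).sum + size (prepareRow b) + 2) ?_
  · refine runs_seqs_cons (main.mono ?_)
    rintro ρ₂ _ n₂ ⟨k1, rfl, k3⟩
    refine runs_seqs_nil ⟨fun i hi => ?_, ?_, ?_⟩
    · rw [k1 i (by omega) (by omega), h1 i hi]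
    · rw [hrows, List.flatMap_assoc]
      congr 2
      funext n
      rw [List.flatMap_map]
    · rw [← hrows] at k3
      have key : ∀ l : List ℤ, (l.map fun n => ((row (ρ (b + 2) * θ) (w' * θ) n).map fun m =>
          c (quadPoint θ n m) + size (preparePoint b) + 10).sum + size (prepareRow b) + 2 + 9).sum ≤
          overhead b * l.length + ((l.flatMap fun n => (row (ρ (b + 2) * θ) (w' * θ) n).map
            (quadPoint θ n)).map fun p => c p + overhead b).sum := by
        intro l
        induction l with
        | nil => simp
        | cons n l ih =>
          have h9 : ((row (ρ (b + 2) * θ) (w' * θ) n).map fun m =>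
              c (quadPoint θ n m) + size (preparePoint b) + 10).sum ≤
              (((row (ρ (b + 2) * θ) (w' * θ) n).map (quadPoint θ n)).map
                fun p => c p + overhead b).sum := by
            rw [List.map_map]
            refine List.sum_le_sum fun m _ => ?_
            simp only [Function.comp, overhead]
            omega
          have h10 : size (prepareRow b) + 11 ≤ overhead b := by
            simp only [overhead]
            omega
          simp only [List.map_cons, List.sum_cons, List.length_cons, List.flatMap_cons,
            List.map_append, List.sum_append, mul_add, mul_one]
          linarith
      have := key (rows (ρ b / θ) (w / θ) (ρ (b + 2) * θ) (w' * θ))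
      have h11 : size (prepare b) + 2 ≤ overhead b := by
        simp only [overhead]
        omega
      simp only [mul_add, mul_one]
      linarith
  · intro n hn ρ₂ out₂ q1 q2
    rw [← hrows] at hn
    have r2 : ρ₂ (b + 2) = ρ (b + 2) * θ := by rw [q2 _ (by omega) (by omega), h4]
    have r3 : ρ₂ (b + 3) = w' * θ := by rw [q2 _ (by omega) (by omega), h5]
    have r4 : ρ₂ (b + 4) = θ := by rw [q2 _ (by omega) (by omega), h6]
    refine runs_seqs_cons (runs_asgs_size (by simp) fun n₃ hn₃ => ?_)
    set ρ₃ := assignAll [(b + 7, floor (v (b + 2) + v (b + 5) * sqrtTwo)),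
      (b + 8, v (b + 2) + v (b + 3) + v (b + 5) * sqrtTwo + 1)] ρ₂ with hρ₃
    have s1 : ∀ i < b + 7, ρ₃ i = ρ₂ i := fun i hi => by
      rw [hρ₃, assignAll_of_notMem]
      simp
      omega
    have s7 : ρ₃ (b + 7) = ⌊ρ (b + 2) * θ + n * √2⌋ := by
      simp [hρ₃, q1, r2]
    have s8 : ρ₃ (b + 8) = ρ (b + 2) * θ + w' * θ + n * √2 + 1 := by
      simp [hρ₃, q1, r2, r3]
    have hrow : row (ρ (b + 2) * θ) (w' * θ) n =
        intsFrom ⌊ρ (b + 2) * θ + n * √2⌋ (ρ₃ (b + 8)) := by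
      rw [row, s8]
    refine runs_seqs_cons ((runs_forLoop (x := b + 7) (y := b + 8) (b := b + 9)
      (by omega) (by omega) (by omega) s7 (fun m => g (quadPoint θ n m))
      (fun m => c (quadPoint θ n m) + size (preparePoint b) + 1) ?_).mono ?_)
    · intro m hm ρ₄ out₄ t1 t2
      have u4 : ρ₄ (b + 4) = θ := by rw [t2 _ (by omega) (by omega), s1 _ (by omega), r4]
      have u5 : ρ₄ (b + 5) = n := by rw [t2 _ (by omega) (by omega), s1 _ (by omega), q1]
      refine runs_seqs_cons (runs_asgs_size (by simp [u4, hθp.ne'])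
        fun n₅ hn₅ => ?_)
      set ρ₅ := assignAll [(b + 9, v (b + 4) * (v (b + 7) + v (b + 5) * sqrtTwo)),
        (b + 10, (v (b + 7) - v (b + 5) * sqrtTwo) / v (b + 4))] ρ₄ with hρ₅
      have v1 : ∀ i < b + 9, ρ₅ i = ρ₄ i := fun i hi => by
        rw [hρ₅, assignAll_of_notMem]
        simp
        omega
      refine runs_seqs_cons ((hP (quadPoint θ n m) ?_ ρ₅ out₄ (fun i hi => ?_) ?_ ?_).mono ?_)
      · refine List.mem_flatMap.2 ⟨n, hn, List.mem_map.2 ⟨m, ?_, rfl⟩⟩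
        rwa [hrow]
      · rw [v1 i (by omega), t2 i (by omega) (by omega), s1 i (by omega),
          q2 i (by omega) (by omega), h1 i hi]
      · simp [hρ₅, quadPoint, t1, u4, u5]
      · simp [hρ₅, quadPoint, t1, u4, u5]
      · rintro ρ₆ out₆ n₆ ⟨x1, x2, x3⟩
        refine runs_seqs_nil ⟨fun i hi => ?_, x2, ?_⟩
        · rw [x1 i (by omega), v1 i hi]
        · rw [preparePoint]
          omega
    · rintro ρ₄ out₄ n₄ ⟨x1, x2, x3⟩
      rw [← hrow] at x2 x3
      refine runs_seqs_nil ⟨fun i hi => ?_, x2, ?_⟩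
      · rw [x1 i (by omega) (by omega), s1 i hi]
      · have e : ∀ m, c (quadPoint θ n m) + size (preparePoint b) + 1 + 9 =
            c (quadPoint θ n m) + size (preparePoint b) + 10 := fun m => by omega
        simp only [e] at x3
        have : n₃ ≤ size (prepareRow b) := hn₃
        omega

end Grid

/-! ## An ellipse around the enclosing polygon -/

namespace Grid

open Real MeasureTheory Arith

theorem isLinearMap_cdet (w : ℂ) : IsLinearMap ℝ (cdet w) :=
  ⟨fun x y => by simp [cdet]; ring, fun t x => by simp [cdet]; ring⟩

theorem cdet_sub (w x y : ℂ) : cdet w (x - y) = cdet w x - cdet w y := by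
  simp [cdet]
  ring

/-- A strip is convex, so it contains the hull as soon as it contains the vertices. -/
theorem abs_cdet_sub_le_of_mem_hull {V : Set ℂ} {w a : ℂ} {σ : ℝ}
    (h : ∀ v ∈ V, |cdet w (v - a)| ≤ σ) {z : ℂ} (hz : z ∈ convexHull ℝ V) :
    |cdet w (z - a)| ≤ σ := by
  have hc : Convex ℝ (cdet w ⁻¹' Set.Icc (cdet w a - σ) (cdet w a + σ)) :=
    (convex_Icc _ _).is_linear_preimage (isLinearMap_cdet w)
  have hsub : V ⊆ cdet w ⁻¹' Set.Icc (cdet w a - σ) (cdet w a + σ) := by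
    intro v hv
    have := abs_le.1 (h v hv)
    rw [cdet_sub] at this
    exact ⟨by linarith, by linarith⟩
  have := convexHull_min hsub hc hz
  rw [cdet_sub, abs_le]
  exact ⟨by linarith [this.1], by linarith [this.2]⟩

theorem normSq_sub_le_of_mem_hull {V : Set ℂ} {a : ℂ} {d : ℝ} (hd : 0 ≤ d)
    (h : ∀ v ∈ V, Complex.normSq (v - a) ≤ d) {z : ℂ} (hz : z ∈ convexHull ℝ V) :
    Complex.normSq (z - a) ≤ d := by
  have hiff : ∀ z, z ∈ Metric.closedBall a (√d) ↔ Complex.normSq (z - a) ≤ d := by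
    intro z
    rw [Metric.mem_closedBall, Complex.dist_eq, Complex.normSq_eq_norm_sq,
      Real.le_sqrt (norm_nonneg _) hd]
  rw [← hiff]
  exact convexHull_min (fun v hv => (hiff v).2 (h v hv)) (convex_closedBall _ _) hz

theorem exists_cdet_ne_zero {A : Set ℂ} (hA : (interior A).Nonempty) {w : ℂ} (hw : w ≠ 0) (a : ℂ) :
    ∃ z ∈ A, cdet w (z - a) ≠ 0 := by
  obtain ⟨z₀, hz₀⟩ := hA
  have hcont : Continuous fun t : ℝ => z₀ + t • (Complex.I * w) := by fun_prop
  have hev : ∀ᶠ t in nhds (0 : ℝ), z₀ + t • (Complex.I * w) ∈ A := by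
    have h1 := hcont.tendsto 0
    simp only [zero_smul, add_zero] at h1
    exact h1.eventually (mem_interior_iff_mem_nhds.1 hz₀)
  obtain ⟨ε, hε, hb⟩ := Metric.eventually_nhds_iff.1 hev
  by_contra hc
  push Not at hc
  have h1 := hc _ (interior_subset hz₀)
  have h2 := hc _ (hb (y := ε / 2) (by rw [dist_zero_right, Real.norm_eq_abs, abs_of_pos (by linarith)]; linarith))
  have h3 : cdet w (z₀ + (ε / 2) • (Complex.I * w) - a) =
      cdet w (z₀ - a) + ε / 2 * Complex.normSq w := by
    simp [cdet, Complex.normSq_apply]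
    ring
  rw [h3, h1, zero_add] at h2
  have h4 : 0 < Complex.normSq w := Complex.normSq_pos.2 hw
  have : 0 < ε / 2 * Complex.normSq w := by positivity
  linarith

/-- The triangle `a, b, c` contains the parallelogram at `a` spanned by the halved sides. Its area
is a quarter of the determinant and easy to compute as the image of a square. -/
theorem abs_cdet_le_volume_hull {V : Set ℂ} (hV : V.Finite) {a b c : ℂ} (ha : a ∈ V) (hb : b ∈ V)
    (hc : c ∈ V) : |cdet (b - a) (c - a)| ≤ 4 * volume.real (convexHull ℝ V) := by
  have hcomp : IsCompact (convexHull ℝ V) := Set.Finite.isCompact_convexHull (𝕜 := ℝ) hV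
  by_cases hδ : cdet (b - a) (c - a) = 0
  · rw [hδ, abs_zero]
    have : 0 ≤ volume.real (convexHull ℝ V) := measureReal_nonneg
    linarith
  have hmeas : MeasurableSet ((fun z => a + z) ⁻¹' convexHull ℝ V) :=
    (measurable_const_add a) hcomp.isClosed.measurableSet
  have h1 := volume_coord hδ hmeas
  rw [measure_preimage_add] at h1
  have h2 : Set.Icc (0 : ℝ) (1 / 2) ×ˢ Set.Icc (0 : ℝ) (1 / 2) ⊆
      {p : ℝ × ℝ | p.1 • (b - a) + p.2 • (c - a) ∈ (fun z => a + z) ⁻¹' convexHull ℝ V} := by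
    rintro ⟨s, t⟩ ⟨⟨hs0, hs1⟩, ht0, ht1⟩
    have hc' := convex_convexHull ℝ V
    have key : a + (s • (b - a) + t • (c - a)) =
        (1 - s - t) • a + s • b + t • c := by module
    simp only at hs0 hs1 ht0 ht1
    have hsum := hc'.sum_mem (t := Finset.univ) (w := ![1 - s - t, s, t]) (z := ![a, b, c])
      (by intro i _; fin_cases i <;> simp <;> linarith) (by simp [Fin.sum_univ_three]; ring)
      (by intro i _; fin_cases i <;> simp <;> exact subset_convexHull ℝ V (by assumption))
    simp only [Fin.sum_univ_three] at hsum
    change a + (s • (b - a) + t • (c - a)) ∈ convexHull ℝ V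
    rw [key]
    exact hsum
  have h3 := measure_mono (μ := volume) h2
  rw [Measure.volume_eq_prod, Measure.prod_prod, Real.volume_Icc,
    ← ENNReal.ofReal_mul (by norm_num), ← Measure.volume_eq_prod] at h3
  have h4 : ENNReal.ofReal (|cdet (b - a) (c - a)| / 4) ≤ volume (convexHull ℝ V) := by
    rw [h1, div_eq_mul_inv, ENNReal.ofReal_mul (abs_nonneg _)]
    gcongr
    refine le_trans (ENNReal.ofReal_le_ofReal ?_) h3
    norm_num
  have h5 := ENNReal.toReal_mono hcomp.measure_lt_top.ne h4
  rw [ENNReal.toReal_ofReal (by positivity)] at h5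
  change _ ≤ volume.real (convexHull ℝ V) at h5
  linarith

/-- The form whose level sets are ellipses with one axis in the direction `w`. -/
theorem exists_encloses {A : Set ℂ} {D : SetData} {κ : ℝ} (hD : D.Presents κ A)
    (hA : (interior A).Nonempty) {a b c : ℂ} (ha : a ∈ D.vertices) (hb : b ∈ D.vertices)
    (hc : c ∈ D.vertices) {d g : ℝ} (hd : Complex.normSq (b - a) = d)
    (hd' : ∀ x ∈ D.vertices, Complex.normSq (x - a) ≤ d) (hg : cdet (b - a) (c - a) ^ 2 = g)
    (hg' : ∀ x ∈ D.vertices, cdet (b - a) (x - a) ^ 2 ≤ g) :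
    0 < d ∧ 0 < g ∧ ∃ F : Form,
      F.p = √g * ((b - a).re ^ 2 / d ^ 2 + (b - a).im ^ 2 / g) ∧
      F.q = √g * ((b - a).re * (b - a).im / d ^ 2 - (b - a).re * (b - a).im / g) ∧
      F.r = √g * ((b - a).im ^ 2 / d ^ 2 + (b - a).re ^ 2 / g) ∧
      Encloses F a (√g) κ A := by
  set w := b - a with hw
  have hnd : ∀ z ∈ A, Complex.normSq (z - a) ≤ d := fun z hz =>
    normSq_sub_le_of_mem_hull (hd ▸ Complex.normSq_nonneg _) hd' (hD.subset_polygon hz)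
  have hng : ∀ z ∈ A, |cdet w (z - a)| ≤ √g := fun z hz =>
    abs_cdet_sub_le_of_mem_hull (fun x hx => Real.abs_le_sqrt (hg' x hx)) (hD.subset_polygon hz)
  have hw0 : w ≠ 0 := by
    intro h0
    obtain ⟨z, hz, hne⟩ := exists_cdet_ne_zero hA (one_ne_zero (α := ℂ)) a
    have h1 := hnd z hz
    rw [← hd, h0, map_zero] at h1
    have h2 : z - a = 0 := Complex.normSq_eq_zero.1 (le_antisymm h1 (Complex.normSq_nonneg _))
    rw [h2] at hne
    simp [cdet] at hne
  have hdpos : 0 < d := hd ▸ Complex.normSq_pos.2 hw0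
  have hgpos : 0 < g := by
    obtain ⟨z, hz, hne⟩ := exists_cdet_ne_zero hA hw0 a
    exact Real.sqrt_pos.1 ((abs_pos.2 hne).trans_le (hng z hz))
  refine ⟨hdpos, hgpos, ?_⟩
  have hσ : 0 < √g := Real.sqrt_pos.2 hgpos
  have hσ2 : √g * √g = g := Real.mul_self_sqrt hgpos.le
  rw [Complex.normSq_apply] at hd
  have hp : 0 < √g * (w.re ^ 2 / d ^ 2 + w.im ^ 2 / g) := by
    refine mul_pos hσ ?_
    by_cases hre : w.re = 0
    · have : w.im ≠ 0 := fun him => hw0 (Complex.ext hre him)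
      positivity
    · positivity
  -- As `b` is farthest from `a`, the inner product of `w` with `z - a` is at most `d` in absolute
  -- value on the polygon, and by the choice of `c` the determinant is at most `√g`. This form is
  -- the sum of the squares of the two normalized coordinates, times the factor `√g` that makes its
  -- determinant one; so it is at most `2 √g` there.
  let F : Form := ⟨√g * (w.re ^ 2 / d ^ 2 + w.im ^ 2 / g),
    √g * (w.re * w.im / d ^ 2 - w.re * w.im / g), √g * (w.im ^ 2 / d ^ 2 + w.re ^ 2 / g), hp, by
      have e : √g * (w.re ^ 2 / d ^ 2 + w.im ^ 2 / g) * (√g * (w.im ^ 2 / d ^ 2 + w.re ^ 2 / g)) -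
          (√g * (w.re * w.im / d ^ 2 - w.re * w.im / g)) ^ 2 =
          (√g * √g) * (w.re * w.re + w.im * w.im) ^ 2 / (d ^ 2 * g) := by
        field_simp
        ring
      rw [e, hσ2, hd]
      field_simp⟩
  refine ⟨F, rfl, rfl, rfl, hσ, fun z hz => ?_, ?_⟩
  · have h1 := hnd z hz
    have h2 : cdet w (z - a) ^ 2 ≤ g := by
      have := Real.abs_le_sqrt (hg' b hb)
      rw [← sq_abs, ← Real.sq_sqrt hgpos.le]
      exact pow_le_pow_left₀ (abs_nonneg _) (hng z hz) 2
    generalize z - a = y at *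
    rw [Complex.normSq_apply] at h1
    have e : F.val y = √g * ((w.re * y.re + w.im * y.im) ^ 2 / d ^ 2 + cdet w y ^ 2 / g) := by
      simp only [F, Form.val, cdet]
      ring
    have h3 : (w.re * y.re + w.im * y.im) ^ 2 ≤ d ^ 2 := by
      have h4 : (w.re * y.re + w.im * y.im) ^ 2 ≤
          (w.re * w.re + w.im * w.im) * (y.re * y.re + y.im * y.im) := by
        nlinarith [sq_nonneg (w.re * y.im - w.im * y.re)]
      rw [hd] at h4
      nlinarith
    have h5 : (w.re * y.re + w.im * y.im) ^ 2 / d ^ 2 ≤ 1 := div_le_one_of_le₀ h3 (by positivity)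
    have h6 : cdet w y ^ 2 / g ≤ 1 := div_le_one_of_le₀ h2 hgpos.le
    rw [e]
    nlinarith
  -- The level `√g` is twice the area of the triangle `a, b, c`, hence comparable to the area of the
  -- polygon and, through `κ`, of `A`.
  · have h1 := abs_cdet_le_volume_hull (V := {x | x ∈ D.vertices}) (List.finite_toSet _) ha hb hc
    have h2 := hD.area_polygon_le
    rw [← hg, Real.sqrt_sq_eq_abs]
    linarith

/-- Run the program `P` for all listed vertices of a set, with the coordinates of the vertex
relative to the point in `o + 4` and `o + 5` in the variables 14 and 15. -/
def scan (s : Fin 2) (o : ℕ) (P : Prog) : Prog := seqs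
  [asgs [(13, 0)], loop 13 12 (seqs [askVertex s 13 14 15,
    asgs [(14, v 14 - v (o + 4)), (15, v 15 - v (o + 5))], P, asgs [(13, v 13 + 1)]])]

variable {O : Fin 2 → SetData} {ρ : ℕ → ℝ} {out : List ZOmega}

/-- By `hI` the invariant depends only on variables from `16` on, so it is not disturbed by the
counter in `13` and the loaded vertex in `14` and `15`. -/
theorem runs_scan {s : Fin 2} {o : ℕ} (ho : o ≤ 6) {P : Prog} (hP : LoopFree P) {a : ℂ}
    (h12 : ρ 12 = (O s).vertices.length) (hre : ρ (o + 4) = a.re) (him : ρ (o + 5) = a.im)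
    (I : ℕ → (ℕ → ℝ) → Prop)
    (hI : ∀ k ρ₁ ρ₂, (∀ i, 16 ≤ i → ρ₁ i = ρ₂ i) → I k ρ₁ → I k ρ₂) (h0 : I 0 ρ)
    (hstep : ∀ k (hk : k < (O s).vertices.length), ∀ ρ' : ℕ → ℝ, I k ρ' →
      ρ' 14 = ((O s).vertices[k] - a).re → ρ' 15 = ((O s).vertices[k] - a).im →
      Runs O P ρ' out fun ρ'' out'' _ =>
        (∀ i < 14, ρ'' i = ρ' i) ∧ out'' = out ∧ I (k + 1) ρ'') :
    Runs O (scan s o P) ρ out fun ρ' out' n => (∀ i < 13, ρ' i = ρ i) ∧ out' = out ∧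
      I (O s).vertices.length ρ' ∧ n ≤ (size P + 40) * ((O s).vertices.length + 1) := by
  refine runs_seqs_cons (runs_asgs_size (by simp) fun n₁ hn₁ => ?_)
  have hs1 : size (asgs [(13, 0)]) = 4 := rfl
  refine runs_seqs_cons ((runs_loop (fun ρ' out' t => ∃ k : ℕ, ρ' 13 = k ∧
    (∀ i < 13, ρ' i = ρ i) ∧ out' = out ∧ k ≤ (O s).vertices.length ∧ I k ρ' ∧
    t ≤ (size P + 40) * k) (fun ρ' => ⌈ρ' 12 - ρ' 13⌉₊) ?_ ?_).mono ?_)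
  · refine ⟨0, by simp, fun i hi => ?_, rfl, by simp, hI 0 ρ _ (fun i hi => ?_) h0, by simp⟩
    · simp [Function.update_of_ne (show i ≠ 13 by omega)]
    · simp [Function.update_of_ne (show i ≠ 13 by omega)]
  · rintro ρ₁ _ t ⟨k, k1, k2, rfl, k4, k5, k6⟩ hlt
    have e12 : ρ₁ 12 = (O s).vertices.length := by rw [k2 12 (by omega), h12]
    have hk : k < (O s).vertices.length := by
      rw [k1, e12] at hlt
      exact_mod_cast hlt
    refine runs_seqs_cons (runs_askVertex k1 hk ?_)
    refine runs_seqs_cons (runs_asgs_size (by simp) fun n₂ hn₂ => ?_)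
    set ρ₂ := assignAll [(14, v 14 - v (o + 4)), (15, v 15 - v (o + 5))]
      (Function.update (Function.update ρ₁ 14 (O s).vertices[k].re) 15 (O s).vertices[k].im)
      with hρ₂
    have hn₂' : n₂ ≤ 17 := hn₂.trans (Nat.le_of_ble_eq_true rfl)
    have l1 : ∀ i, i ≠ 14 → i ≠ 15 → ρ₂ i = ρ₁ i := by
      intro i h1 h2
      simp [hρ₂, Function.update_of_ne h1, Function.update_of_ne h2]
    have e4 : ρ₁ (o + 4) = a.re := by rw [k2 _ (by omega), hre]
    have e5 : ρ₁ (o + 5) = a.im := by rw [k2 _ (by omega), him]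
    have l14 : ρ₂ 14 = ((O s).vertices[k] - a).re := by
      simp [hρ₂, Function.update_of_ne (show o + 4 ≠ 14 by omega),
        Function.update_of_ne (show o + 4 ≠ 15 by omega), e4]
    have l15 : ρ₂ 15 = ((O s).vertices[k] - a).im := by
      simp [hρ₂, Function.update_of_ne (show o + 5 ≠ 14 by omega),
        Function.update_of_ne (show o + 5 ≠ 15 by omega), e5]
    refine runs_seqs_cons (((hstep k hk ρ₂ (hI k ρ₁ ρ₂ (fun i hi => ?_) k5) l14 l15).and_size
      hP).mono ?_)
    · exact (l1 i (by omega) (by omega)).symm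
    rintro ρ₃ _ n₃ ⟨⟨m1, rfl, m3⟩, hn₃⟩
    refine runs_seqs_cons (runs_asgs_size (by simp) fun n₄ hn₄ => runs_seqs_nil ?_)
    have hn₄' : n₄ ≤ 7 := hn₄.trans (Nat.le_of_ble_eq_true rfl)
    have f13 : ρ₃ 13 = k := by rw [m1 13 (by omega), l1 13 (by omega) (by omega), k1]
    have f12 : ρ₃ 12 = (O s).vertices.length := by
      rw [m1 12 (by omega), l1 12 (by omega) (by omega), e12]
    refine ⟨⟨k + 1, by simp [f13], fun i hi => ?_, rfl, hk, hI _ ρ₃ _ (fun i hi => ?_) m3, ?_⟩, ?_⟩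
    · simp [Function.update_of_ne (show i ≠ 13 by omega)]
      rw [m1 i (by omega), l1 i (by omega) (by omega), k2 i hi]
    · simp [Function.update_of_ne (show i ≠ 13 by omega)]
    · rw [mul_add, mul_one]
      omega
    · have u13 : assignAll [(13, v 13 + 1)] ρ₃ 13 = k + 1 := by simp [f13]
      have u12 : assignAll [(13, v 13 + 1)] ρ₃ 12 = (O s).vertices.length := by simp [f12]
      rw [u13, u12, k1, e12, Nat.lt_ceil]
      have hk' : ((k + 1 : ℕ) : ℝ) ≤ (O s).vertices.length := by exact_mod_cast hk
      push_cast at hk'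
      have := Nat.ceil_lt_add_one (sub_nonneg.2 hk')
      linarith
  · rintro ρ₁ _ n ⟨t, rfl, ⟨k, k1, k2, rfl, k4, k5, k6⟩, hlt⟩
    have hk : k = (O s).vertices.length := by
      rw [k1, k2 12 (by omega), h12, Nat.cast_lt] at hlt
      omega
    subst hk
    refine runs_seqs_nil ⟨k2, rfl, k5, ?_⟩
    rw [mul_add, mul_one]
    omega

/-- Search for the vertex with the greatest distance from the first one. -/
def farthest (s : Fin 2) (o : ℕ) : Prog := scan s o (seqs
  [asgs [(20, v 14 * v 14 + v 15 * v 15)],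
    cond (v 18) (v 20) (asgs [(16, v 14), (17, v 15), (18, v 20)]) skip])

/-- Search for the greatest distance of a vertex from the line through the two found before. -/
def highest (s : Fin 2) (o : ℕ) : Prog := scan s o (seqs
  [asgs [(20, (v 16 * v 15 - v 17 * v 14) * (v 16 * v 15 - v 17 * v 14))],
    cond (v 19) (v 20) (asgs [(19, v 20)]) skip])

/-- Computation of an ellipse around the enclosing polygon. -/
def ellipse (s : Fin 2) (o : ℕ) : Prog := seqs
  [askSize s 12, asgs [(13, 0)], askVertex s 13 (o + 4) (o + 5),
    asgs [(16, 0), (17, 0), (18, 0)], farthest s o, asgs [(19, 0)], highest s o,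
    asgs [(o + 3, v 19 ^ (1 / 2 : Arith)),
      (o, v (o + 3) * (v 16 * v 16 / (v 18 * v 18) + v 17 * v 17 / v 19)),
      (o + 1, v (o + 3) * (v 16 * v 17 / (v 18 * v 18) - v 16 * v 17 / v 19)),
      (o + 2, v (o + 3) * (v 17 * v 17 / (v 18 * v 18) + v 16 * v 16 / v 19))]]

theorem runs_farthest {s : Fin 2} {o : ℕ} (ho : o ≤ 6) {a : ℂ} (ha : a ∈ (O s).vertices)
    (h12 : ρ 12 = (O s).vertices.length) (hre : ρ (o + 4) = a.re) (him : ρ (o + 5) = a.im)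
    (h16 : ρ 16 = 0) (h17 : ρ 17 = 0) (h18 : ρ 18 = 0) :
    Runs O (farthest s o) ρ out fun ρ' out' n => (∀ i < 13, ρ' i = ρ i) ∧ out' = out ∧
      (∃ b ∈ (O s).vertices, ρ' 16 = (b - a).re ∧ ρ' 17 = (b - a).im ∧
        ρ' 18 = Complex.normSq (b - a) ∧
        ∀ x ∈ (O s).vertices, Complex.normSq (x - a) ≤ Complex.normSq (b - a)) ∧
      n ≤ 100 * ((O s).vertices.length + 1) := by
  refine (runs_scan ho (a := a) ?_ h12 hre him (fun k ρ' => ∃ b ∈ (O s).vertices,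
    ρ' 16 = (b - a).re ∧ ρ' 17 = (b - a).im ∧ ρ' 18 = Complex.normSq (b - a) ∧
    ∀ j (hj : j < (O s).vertices.length), j < k →
      Complex.normSq ((O s).vertices[j] - a) ≤ Complex.normSq (b - a)) ?_ ?_ ?_).mono ?_
  · refine ⟨loopFree_asgs _, loopFree_cond (loopFree_asgs _) trivial, trivial⟩
  · rintro k ρ₁ ρ₂ h ⟨b, hb, h1, h2, h3, h4⟩
    exact ⟨b, hb, by rw [← h1, h 16 le_rfl], by rw [← h2, h 17 (by norm_num)],
      by rw [← h3, h 18 (by norm_num)], h4⟩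
  -- The zero initial values describe `a` itself as the first candidate.
  · exact ⟨a, ha, by simp [h16], by simp [h17], by simp [h18], fun _ _ h => by omega⟩
  · rintro k hk ρ' ⟨b, hb, h1, h2, h3, h4⟩ e14 e15
    have e20 : ρ' 14 * ρ' 14 + ρ' 15 * ρ' 15 = Complex.normSq ((O s).vertices[k] - a) := by
      rw [e14, e15, Complex.normSq_apply]
    refine runs_seqs_cons (runs_asgs (by simp) fun n => runs_seqs_cons (runs_cond (by simp)
      (by simp) (fun hlt => runs_asgs (by simp) fun m m' => runs_seqs_nil ?_)
      (fun hlt => runs_skip fun m' => runs_seqs_nil ?_)))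
    · simp [e20, h3] at hlt
      refine ⟨fun i hi => ?_, rfl, (O s).vertices[k], List.getElem_mem _, ?_, ?_, ?_, ?_⟩
      · rw [assignAll_of_notMem, assignAll_of_notMem]
        · simp
          omega
        · simp
          omega
      · simp [e14]
      · simp [e15]
      · simp [e20]
      · intro j hj hjk
        rcases Nat.lt_succ_iff_lt_or_eq.1 hjk with h | rfl
        · exact (h4 j hj h).trans hlt.le
        · exact le_rfl
    · simp [e20, h3] at hlt
      refine ⟨fun i hi => ?_, rfl, b, hb, ?_, ?_, ?_, ?_⟩
      · rw [assignAll_of_notMem]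
        simp
        omega
      · simp [h1]
      · simp [h2]
      · simp [h3]
      · intro j hj hjk
        rcases Nat.lt_succ_iff_lt_or_eq.1 hjk with h | rfl
        · exact h4 j hj h
        · exact hlt
  · rintro ρ' out' n ⟨h1, h2, ⟨b, hb, h3, h4, h5, h6⟩, h7⟩
    refine ⟨h1, h2, ⟨b, hb, h3, h4, h5, fun x hx => ?_⟩, h7.trans (Nat.mul_le_mul_right _ (Nat.le_of_ble_eq_true rfl))⟩
    obtain ⟨j, hj, rfl⟩ := List.getElem_of_mem hx
    exact h6 j hj hj

theorem runs_highest {s : Fin 2} {o : ℕ} (ho : o ≤ 6) {a w : ℂ} {d : ℝ}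
    (ha : a ∈ (O s).vertices)
    (h12 : ρ 12 = (O s).vertices.length) (hre : ρ (o + 4) = a.re) (him : ρ (o + 5) = a.im)
    (h16 : ρ 16 = w.re) (h17 : ρ 17 = w.im) (h18 : ρ 18 = d) (h19 : ρ 19 = 0) :
    Runs O (highest s o) ρ out fun ρ' out' n => (∀ i < 13, ρ' i = ρ i) ∧ out' = out ∧
      (ρ' 16 = w.re ∧ ρ' 17 = w.im ∧ ρ' 18 = d ∧ ∃ b ∈ (O s).vertices,
        ρ' 19 = cdet w (b - a) ^ 2 ∧
        ∀ x ∈ (O s).vertices, cdet w (x - a) ^ 2 ≤ cdet w (b - a) ^ 2) ∧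
      n ≤ 100 * ((O s).vertices.length + 1) := by
  refine (runs_scan ho (a := a) ?_ h12 hre him (fun k ρ' =>
    ρ' 16 = w.re ∧ ρ' 17 = w.im ∧ ρ' 18 = d ∧ ∃ b ∈ (O s).vertices,
    ρ' 19 = cdet w (b - a) ^ 2 ∧
    ∀ j (hj : j < (O s).vertices.length), j < k →
      cdet w ((O s).vertices[j] - a) ^ 2 ≤ cdet w (b - a) ^ 2) ?_ ?_ ?_).mono ?_
  · refine ⟨loopFree_asgs _, loopFree_cond (loopFree_asgs _) trivial, trivial⟩
  · rintro k ρ₁ ρ₂ h ⟨h1, h2, h3, b, hb, h4, h5⟩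
    exact ⟨by rw [← h1, h 16 le_rfl], by rw [← h2, h 17 (by norm_num)],
      by rw [← h3, h 18 (by norm_num)], b, hb, by rw [← h4, h 19 (by norm_num)], h5⟩
  · exact ⟨h16, h17, h18, a, ha, by simp [h19, cdet], fun _ _ h => by omega⟩
  · rintro k hk ρ' ⟨h1, h2, h3, b, hb, h4, h5⟩ e14 e15
    have e20 : (ρ' 16 * ρ' 15 - ρ' 17 * ρ' 14) * (ρ' 16 * ρ' 15 - ρ' 17 * ρ' 14) =
        cdet w ((O s).vertices[k] - a) ^ 2 := by
      rw [h1, h2, e14, e15, cdet]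
      ring
    refine runs_seqs_cons (runs_asgs (by simp) fun n => runs_seqs_cons (runs_cond (by simp)
      (by simp) (fun hlt => runs_asgs (by simp) fun m m' => runs_seqs_nil ?_)
      (fun hlt => runs_skip fun m' => runs_seqs_nil ?_)))
    · simp only [assignAll_cons, assignAll_nil, eval_v, eval_sub, eval_mul, e20] at hlt ⊢
      simp [h4] at hlt
      refine ⟨fun i hi => ?_, trivial, by simp [h1], by simp [h2], by simp [h3],
        (O s).vertices[k], List.getElem_mem _, by simp, ?_⟩
      · rw [Function.update_of_ne (by omega), Function.update_of_ne (by omega)]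
      · intro j hj hjk
        rcases Nat.lt_succ_iff_lt_or_eq.1 hjk with h | rfl
        · exact (h5 j hj h).trans hlt.le
        · exact le_rfl
    · simp only [assignAll_cons, assignAll_nil, eval_v, eval_sub, eval_mul, e20] at hlt ⊢
      simp [h4] at hlt
      refine ⟨fun i hi => ?_, trivial, by simp [h1], by simp [h2], by simp [h3], b, hb,
        by simp [h4], ?_⟩
      · rw [Function.update_of_ne (by omega)]
      · intro j hj hjk
        rcases Nat.lt_succ_iff_lt_or_eq.1 hjk with h | rfl
        · exact h5 j hj h
        · exact hlt
  · rintro ρ' out' n ⟨h1, h2, ⟨h3, h4, h5, b, hb, h6, h7⟩, h8⟩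
    refine ⟨h1, h2, ⟨h3, h4, h5, b, hb, h6, fun x hx => ?_⟩, h8.trans (Nat.mul_le_mul_right _ (Nat.le_of_ble_eq_true rfl))⟩
    obtain ⟨j, hj, rfl⟩ := List.getElem_of_mem hx
    exact h7 j hj hj

theorem runs_ellipse {s : Fin 2} {o : ℕ} (ho : o ≤ 6) {A : Set ℂ} {κ : ℝ}
    (hD : (O s).Presents κ A) (hA : (interior A).Nonempty) :
    Runs O (ellipse s o) ρ out fun ρ' out' n => (∀ i < o, ρ' i = ρ i) ∧ out' = out ∧
      (∃ F : Form, ρ' o = F.p ∧ ρ' (o + 1) = F.q ∧ ρ' (o + 2) = F.r ∧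
        Encloses F ⟨ρ' (o + 4), ρ' (o + 5)⟩ (ρ' (o + 3)) κ A) ∧
      n ≤ 600 * ((O s).vertices.length + 1) := by
  have hlen : 0 < (O s).vertices.length := by
    rw [List.length_pos_iff]
    intro h0
    obtain ⟨z, hz⟩ := hA
    have := hD.subset_polygon (interior_subset hz)
    simp [h0] at this
  set a := (O s).vertices[0] with ha
  have hamem : a ∈ (O s).vertices := List.getElem_mem _
  refine runs_seqs_cons (runs_askSize (runs_seqs_cons (runs_asgs_size (by simp) fun n₁ hn₁ =>
    runs_seqs_cons (runs_askVertex (k := 0) (by simp) hlen (runs_seqs_cons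
      (runs_asgs_size (by simp) fun n₂ hn₂ => ?_))))))
  have hn₁' : n₁ ≤ 4 := hn₁.trans (Nat.le_of_ble_eq_true rfl)
  have hn₂' : n₂ ≤ 10 := hn₂.trans (Nat.le_of_ble_eq_true rfl)
  set ρ₁ := assignAll [(16, 0), (17, 0), (18, 0)] (Function.update (Function.update
    (assignAll [(13, 0)] (Function.update ρ 12 (O s).vertices.length)) (o + 4)
    (O s).vertices[0].re) (o + 5) (O s).vertices[0].im) with hρ₁
  have hfr : ∀ i < o, ρ₁ i = ρ i := by
    intro i hi
    rw [hρ₁, assignAll_of_notMem (by simp; omega), Function.update_of_ne (by omega),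
      Function.update_of_ne (by omega), assignAll_of_notMem (by simp; omega),
      Function.update_of_ne (by omega)]
  have n4 : 12 ≠ o + 4 := by omega
  have n5 : 12 ≠ o + 5 := by omega
  have h12 : ρ₁ 12 = (O s).vertices.length := by
    simp [hρ₁, Function.update_of_ne n4, Function.update_of_ne n5]
  have h4 : ρ₁ (o + 4) = a.re := by
    rw [hρ₁, assignAll_of_notMem (by simp; omega), Function.update_of_ne (by omega),
      Function.update_self]
  have h5 : ρ₁ (o + 5) = a.im := by
    rw [hρ₁, assignAll_of_notMem (by simp; omega), Function.update_self]
  refine runs_seqs_cons ((runs_farthest ho hamem h12 h4 h5 (by simp [hρ₁]) (by simp [hρ₁])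
    (by simp [hρ₁])).mono ?_)
  rintro ρ₂ _ n₃ ⟨f1, rfl, ⟨b, hb, f3, f4, f5, f6⟩, f7⟩
  refine runs_seqs_cons (runs_asgs_size (by simp) fun n₄ hn₄ => ?_)
  have hn₄' : n₄ ≤ 4 := hn₄.trans (Nat.le_of_ble_eq_true rfl)
  simp only [assignAll_cons, assignAll_nil, eval_zero]
  refine runs_seqs_cons ((runs_highest ho hamem (w := b - a) (d := Complex.normSq (b - a))
    ?_ ?_ ?_ ?_ ?_ ?_ ?_).mono ?_)
  · simp [f1, h12]
  · rw [Function.update_of_ne (by omega), f1 _ (by omega), h4]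
  · rw [Function.update_of_ne (by omega), f1 _ (by omega), h5]
  · simp [f3]
  · simp [f4]
  · simp [f5]
  · simp
  rintro ρ₃ _ n₅ ⟨g1, rfl, ⟨g3, g4, g5, c, hc, g6, g7⟩, g8⟩
  obtain ⟨hd, hg, F, hFp, hFq, hFr, hF⟩ := exists_encloses hD hA hamem hb hc rfl f6 rfl g7
  set d := Complex.normSq (b - a)
  set g := cdet (b - a) (c - a) ^ 2
  set w := b - a
  have k4 : ρ₃ (o + 4) = a.re := by
    rw [g1 _ (by omega), Function.update_of_ne (by omega), f1 _ (by omega), h4]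
  have k5 : ρ₃ (o + 5) = a.im := by
    rw [g1 _ (by omega), Function.update_of_ne (by omega), f1 _ (by omega), h5]
  have q : ∀ k ≤ 3, ∀ j, 16 ≤ j → j ≠ o + k := fun k hk j hj => by omega
  have q0 : ∀ j, 16 ≤ j → j ≠ o := fun j hj => by omega
  refine runs_seqs_cons (runs_asgs_size ?_ fun n₆ hn₆ => runs_seqs_nil ?_)
  · simp [Function.update_of_ne (q 3 (by norm_num) 16 (by norm_num)),
      Function.update_of_ne (q 3 (by norm_num) 18 (by norm_num)),
      Function.update_of_ne (q 3 (by norm_num) 19 (by norm_num)),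
      Function.update_of_ne (q 1 (by norm_num) 18 (by norm_num)),
      Function.update_of_ne (q 1 (by norm_num) 19 (by norm_num)),
      Function.update_of_ne (q0 18 (by norm_num)),
      Function.update_of_ne (q0 19 (by norm_num)), g5, g6, hd.ne', hg.ne', hg]
  have hn₆' : n₆ ≤ 117 := hn₆.trans (Nat.le_of_ble_eq_true rfl)
  have hσ : g ^ (2⁻¹ : ℝ) = √g := by rw [Real.sqrt_eq_rpow, one_div]
  refine ⟨fun i hi => ?_, rfl, ⟨F, ?_, ?_, ?_, ?_⟩, ?_⟩
  · rw [assignAll_of_notMem (by simp; omega), g1 _ (by omega), Function.update_of_ne (by omega),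
      f1 _ (by omega), hfr i hi]
  · rw [hFp]
    simp [Function.update_of_ne (q 3 (by norm_num) 16 (by norm_num)),
      Function.update_of_ne (q 3 (by norm_num) 17 (by norm_num)),
      Function.update_of_ne (q 3 (by norm_num) 18 (by norm_num)),
      Function.update_of_ne (q 3 (by norm_num) 19 (by norm_num)), g3, g4, g5, g6, hσ]
    ring_nf
    simp
  · rw [hFq]
    simp [Function.update_of_ne (q 3 (by norm_num) 16 (by norm_num)),
      Function.update_of_ne (q 3 (by norm_num) 17 (by norm_num)),
      Function.update_of_ne (q 3 (by norm_num) 18 (by norm_num)),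
      Function.update_of_ne (q 3 (by norm_num) 19 (by norm_num)),
      Function.update_of_ne (q0 16 (by norm_num)),
      Function.update_of_ne (q0 17 (by norm_num)),
      Function.update_of_ne (q0 18 (by norm_num)),
      Function.update_of_ne (q0 19 (by norm_num)), g3, g4, g5, g6, hσ]
    ring_nf
    simp
  · rw [hFr]
    simp [Function.update_of_ne (q 3 (by norm_num) 16 (by norm_num)),
      Function.update_of_ne (q 3 (by norm_num) 17 (by norm_num)),
      Function.update_of_ne (q 3 (by norm_num) 18 (by norm_num)),
      Function.update_of_ne (q 3 (by norm_num) 19 (by norm_num)),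
      Function.update_of_ne (q0 16 (by norm_num)),
      Function.update_of_ne (q0 17 (by norm_num)),
      Function.update_of_ne (q0 18 (by norm_num)),
      Function.update_of_ne (q0 19 (by norm_num)),
      Function.update_of_ne (q 1 (by norm_num) 16 (by norm_num)),
      Function.update_of_ne (q 1 (by norm_num) 17 (by norm_num)),
      Function.update_of_ne (q 1 (by norm_num) 18 (by norm_num)),
      Function.update_of_ne (q 1 (by norm_num) 19 (by norm_num)), g3, g4, g5, g6, hσ]
    ring_nf
    simp
  · have e4 : assignAll [(o + 3, v 19 ^ (1 / 2 : Arith)),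
      (o, v (o + 3) * (v 16 * v 16 / (v 18 * v 18) + v 17 * v 17 / v 19)),
      (o + 1, v (o + 3) * (v 16 * v 17 / (v 18 * v 18) - v 16 * v 17 / v 19)),
      (o + 2, v (o + 3) * (v 17 * v 17 / (v 18 * v 18) + v 16 * v 16 / v 19))] ρ₃ (o + 4) = a.re := by
      rw [assignAll_of_notMem (by simp), k4]
    have e5 : assignAll [(o + 3, v 19 ^ (1 / 2 : Arith)),
      (o, v (o + 3) * (v 16 * v 16 / (v 18 * v 18) + v 17 * v 17 / v 19)),
      (o + 1, v (o + 3) * (v 16 * v 17 / (v 18 * v 18) - v 16 * v 17 / v 19)),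
      (o + 2, v (o + 3) * (v 17 * v 17 / (v 18 * v 18) + v 16 * v 16 / v 19))] ρ₃ (o + 5) = a.im := by
      rw [assignAll_of_notMem (by simp), k5]
    have e3 : assignAll [(o + 3, v 19 ^ (1 / 2 : Arith)),
      (o, v (o + 3) * (v 16 * v 16 / (v 18 * v 18) + v 17 * v 17 / v 19)),
      (o + 1, v (o + 3) * (v 16 * v 17 / (v 18 * v 18) - v 16 * v 17 / v 19)),
      (o + 2, v (o + 3) * (v 17 * v 17 / (v 18 * v 18) + v 16 * v 16 / v 19))] ρ₃ (o + 3) = √g := by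
      simp [g6, hσ]
    rw [e3, e4, e5]
    exact hF
  · omega

end Grid

/-! ## Reduction of the basis by a program -/

namespace Grid

open Real Arith

/-- Three registers hold the coefficients of a form. -/
def HoldsForm (ρ : ℕ → ℝ) (o : ℕ) (F : Form) : Prop :=
  ρ o = F.p ∧ ρ (o + 1) = F.q ∧ ρ (o + 2) = F.r

/-- Four registers hold the coordinates of a pair of points. -/
def HoldsPair (ρ : ℕ → ℝ) (z : ℕ) (w : ℂ × ℂ) : Prop :=
  ρ z = w.1.re ∧ ρ (z + 1) = w.1.im ∧ ρ (z + 2) = w.2.re ∧ ρ (z + 3) = w.2.im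

theorem HoldsForm.congr {ρ ρ' : ℕ → ℝ} {o : ℕ} {F : Form} (h : HoldsForm ρ o F)
    (h' : ∀ i < o + 3, ρ' i = ρ i) : HoldsForm ρ' o F :=
  ⟨by rw [h' _ (by omega), h.1], by rw [h' _ (by omega), h.2.1], by rw [h' _ (by omega), h.2.2]⟩

theorem HoldsPair.congr {ρ ρ' : ℕ → ℝ} {z : ℕ} {w : ℂ × ℂ} (h : HoldsPair ρ z w)
    (h' : ∀ i < z + 4, ρ' i = ρ i) : HoldsPair ρ' z w :=
  ⟨by rw [h' _ (by omega), h.1], by rw [h' _ (by omega), h.2.1],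
    by rw [h' _ (by omega), h.2.2.1], by rw [h' _ (by omega), h.2.2.2]⟩

/-- The value of a form. -/
def valTerm (o z : ℕ) : Arith :=
  v o * (v z * v z) + 2 * v (o + 1) * v z * v (z + 1) + v (o + 2) * (v (z + 1) * v (z + 1))

/-- The value of a bilinear form. -/
def bilTerm (o z w : ℕ) : Arith :=
  v o * v z * v w + v (o + 1) * (v z * v (w + 1) + v (z + 1) * v w) +
    v (o + 2) * v (z + 1) * v (w + 1)

/-- Replace the second basis vector by its reduction. -/
def reduceStep : Prog := seqs [
  asgs [(22, valTerm 0 12), (23, valTerm 6 14)],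
  asgs [(24, bilTerm 0 12 16 / v 22), (25, bilTerm 6 14 18 / v 23),
    (26, scaleTerm (v 23 / v 22)),
    (27, floor ((v 24 / v 26 + v 25 * v 26) / 2 + 1 / 2)),
    (28, floor ((v 24 / v 26 - v 25 * v 26) / (2 * sqrtTwo) + 1 / 2)),
    (29, v 26 * (v 27 + v 28 * sqrtTwo)), (30, (v 27 - v 28 * sqrtTwo) / v 26)],
  asgs [(16, v 16 - v 29 * v 12), (17, v 17 - v 29 * v 13), (18, v 18 - v 30 * v 14),
    (19, v 19 - v 30 * v 15)],
  asgs [(20, v 22 * v 23), (21, 2 * (valTerm 0 16 * valTerm 6 18))]]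

/-- Exchange the basis vectors, up to a sign. -/
def exchange : Prog := asgs [(22, v 12), (23, v 13), (24, v 14), (25, v 15), (12, v 16),
  (13, v 17), (14, v 18), (15, v 19), (16, 0 - v 22), (17, 0 - v 23), (18, 0 - v 24),
  (19, 0 - v 25)]

/-- The first basis. -/
def startBasis : Prog := cond (v 2 * v 8) (v 0 * v 6)
  (asgs [(12, 0), (13, 1), (14, 0), (15, 1), (16, 0 - sqrtTwo / 2), (17, 0 - sqrtTwo / 2),
    (18, sqrtTwo / 2), (19, sqrtTwo / 2)])
  (asgs [(12, 1), (13, 0), (14, 1), (15, 0), (16, sqrtTwo / 2), (17, sqrtTwo / 2),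
    (18, 0 - sqrtTwo / 2), (19, 0 - sqrtTwo / 2)])

/-- Compute a basis with a short first vector. -/
def reduction : Prog := seqs
  [startBasis, reduceStep, loop 21 20 (seqs [exchange, reduceStep])]

/-- Bound for the number of steps per iteration. -/
def reductionCost : ℕ := size startBasis + size reduceStep + size exchange + 10

variable {O : Fin 2 → SetData} {ρ : ℕ → ℝ} {out : List ZOmega} {F G : Form} {e f : ℂ × ℂ}

theorem eval_valTerm {o z : ℕ} {w : ℂ} (hF : HoldsForm ρ o F) (h : ρ z = w.re)
    (h' : ρ (z + 1) = w.im) : (valTerm o z).eval ρ = F.val w := by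
  simp [valTerm, hF.1, hF.2.1, hF.2.2, h, h', Form.val]
  ring

theorem eval_bilTerm {o y z : ℕ} {w x : ℂ} (hF : HoldsForm ρ o F) (h : ρ y = w.re)
    (h' : ρ (y + 1) = w.im) (k : ρ z = x.re) (k' : ρ (z + 1) = x.im) :
    (bilTerm o y z).eval ρ = F.bil w x := by
  simp [bilTerm, hF.1, hF.2.1, hF.2.2, h, h', k, k', Form.bil]

theorem ok_valTerm (o z : ℕ) : (valTerm o z).Ok ρ := by simp [valTerm]

theorem ok_bilTerm (o y z : ℕ) : (bilTerm o y z).Ok ρ := by simp [bilTerm]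

theorem loopFree_reduceStep : LoopFree reduceStep :=
  ⟨loopFree_asgs _, loopFree_asgs _, loopFree_asgs _, loopFree_asgs _, trivial⟩

theorem runs_reduceStep (hF : HoldsForm ρ 0 F) (hG : HoldsForm ρ 6 G) (h : IsBasis e f)
    (he : HoldsPair ρ 12 e) (hf : HoldsPair ρ 16 f) :
    Runs O reduceStep ρ out fun ρ' out' n => ((∀ i < 12, ρ' i = ρ i) ∧ out' = out ∧
      HoldsPair ρ' 12 e ∧ HoldsPair ρ' 16 (reduceBy F G e f) ∧ ρ' 20 = nrm F G e ∧
      ρ' 21 = 2 * nrm F G (reduceBy F G e f)) ∧ n ≤ size reduceStep := by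
  refine Runs.and_size ?_ loopFree_reduceStep
  have ha := h.val_fst_pos F
  have hb := h.val_snd_pos G
  obtain ⟨he1, he2, he3, he4⟩ := id he
  obtain ⟨hf1, hf2, hf3, hf4⟩ := id hf
  have t1 : (valTerm 0 12).eval ρ = F.val e.1 := eval_valTerm hF he1 he2
  have hG' : ∀ x : ℝ, HoldsForm (Function.update ρ 22 x) 6 G := fun x => hG.congr fun i hi =>
    Function.update_of_ne (by omega) _ _
  have t2 : ∀ x : ℝ, (valTerm 6 14).eval (Function.update ρ 22 x) = G.val e.2 := fun x =>
    eval_valTerm (hG' x) (by simpa using he3) (by simpa using he4)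
  refine runs_seqs_cons (runs_asgs (by simp [ok_valTerm]) fun n₁ => ?_)
  simp only [assignAll_cons, assignAll_nil, t1, t2]
  obtain ⟨ρ₁, hρ₁⟩ : ∃ ρ₁, ρ₁ = Function.update (Function.update ρ 22 (F.val e.1)) 23
    (G.val e.2) := ⟨_, rfl⟩
  rw [← hρ₁]
  have l1 : ∀ i < 22, ρ₁ i = ρ i := fun i hi => by
    rw [hρ₁, Function.update_of_ne (by omega), Function.update_of_ne (by omega)]
  have l22 : ρ₁ 22 = F.val e.1 := by simp [hρ₁]
  have l23 : ρ₁ 23 = G.val e.2 := by simp [hρ₁]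
  clear hρ₁
  have t3 : (bilTerm 0 12 16).eval ρ₁ = F.bil e.1 f.1 :=
    eval_bilTerm (hF.congr fun i hi => l1 i (by omega)) (by rw [l1 12 (by omega), he1])
      (by rw [l1 _ (by omega), he2]) (by rw [l1 _ (by omega), hf1])
      (by rw [l1 _ (by omega), hf2])
  have t4 : ∀ x : ℝ, (bilTerm 6 14 18).eval (Function.update ρ₁ 24 x) = G.bil e.2 f.2 := fun x =>
    eval_bilTerm (hG.congr fun i hi => by rw [Function.update_of_ne (by omega), l1 i (by omega)])
      (by simp; rw [l1 _ (by omega), he3]) (by simp; rw [l1 _ (by omega), he4])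
      (by simp; rw [l1 _ (by omega), hf3]) (by simp; rw [l1 _ (by omega), hf4])
  obtain ⟨θ, hθ⟩ : ∃ θ, θ = scale (G.val e.2 / F.val e.1) := ⟨_, rfl⟩
  have hθp : θ ≠ 0 := hθ ▸ (scale_pos _).ne'
  obtain ⟨α, hα⟩ : ∃ α, α = nearest θ (F.bil e.1 f.1 / F.val e.1) (G.bil e.2 f.2 / G.val e.2) :=
    ⟨_, rfl⟩
  refine runs_seqs_cons (runs_asgs ?_ fun n₂ => ?_)
  · simp [ok_bilTerm, l22, l23, ha.ne', hb.ne', div_pos hb ha, ← hθ, hθp]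
  obtain ⟨ρ₂, hρ₂⟩ : ∃ ρ₂, ρ₂ = assignAll [(24, bilTerm 0 12 16 / v 22),
    (25, bilTerm 6 14 18 / v 23), (26, scaleTerm (v 23 / v 22)),
    (27, floor ((v 24 / v 26 + v 25 * v 26) / 2 + 1 / 2)),
    (28, floor ((v 24 / v 26 - v 25 * v 26) / (2 * sqrtTwo) + 1 / 2)),
    (29, v 26 * (v 27 + v 28 * sqrtTwo)), (30, (v 27 - v 28 * sqrtTwo) / v 26)] ρ₁ := ⟨_, rfl⟩
  rw [← hρ₂]
  have m1 : ∀ i < 24, ρ₂ i = ρ₁ i := fun i hi => by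
    rw [hρ₂, assignAll_of_notMem]
    simp
    omega
  have m29 : ρ₂ 29 = α.1 := by
    simp [hρ₂, t3, t4, l22, l23, ← hθ, hα, nearest]
  have m30 : ρ₂ 30 = α.2 := by
    simp [hρ₂, t3, t4, l22, l23, ← hθ, hα, nearest]
  clear hρ₂
  refine runs_seqs_cons (runs_asgs (by simp) fun n₃ => ?_)
  obtain ⟨ρ₃, hρ₃⟩ : ∃ ρ₃, ρ₃ = assignAll [(16, v 16 - v 29 * v 12), (17, v 17 - v 29 * v 13),
    (18, v 18 - v 30 * v 14), (19, v 19 - v 30 * v 15)] ρ₂ := ⟨_, rfl⟩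
  rw [← hρ₃]
  have q1 : ∀ i < 16, ρ₃ i = ρ i := fun i hi => by
    rw [hρ₃, assignAll_of_notMem, m1 i (by omega), l1 i (by omega)]
    simp
    omega
  have q22 : ρ₃ 22 = F.val e.1 := by simp [hρ₃, m1, l22]
  have q23 : ρ₃ 23 = G.val e.2 := by simp [hρ₃, m1, l23]
  have hred : reduceBy F G e f = f - act α e := by rw [reduceBy, hα, hθ]
  have qf : HoldsPair ρ₃ 16 (reduceBy F G e f) := by
    rw [hred]
    refine ⟨?_, ?_, ?_, ?_⟩ <;> simp at he2 he3 he4 hf2 hf3 hf4 <;>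
      simp [hρ₃, m1, l1, m29, m30, he1, he2, he3, he4, hf1, hf2, hf3, hf4]
  clear hρ₃
  have qF : HoldsForm ρ₃ 0 F := hF.congr fun i hi => q1 i (by omega)
  have qG : ∀ x : ℝ, HoldsForm (Function.update ρ₃ 20 x) 6 G := fun x => hG.congr fun i hi => by
    rw [Function.update_of_ne (by omega), q1 i (by omega)]
  have t5 : ∀ x : ℝ, (valTerm 0 16).eval (Function.update ρ₃ 20 x) =
      F.val (reduceBy F G e f).1 := fun x =>
    eval_valTerm (qF.congr fun i hi => Function.update_of_ne (by omega) _ _)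
      (by simpa using qf.1) (by simpa using qf.2.1)
  have t6 : ∀ x : ℝ, (valTerm 6 18).eval (Function.update ρ₃ 20 x) =
      G.val (reduceBy F G e f).2 := fun x =>
    eval_valTerm (qG x) (by simpa using qf.2.2.1) (by simpa using qf.2.2.2)
  refine runs_seqs_cons (runs_asgs (by simp [ok_valTerm]) fun n₄ => runs_seqs_nil ?_)
  have hfr : ∀ i < 20, assignAll [(20, v 22 * v 23), (21, 2 * (valTerm 0 16 * valTerm 6 18))] ρ₃ i =
      ρ₃ i := fun i hi => assignAll_of_notMem (by simp; omega) _
  refine ⟨fun i hi => ?_, rfl, ?_, ?_, ?_, ?_⟩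
  · rw [hfr i (by omega), q1 i (by omega)]
  · exact he.congr fun i hi => by rw [hfr i (by omega), q1 i (by omega)]
  · exact qf.congr fun i hi => hfr i (by omega)
  · simp [q22, q23, nrm]
  · simp [t5, t6, nrm]

theorem loopFree_startBasis : LoopFree startBasis :=
  loopFree_cond (loopFree_asgs _) (loopFree_asgs _)

/-- The product of the forms is `F.p * G.p` at `1` and `F.r * G.r` at `i`; the square of the smaller
one is at most the product of both. Thus only the products `p r` matter, which uprightness controls.
-/
theorem runs_startBasis (hF : HoldsForm ρ 0 F) (hG : HoldsForm ρ 6 G) :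
    Runs O startBasis ρ out fun ρ' out' n => ((∀ i < 12, ρ' i = ρ i) ∧ out' = out ∧
      ∃ e f, IsBasis e f ∧ HoldsPair ρ' 12 e ∧ HoldsPair ρ' 16 f ∧
        nrm F G e ^ 2 ≤ F.p * F.r * (G.p * G.r)) ∧ n ≤ size startBasis := by
  refine Runs.and_size ?_ loopFree_startBasis
  obtain ⟨f1, -, f3⟩ := hF
  obtain ⟨g1, -, g3⟩ := hG
  simp at f3 g3
  have hFr := F.r_pos
  have hGr := G.r_pos
  have hFp := F.pos
  have hGp := G.pos
  refine runs_cond (by simp) (by simp) (fun hlt => ?_) (fun hlt => ?_)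
  · simp [f1, f3, g1, g3] at hlt
    refine runs_asgs (by simp) fun n m => ⟨fun i hi => assignAll_of_notMem (by simp; omega) _, rfl,
      _, _, isBasis_I, ?_, ?_, ?_⟩
    · simp [HoldsPair]
    · simp [HoldsPair, omega_eq]
    · simp only [nrm, Form.val_I]
      have : 0 < F.r * G.r := by positivity
      nlinarith
  · simp [f1, f3, g1, g3] at hlt
    refine runs_asgs (by simp) fun n m => ⟨fun i hi => assignAll_of_notMem (by simp; omega) _, rfl,
      _, _, isBasis_one, ?_, ?_, ?_⟩
    · simp [HoldsPair]
    · simp [HoldsPair, omega_eq]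
    · simp only [nrm, Form.val_one]
      have : 0 < F.p * G.p := by positivity
      nlinarith

theorem runs_exchange (he : HoldsPair ρ 12 e) (hf : HoldsPair ρ 16 f)
    {Q : (ℕ → ℝ) → List ZOmega → ℕ → Prop}
    (h : ∀ ρ', ∀ n ≤ size exchange, (∀ i < 12, ρ' i = ρ i) → HoldsPair ρ' 12 f →
      HoldsPair ρ' 16 (-e) → Q ρ' out n) : Runs O exchange ρ out Q := by
  refine runs_asgs_size (by simp) fun n hn => h _ n hn
    (fun i hi => assignAll_of_notMem (by simp; omega) _) ?_ ?_
  · simpa [HoldsPair] using hf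
  · simpa [HoldsPair] using he

/-- More than halving lowers the binary logarithm by at least one. The lower bound on `y * x`
ensures `logb 2 (4 * y) ≥ 1`, so that truncation of the natural floor at zero does not spoil the
descent. -/
theorem floor_logb_lt {x y : ℝ} (hx : 0 < x) (hxy : 2 * x < y) (h : 1 / 4 ≤ y * x) :
    ⌊logb 2 (4 * x)⌋₊ < ⌊logb 2 (4 * y)⌋₊ := by
  have hy : 1 / 2 ≤ y := by nlinarith
  have h1 : logb 2 (4 * x) ≤ logb 2 (4 * y) - 1 := by
    have h2 : logb 2 (4 * y) - 1 = logb 2 (2 * y) := by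
      rw [show 4 * y = 2 * (2 * y) by ring, logb_mul (by norm_num) (by linarith)]
      simp
    rw [h2]
    exact logb_le_logb_of_le (by norm_num) (by linarith) (by linarith)
  have h3 : 1 ≤ logb 2 (4 * y) := by
    rw [le_logb_iff_rpow_le (by norm_num) (by linarith)]
    norm_num
    linarith
  have h4 : 1 ≤ ⌊logb 2 (4 * y)⌋₊ := Nat.le_floor (by simpa using h3)
  have h5 : ⌊logb 2 (4 * x)⌋₊ ≤ ⌊logb 2 (4 * y) - 1⌋₊ := Nat.floor_mono h1
  rw [Nat.floor_sub_one] at h5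
  omega

/-- The loop exchanges and reduces while this more than halves the product;
`IsBasis.nrm_le_of_reduced` applies when it stops. The same quantity `V` is the variant and pays for
the steps. Termination needs no uprightness, so the bound is given in terms of any `x` that
dominates the initial product. -/
theorem runs_reduction (hF : HoldsForm ρ 0 F) (hG : HoldsForm ρ 6 G) :
    Runs O reduction ρ out fun ρ' out' n => (∀ i < 12, ρ' i = ρ i) ∧ out' = out ∧
      (∃ e f, IsBasis e f ∧ HoldsPair ρ' 12 e ∧ HoldsPair ρ' 16 f ∧ nrm F G e ≤ 109) ∧
      ∀ x, F.p * F.r * (G.p * G.r) ≤ x ^ 2 → 0 ≤ x →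
        n ≤ reductionCost * (⌊logb 2 (4 * x)⌋₊ + 1) := by
  refine runs_seqs_cons ((runs_startBasis hF hG).mono ?_)
  rintro ρ₁ out₁ n₁ ⟨⟨h1, ho₁, e₀, f₀, hb₀, he₀, hf₀, hnrm⟩, hn₁⟩
  refine runs_seqs_cons ((runs_reduceStep (hF.congr fun i hi => h1 i (by omega))
    (hG.congr fun i hi => h1 i (by omega)) hb₀ he₀ hf₀).mono ?_)
  rintro ρ₂ out₂ n₂ ⟨⟨k1, ho₂, k3, k4, k5, k6⟩, hn₂⟩
  rw [ho₁] at ho₂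
  obtain ⟨K, hK⟩ : ∃ K, K = size exchange + size reduceStep + 3 := ⟨_, rfl⟩
  obtain ⟨V, hV⟩ : ∃ V : (ℕ → ℝ) → ℕ, V = fun ρ => ⌊logb 2 (4 * ρ 20)⌋₊ := ⟨_, rfl⟩
  refine runs_seqs_cons ((runs_loop (fun ρ' out' t => (∀ i < 12, ρ' i = ρ i) ∧ out' = out ∧
    (∃ e f, IsBasis e f ∧ HoldsPair ρ' 12 e ∧ HoldsPair ρ' 16 (reduceBy F G e f) ∧
      ρ' 20 = nrm F G e ∧ ρ' 21 = 2 * nrm F G (reduceBy F G e f)) ∧ t + K * V ρ' ≤ K * V ρ₂)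
    V ?_ ?_).mono ?_)
  · exact ⟨fun i hi => by rw [k1 i hi, h1 i hi], ho₂, ⟨e₀, f₀, hb₀, k3, k4, k5, k6⟩, by simp⟩
  · rintro ρ₃ out₃ t ⟨l1, ho₃, ⟨e, f, hb, l2, l3, l4, l5⟩, ht⟩ hlt
    refine runs_seqs_cons (runs_exchange l2 l3 fun ρ₄ n₄ hn₄ m1 m2 m3 => ?_)
    have hfr : ∀ i < 12, ρ₄ i = ρ i := fun i hi => by rw [m1 i hi, l1 i hi]
    have hbs := (hb.reduceBy F G).swap
    refine runs_seqs_cons ((runs_reduceStep (hF.congr fun i hi => hfr i (by omega))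
      (hG.congr fun i hi => hfr i (by omega)) hbs m2 m3).mono ?_)
    rintro ρ₅ out₅ n₅ ⟨⟨q1, ho₅, q2, q3, q4, q5⟩, hn₅⟩
    have hlt' : V ρ₅ < V ρ₃ := by
      rw [hV]
      simp only [q4, l4]
      rw [l4, l5] at hlt
      exact floor_logb_lt (hbs.nrm_pos F G) hlt ((hb.reduceBy F G).quarter_le F G)
    refine runs_seqs_nil ⟨⟨fun i hi => by rw [q1 i hi, hfr i hi], by rw [ho₅, ho₃],
      ⟨_, _, hbs, q2, q3, q4, q5⟩, ?_⟩, hlt'⟩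
    have : K * (V ρ₅ + 1) ≤ K * V ρ₃ := Nat.mul_le_mul_left _ hlt'
    rw [mul_add, mul_one] at this
    omega
  · rintro ρ₃ out₃ n ⟨t, rfl, ⟨l1, ho₃, ⟨e, f, hb, l2, l3, l4, l5⟩, ht⟩, hlt⟩
    refine runs_seqs_nil ⟨l1, ho₃, ⟨e, _, hb.reduceBy F G, l2, l3,
      hb.nrm_le_of_reduced F G ?_⟩, fun x hx hx0 => ?_⟩
    · rw [l4, l5] at hlt
      exact not_lt.1 hlt
    · have h2 : nrm F G e₀ ≤ x := by
        have := hb₀.nrm_pos F G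
        exact le_of_sq_le_sq (hnrm.trans hx) hx0
      have h3 : V ρ₂ ≤ ⌊logb 2 (4 * x)⌋₊ := by
        rw [hV]
        simp only [k5]
        have := hb₀.nrm_pos F G
        exact Nat.floor_mono (logb_le_logb_of_le (by norm_num) (by linarith) (by linarith))
      have h4 : K ≤ reductionCost := by
        rw [hK, reductionCost]
        omega
      have h5 : K * V ρ₂ ≤ reductionCost * ⌊logb 2 (4 * x)⌋₊ := Nat.mul_le_mul h4 h3
      have h6 : n₁ + n₂ + 10 ≤ reductionCost := by
        rw [reductionCost]
        omega
      rw [mul_add, mul_one]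
      omega

end Grid

/-! ## The program -/

namespace Grid

open Real Arith

/-- Test one point and output it if it is a solution. -/
def pointProg : Prog := seqs [
  asgs [(54, v 52 * v 12 + v 33), (55, v 52 * v 13 + v 34), (56, v 53 * v 14 + v 35),
    (57, v 53 * v 15 + v 36)],
  askMember 0 54 55 58, askMember 1 56 57 59,
  -- Both answers are `0` or `1`, so the product is positive exactly if both tests accept.
  cond 0 (v 58 * v 59) (seqs [
    asgs [(60, ((v 55 - v 57) - (v 54 - v 56)) / (2 * sqrtTwo)), (61, (v 55 + v 57) / 2),
      (62, ((v 55 - v 57) + (v 54 - v 56)) / (2 * sqrtTwo)), (63, (v 54 + v 56) / 2)],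
    output 60 61 62 63]) skip]

/-- Output the solutions on one line. -/
def lineProg : Prog := seqs [
  asgs [(33, v 31 * v 16), (34, v 31 * v 17), (35, v 32 * v 18), (36, v 32 * v 19)],
  askLine 0 33 34 12 13 37 38 39,
  cond 0 (v 37) (seqs [askLine 1 35 36 14 15 40 41 42,
    cond 0 (v 40) (seqs [
      asgs [(43, v 38), (44, v 39 - v 38), (45, v 41), (46, v 42 - v 41)],
      forEach 43 pointProg]) skip]) skip]

/-- Bounds for the parameters of the lines. -/
def lineBounds : Prog := asgs
  [(20, 2 * (valTerm 0 12 ^ (1 / 2 : Arith) * v 3 ^ (1 / 2 : Arith))),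
    (21, 2 * (valTerm 6 14 ^ (1 / 2 : Arith) * v 9 ^ (1 / 2 : Arith))),
    (22, sqrtTwo * (v 12 * v 5 - v 13 * v 4) - v 20), (23, 2 * v 20),
    (24, 0 - sqrtTwo * (v 14 * v 11 - v 15 * v 10) - v 21), (25, 2 * v 21)]

/-- The program that solves two-dimensional grid problems. -/
def gridProg : Prog := seqs
  [ellipse 0 0, ellipse 1 6, reduction, lineBounds, forEach 22 lineProg]

variable {O : Fin 2 → SetData} {ρ : ℕ → ℝ} {out : List ZOmega} {e f : ℂ × ℂ} {α β : ℝ × ℝ}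

theorem loopFree_pointProg : LoopFree pointProg :=
  ⟨loopFree_asgs _, trivial, trivial, loopFree_cond ⟨loopFree_asgs _, trivial, trivial⟩ trivial,
    trivial⟩

theorem runs_pointProg (hb : IsBasis e f) (hα : α ∈ quad) (hβ : β ∈ quad)
    (he : HoldsPair ρ 12 e) (hf : HoldsPair ρ 33 (act β f)) (h1 : ρ 52 = α.1)
    (h2 : ρ 53 = α.2) :
    Runs O pointProg ρ out fun ρ' out' n => ((∀ i < 54, ρ' i = ρ i) ∧
      out' = pointOutput (O 0) (O 1) e f β α ++ out) ∧ n ≤ size pointProg := by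
  refine Runs.and_size ?_ loopFree_pointProg
  obtain ⟨he1, he2, he3, he4⟩ := he
  obtain ⟨hf1, hf2, hf3, hf4⟩ := hf
  simp only [Nat.reduceAdd] at he2 he3 he4 hf2 hf3 hf4
  obtain ⟨z, hz⟩ : ∃ z, z = act α e + act β f := ⟨_, rfl⟩
  have hzm : z ∈ zomega := hz ▸ hb.comb_mem hα hβ
  obtain ⟨d1, d2, d3, d4⟩ := decode_coeff hzm
  refine runs_seqs_cons (runs_asgs (by simp) fun n₁ => ?_)
  obtain ⟨ρ₁, hρ₁⟩ : ∃ ρ₁, ρ₁ = assignAll [(54, v 52 * v 12 + v 33), (55, v 52 * v 13 + v 34),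
    (56, v 53 * v 14 + v 35), (57, v 53 * v 15 + v 36)] ρ := ⟨_, rfl⟩
  rw [← hρ₁]
  have l1 : ∀ i < 54, ρ₁ i = ρ i := fun i hi => by
    rw [hρ₁, assignAll_of_notMem]
    simp
    omega
  have l54 : ρ₁ 54 = z.1.re := by simp [hρ₁, hz, h1, he1, hf1]
  have l55 : ρ₁ 55 = z.1.im := by simp [hρ₁, hz, h1, he2, hf2]
  have l56 : ρ₁ 56 = z.2.re := by simp [hρ₁, hz, h2, he3, hf3]
  have l57 : ρ₁ 57 = z.2.im := by simp [hρ₁, hz, h2, he4, hf4]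
  clear hρ₁
  refine runs_seqs_cons (runs_askMember (runs_seqs_cons (runs_askMember (runs_seqs_cons
    (runs_cond (by simp) (by simp) (fun hlt => ?_) (fun hlt => ?_))))))
  · simp [l54, l55, l56, l57] at hlt
    have hmem : (O 0).mem z.1 = true ∧ (O 1).mem z.2 = true := by
      by_contra hc
      rw [not_and_or] at hc
      rcases hc with hc | hc <;> simp [hc] at hlt
    refine runs_seqs_cons (runs_asgs (by simp) fun n₂ => runs_seqs_cons (runs_output
      (u := decode z) ?_ ?_ ?_ ?_ (runs_seqs_nil fun m => runs_seqs_nil ⟨fun i hi => ?_, ?_⟩)))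
    · simp [l54, l55, l56, l57, ← d1]
    · simp [l54, l55, l56, l57, ← d2]
    · simp [l54, l55, l56, l57, ← d3]
    · simp [l54, l55, l56, l57, ← d4]
    · rw [assignAll_of_notMem (by simp; omega), Function.update_of_ne (by omega),
        Function.update_of_ne (by omega), l1 i hi]
    · rw [pointOutput, ← hz, if_pos hmem]
      rfl
  · simp [l54, l55, l56, l57] at hlt
    have hmem : ¬ ((O 0).mem z.1 = true ∧ (O 1).mem z.2 = true) := by
      rintro ⟨hc, hc'⟩
      simp [hc, hc'] at hlt
      linarith
    refine runs_skip fun m => runs_seqs_nil ⟨fun i hi => ?_, ?_⟩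
    · rw [Function.update_of_ne (by omega), Function.update_of_ne (by omega), l1 i hi]
    · rw [pointOutput, ← hz, if_neg hmem]
      rfl

/-- Bound for the number of steps per loop iteration on a line. -/
def lineCost : ℕ := size pointProg + 2 * overhead 43 + 200

theorem runs_lineProg (hb : IsBasis e f) (hβ : β ∈ quad) (he : HoldsPair ρ 12 e)
    (hf : HoldsPair ρ 16 f) (h1 : ρ 31 = β.1) (h2 : ρ 32 = β.2)
    (hle : ∀ x y, (O 0).line (β.1 • f.1) e.1 = some (x, y) → x ≤ y)
    (hle' : ∀ x y, (O 1).line (β.2 • f.2) e.2 = some (x, y) → x ≤ y) :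
    Runs O lineProg ρ out fun ρ' out' n => (∀ i < 33, ρ' i = ρ i) ∧
      out' = linePoints (O 0) (O 1) e f β ++ out ∧
      n ≤ lineCost * (lineWork (O 0) (O 1) e f β + 1) := by
  obtain ⟨he1, he2, he3, he4⟩ := id he
  obtain ⟨hf1, hf2, hf3, hf4⟩ := hf
  simp only [Nat.reduceAdd] at he2 he3 he4 hf2 hf3 hf4
  have hcost : 200 ≤ lineCost := by
    rw [lineCost]
    omega
  refine runs_seqs_cons (runs_asgs_size (by simp) fun n₁ hn₁ => ?_)
  have hn₁' : n₁ ≤ 40 := hn₁.trans (Nat.le_of_ble_eq_true rfl)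
  obtain ⟨ρ₁, hρ₁⟩ : ∃ ρ₁, ρ₁ = assignAll [(33, v 31 * v 16), (34, v 31 * v 17),
    (35, v 32 * v 18), (36, v 32 * v 19)] ρ := ⟨_, rfl⟩
  rw [← hρ₁]
  have l1 : ∀ i < 33, ρ₁ i = ρ i := fun i hi => by
    rw [hρ₁, assignAll_of_notMem]
    simp
    omega
  have hβf : HoldsPair ρ₁ 33 (act β f) := by
    simp [HoldsPair, hρ₁, h1, h2, hf1, hf2, hf3, hf4]
  clear hρ₁
  obtain ⟨k1, k2, k3, k4⟩ := id hβf
  simp only [Nat.reduceAdd] at k2 k3 k4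
  have p1 : (⟨ρ₁ 33, ρ₁ 34⟩ : ℂ) = β.1 • f.1 := by rw [k1, k2]; rfl
  have p2 : (⟨ρ₁ 35, ρ₁ 36⟩ : ℂ) = β.2 • f.2 := by rw [k3, k4]; rfl
  have p3 : (⟨ρ₁ 12, ρ₁ 13⟩ : ℂ) = e.1 := by
    rw [l1 12 (by omega), l1 13 (by omega), he1, he2]
  have p4 : (⟨ρ₁ 14, ρ₁ 15⟩ : ℂ) = e.2 := by
    rw [l1 14 (by omega), l1 15 (by omega), he3, he4]
  have s37 : size ((0 : Arith).compile 0) + size ((v 37).compile 1) + 1 = 4 := rfl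
  have s40 : size ((0 : Arith).compile 0) + size ((v 40).compile 1) + 1 = 4 := rfl
  refine runs_seqs_cons (runs_askLine (fun hl => ?_) (fun x y hl => ?_))
  · refine runs_seqs_cons (runs_cond_size (by simp) (by simp) (fun hlt => ?_) (fun hlt => ?_))
    · simp at hlt
    rw [p1, p3] at hl
    refine runs_skip fun m hm => runs_seqs_nil ⟨fun i hi => ?_, ?_, ?_⟩
    · rw [Function.update_of_ne (by omega), l1 i hi]
    · simp [linePoints, hl, -Complex.real_smul]
    · rw [mul_add, mul_one]
      omega
  rw [p1, p3] at hl
  refine runs_seqs_cons (runs_cond_size (by simp) (by simp) (fun hlt => ?_) (fun hlt => ?_))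
  swap
  · simp at hlt
  refine runs_seqs_cons (runs_askLine (fun hl' => ?_) (fun x' y' hl' => ?_))
  · refine runs_seqs_cons (runs_cond_size (by simp) (by simp) (fun hlt => ?_) (fun hlt => ?_))
    · simp at hlt
    simp [p2, p4, -Complex.real_smul] at hl'
    refine runs_skip fun m hm => runs_seqs_nil fun m' hm' => runs_seqs_nil ⟨fun i hi => ?_, ?_, ?_⟩
    · rw [Function.update_of_ne (by omega), Function.update_of_ne (by omega),
        Function.update_of_ne (by omega), Function.update_of_ne (by omega), l1 i hi]
    · simp [linePoints, hl, hl', -Complex.real_smul]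
    · rw [mul_add, mul_one]
      omega
  simp [p2, p4, -Complex.real_smul] at hl'
  refine runs_seqs_cons (runs_cond_size (by simp) (by simp) (fun hlt => ?_) (fun hlt => ?_))
  swap
  · simp at hlt
  refine runs_seqs_cons (runs_asgs_size (by simp) fun n₂ hn₂ => ?_)
  have hn₂' : n₂ ≤ 40 := hn₂.trans (Nat.le_of_ble_eq_true rfl)
  obtain ⟨ρ₂, hρ₂⟩ : ∃ ρ₂, ρ₂ = assignAll [(43, v 38), (44, v 39 - v 38), (45, v 41),
    (46, v 42 - v 41)] (Function.update (Function.update (Function.update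
      (Function.update (Function.update (Function.update ρ₁ 38 x) 39 y) 37 1) 41 x') 42 y') 40 1) :=
    ⟨_, rfl⟩
  rw [← hρ₂]
  have m1 : ∀ i < 37, ρ₂ i = ρ₁ i := fun i hi => by
    rw [hρ₂, assignAll_of_notMem (by simp; omega), Function.update_of_ne (by omega),
      Function.update_of_ne (by omega), Function.update_of_ne (by omega),
      Function.update_of_ne (by omega), Function.update_of_ne (by omega),
      Function.update_of_ne (by omega)]
  have m43 : ρ₂ 43 = x := by simp [hρ₂]
  have m44 : ρ₂ (43 + 1) = y - x := by simp [hρ₂]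
  have m45 : ρ₂ (43 + 2) = x' := by simp [hρ₂]
  have m46 : ρ₂ (43 + 3) = y' - x' := by simp [hρ₂]
  clear hρ₂
  have main := runs_forEach (O := O) (out := out) (ρ := ρ₂) (b := 43) (P := pointProg)
    (by rw [m44]; linarith [hle x y hl]) (by rw [m46]; linarith [hle' x' y' hl'])
    (fun α => pointOutput (O 0) (O 1) e f β α) (fun _ => size pointProg) ?_
  · rw [m43, m44, m45, m46] at main
    refine runs_seqs_cons (main.mono ?_)
    rintro ρ₃ _ n₃ ⟨q1, rfl, q3⟩
    have hwork : lineWork (O 0) (O 1) e f β =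
        numRows x (y - x) x' (y' - x') + (cands x (y - x) x' (y' - x')).length := by
      simp [lineWork, hl, hl', -Complex.real_smul]
    refine runs_seqs_nil fun m hm => runs_seqs_nil fun m' hm' => runs_seqs_nil
      ⟨fun i hi => ?_, ?_, ?_⟩
    · rw [q1 i (by omega), m1 i (by omega), l1 i hi]
    · simp [linePoints, hl, hl', -Complex.real_smul]
    · rw [hwork]
      simp only [List.map_const', List.sum_replicate, smul_eq_mul] at q3
      have e1 : overhead 43 * numRows x (y - x) x' (y' - x') ≤
          lineCost * numRows x (y - x) x' (y' - x') :=
        Nat.mul_le_mul_right _ (by rw [lineCost]; omega)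
      have e2 : (cands x (y - x) x' (y' - x')).length * (size pointProg + overhead 43) ≤
          (cands x (y - x) x' (y' - x')).length * lineCost :=
        Nat.mul_le_mul_left _ (by rw [lineCost]; omega)
      have e3 : overhead 43 + 150 ≤ lineCost := by
        rw [lineCost]
        omega
      rw [mul_comm _ lineCost] at e2
      rw [mul_add, mul_one] at q3
      rw [mul_add, mul_add, mul_one]
      omega
  · intro α hα ρ₃ out₃ q1 q2 q3
    have hα := cands_subset_quad hα
    refine (runs_pointProg hb hα hβ ?_ ?_ q2 q3).mono fun ρ₄ out₄ n h => ⟨h.1.1, h.1.2, h.2⟩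
    · exact he.congr fun i hi => by rw [q1 i (by omega), m1 i (by omega), l1 i (by omega)]
    · exact hβf.congr fun i hi => by rw [q1 i (by omega), m1 i (by omega)]

end Grid

/-! ## Correctness and running time -/

namespace Grid

open Real Arith MeasureTheory

variable {O : Fin 2 → SetData} {ρ : ℕ → ℝ} {out : List ZOmega}

/-- The bounds are ordered because the section between them is non-empty; `runs_forEach` needs sides
that are not negative. -/
theorem SetData.Presents.line_le {D : SetData} {κ : ℝ} {A : Set ℂ} (hD : D.Presents κ A) {p q : ℂ}
    (hp : p ∈ DOmega) (hq : q ∈ DOmega) (hq0 : q ≠ 0) {x y : ℝ} (h : D.line p q = some (x, y)) :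
    x ≤ y := by
  have hne : lineSection A p q ≠ ∅ := fun h0 => by
    rw [(hD.line_none_iff p hp q hq hq0).2 h0] at h
    cases h
  obtain ⟨t, ht⟩ := Set.nonempty_iff_ne_empty.2 hne
  have := (hD.line_some p hp q hq hq0 x y h).1 ht
  exact this.1.trans this.2

theorem Encloses.mem_Icc {F : Form} {u : ℂ} {s κ : ℝ} {A : Set ℂ} (h : Encloses F u s κ A)
    {e z : ℂ} (hz : z ∈ A) : |√2 * cdet e z - √2 * cdet e u| ≤ 2 * (√(F.val e) * √s) := by
  have h1 := h.coord_mem (e := e) hz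
  rw [← mul_sub, abs_mul, abs_of_nonneg (Real.sqrt_nonneg 2)]
  calc √2 * |cdet e z - cdet e u| ≤ √2 * (√2 * (√(F.val e) * √s)) := by gcongr
    _ = 2 * (√(F.val e) * √s) := by rw [← mul_assoc, sqrt2_mul]

theorem runs_lineBounds {F G : Form} {e f : ℂ × ℂ} (hb : IsBasis e f) (hF : HoldsForm ρ 0 F)
    (hG : HoldsForm ρ 6 G) (he : HoldsPair ρ 12 e) (h3 : 0 < ρ 3) (h9 : 0 < ρ 9)
    {Q : (ℕ → ℝ) → List ZOmega → ℕ → Prop}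
    (h : ∀ ρ', ∀ n ≤ size lineBounds, (∀ i < 20, ρ' i = ρ i) →
      ρ' 22 = √2 * cdet e.1 ⟨ρ 4, ρ 5⟩ - 2 * (√(F.val e.1) * √(ρ 3)) →
      ρ' 23 = 4 * (√(F.val e.1) * √(ρ 3)) →
      ρ' 24 = -(√2 * cdet e.2 ⟨ρ 10, ρ 11⟩) - 2 * (√(G.val e.2) * √(ρ 9)) →
      ρ' 25 = 4 * (√(G.val e.2) * √(ρ 9)) → Q ρ' out n) :
    Runs O lineBounds ρ out Q := by
  obtain ⟨he1, he2, he3, he4⟩ := id he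
  have hp := hb.val_fst_pos F
  have hp' := hb.val_snd_pos G
  have t1 : (valTerm 0 12).eval ρ = F.val e.1 := eval_valTerm hF he1 he2
  have t2 : ∀ x : ℝ, (valTerm 6 14).eval (Function.update ρ 20 x) = G.val e.2 := fun x =>
    eval_valTerm (hG.congr fun i hi => Function.update_of_ne (by omega) _ _)
      (by simpa using he3) (by simpa using he4)
  simp only [Nat.reduceAdd] at he2 he3 he4
  have hs : ∀ x : ℝ, x ^ (2⁻¹ : ℝ) = √x := fun x => by rw [Real.sqrt_eq_rpow, one_div]
  refine runs_asgs_size (by simp [ok_valTerm, t1, t2, hp, hp', h3, h9]) fun n hn => h _ n hn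
    (fun i hi => assignAll_of_notMem (by simp; omega) _) ?_ ?_ ?_ ?_
  · simp [t1, hs, he1, he2, cdet]
  · simp [t1, hs]
    ring
  · simp [t2, hs, he3, he4, cdet]
  · simp [t2, hs]
    ring

/-- With `1 / M` written as `exp L`, the bound for the number of reduction rounds is linear in `L`,
with a constant term that depends on `κ` alone. -/
theorem logb_le {x L : ℝ} (hx : 0 < x) (hL : 0 ≤ L) :
    (⌊logb 2 (4 * (x * exp L) ^ 2)⌋₊ : ℝ) ≤ |logb 2 (4 * x ^ 2)| + 2 / Real.log 2 * L := by
  have hl : 0 < Real.log 2 := Real.log_pos (by norm_num)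
  have h1 : logb 2 (4 * (x * exp L) ^ 2) = logb 2 (4 * x ^ 2) + 2 / Real.log 2 * L := by
    rw [mul_pow, ← mul_assoc, logb_mul (by positivity) (by positivity)]
    congr 1
    rw [logb, Real.log_pow, Real.log_exp]
    push_cast
    ring
  have h2 : logb 2 (4 * (x * exp L) ^ 2) ≤ |logb 2 (4 * x ^ 2)| + 2 / Real.log 2 * L := by
    rw [h1]
    gcongr
    exact le_abs_self _
  refine (Nat.cast_le.2 (Nat.floor_mono h2)).trans (Nat.floor_le (by positivity))

/-- Bound for the number of steps per line, and of steps before the enumeration. -/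
def stepCost : ℕ := lineCost + overhead 22 + size lineBounds + 2000

theorem total_le {S c b m n t w R n₁ n₂ n₃ n₄ n₅ : ℕ} (hS : S = c + b + 2000)
    (h₁ : n₁ ≤ 600 * (m + 1)) (h₂ : n₂ ≤ 600 * (n + 1)) (h₃ : n₃ ≤ R * (t + 1)) (h₄ : n₄ ≤ b)
    (h₅ : n₅ ≤ c * (w + 1)) :
    n₁ + (n₂ + (n₃ + (n₄ + (n₅ + 1)))) ≤
      S * (m + 1) + S * (n + 1) + R * (t + 1) + S * (w + 1) := by
  subst hS
  have h₆ : 0 ≤ (c + b) * (m + 1) := Nat.zero_le _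
  have h₇ : 0 ≤ c * (n + 1) + b * n := Nat.zero_le _
  have h₈ : 0 ≤ b * (w + 1) := Nat.zero_le _
  nlinarith

/-- Bound for the work in the enumeration, per solution. -/
noncomputable def workFactor (κ : ℝ) : ℝ :=
  120 * (4000000000 * κ ^ 2 + 1) + 120 * (8000 * κ ^ 2 + 1) *
    (120 * (4000000000 * κ ^ 2 + 1) + 1)

theorem runs_gridProg {A B : Set ℂ} {κ : ℝ} (hA : Convex ℝ A) (hA' : Bornology.IsBounded A)
    (hAi : (interior A).Nonempty) (hB : Convex ℝ B) (hB' : Bornology.IsBounded B)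
    (hBi : (interior B).Nonempty) (hD : (O 0).Presents κ A) (hE : (O 1).Presents κ B) :
    Runs O gridProg ρ [] fun _ out' n => (∀ u, u ∈ out' ↔ IsSolution A B u) ∧ out'.Nodup ∧ 0 < κ ∧
      ∀ M, 0 < M → IsUpright M A → IsUpright M B → (n : ℝ) ≤
        stepCost * ((O 0).vertices.length + 1) + stepCost * ((O 1).vertices.length + 1) +
        reductionCost * (⌊logb 2 (4 * (36 * κ * exp (Real.log (1 / M))) ^ 2)⌋₊ + 1) +
        stepCost * (workFactor κ * (out'.length + 1) + 1) := by
  refine runs_seqs_cons ((runs_ellipse (by norm_num) hD hAi).mono ?_)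
  rintro ρ₁ out₁ n₁ ⟨-, ho₁, ⟨F, f1, f2, f3, hF⟩, hn₁⟩
  simp only [zero_add] at f2 f3 hF
  refine runs_seqs_cons ((runs_ellipse le_rfl hE hBi).mono ?_)
  rintro ρ₂ out₂ n₂ ⟨g0, ho₂, ⟨G, g1, g2, g3, hG⟩, hn₂⟩
  simp only [Nat.reduceAdd] at hG
  have hF₂ : HoldsForm ρ₂ 0 F := ⟨by rw [g0 _ (by omega), f1], by rw [g0 _ (by omega), f2],
    by rw [g0 _ (by omega), f3]⟩
  have hG₂ : HoldsForm ρ₂ 6 G := ⟨g1, g2, g3⟩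
  rw [← g0 3 (by omega), ← g0 4 (by omega), ← g0 5 (by omega)] at hF
  -- Positivity of `κ` is not part of a presentation; it follows from the positive level of the
  -- ellipse, which is at most `4 κ` times the area.
  have hκ : 0 < κ := by
    have h1 := hF.le_area
    have h2 := hF.pos
    have h3 : 0 ≤ volume.real A := measureReal_nonneg
    by_contra hc
    have : κ * volume.real A ≤ 0 := mul_nonpos_of_nonpos_of_nonneg (not_lt.1 hc) h3
    linarith
  refine runs_seqs_cons ((runs_reduction hF₂ hG₂).mono ?_)
  rintro ρ₃ out₃ n₃ ⟨k0, ho₃, ⟨e, f, hb, he, hf, hshort⟩, hn₃⟩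
  rw [← k0 3 (by omega), ← k0 4 (by omega), ← k0 5 (by omega)] at hF
  rw [← k0 9 (by omega), ← k0 10 (by omega), ← k0 11 (by omega)] at hG
  refine runs_seqs_cons (runs_lineBounds hb (hF₂.congr fun i hi => k0 i (by omega))
    (hG₂.congr fun i hi => k0 i (by omega)) he hF.pos hG.pos fun ρ₄ n₄ hn₄ l0 l1 l2 l3 l4 => ?_)
  obtain ⟨X, hX⟩ : ∃ X, X = ρ₄ 22 := ⟨_, rfl⟩
  obtain ⟨a, ha⟩ : ∃ a, a = ρ₄ (22 + 1) := ⟨_, rfl⟩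
  obtain ⟨X', hX'⟩ : ∃ X', X' = ρ₄ (22 + 2) := ⟨_, rfl⟩
  obtain ⟨b, hb'⟩ : ∃ b, b = ρ₄ (22 + 3) := ⟨_, rfl⟩
  have ha0 : 0 ≤ a := by
    rw [ha]
    simp only [Nat.reduceAdd]
    rw [l2]
    positivity
  have hb0 : 0 ≤ b := by
    rw [hb']
    simp only [Nat.reduceAdd]
    rw [l4]
    positivity
  have hXA : ∀ z ∈ A, √2 * cdet e.1 z ∈ Set.Icc X (X + a) := fun z hz => by
    have := abs_le.1 (hF.mem_Icc (e := e.1) hz)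
    rw [hX, ha]
    simp only [Nat.reduceAdd]
    rw [l1, l2]
    constructor <;> linarith
  have hXB : ∀ z ∈ B, -(√2 * cdet e.2 z) ∈ Set.Icc X' (X' + b) := fun z hz => by
    have := abs_le.1 (hG.mem_Icc (e := e.2) hz)
    rw [hX', hb']
    simp only [Nat.reduceAdd]
    rw [l3, l4]
    constructor <;> linarith
  have hmem : ∀ u, u ∈ enumerate (O 0) (O 1) e f X a X' b ↔ IsSolution A B u := fun u =>
    mem_enumerate hD hE hb ha0 hb0 hXA hXB
  have main := runs_forEach (O := O) (out := out₃) (ρ := ρ₄) (b := 22) (P := lineProg)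
    (by rw [← ha]; exact ha0) (by rw [← hb']; exact hb0) (linePoints (O 0) (O 1) e f)
    (fun β => lineCost * (lineWork (O 0) (O 1) e f β + 1)) ?_
  · rw [← hX, ← ha, ← hX', ← hb'] at main
    refine runs_seqs_cons (main.mono ?_)
    rintro ρ₅ out₅ n₅ ⟨-, ho₅, hn₅⟩
    have hout : out₅ = enumerate (O 0) (O 1) e f X a X' b := by
      rw [ho₅, ho₃, ho₂, ho₁, List.append_nil, enumerate]
    have hwork := work_le_of_area hD hE hb hA hB hκ (X := X) (X' := X')
      (c := 4000000000 * κ ^ 2) ha0 hb0 (by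
        have := area_le hb hA hB hκ hF hG hshort hmem
        have e1 : a = 4 * (√(F.val e.1) * √(ρ₃ 3)) := ha.trans l2
        have e2 : b = 4 * (√(G.val e.2) * √(ρ₃ 9)) := hb'.trans l4
        rwa [← e1, ← e2] at this)
    refine runs_seqs_nil ⟨fun u => by rw [hout, hmem], ?_, hκ, fun M hM hMA hMB => ?_⟩
    · rw [hout]
      exact nodup_enumerate hD hE hb X a X' b
    have h5 : n₅ ≤ (lineCost + overhead 22) * (work (O 0) (O 1) e f X a X' b + 1) := by
      refine hn₅.trans ?_
      have key : ∀ l : List (ℝ × ℝ), (l.map fun β =>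
          lineCost * (lineWork (O 0) (O 1) e f β + 1) + overhead 22).sum ≤
          (lineCost + overhead 22) * (l.map fun β => lineWork (O 0) (O 1) e f β + 1).sum := by
        intro l
        induction l with
        | nil => simp
        | cons β l ih =>
          simp only [List.map_cons, List.sum_cons]
          nlinarith [Nat.zero_le (overhead 22 * lineWork (O 0) (O 1) e f β)]
      have := key (cands X a X' b)
      rw [work]
      nlinarith [Nat.zero_le (lineCost * numRows X a X' b), Nat.zero_le lineCost]
    have h3 := hn₃ ((36 * κ / M) ^ 2) (by
      have e1 := hF.mul_le_of_isUpright hA' hA hκ hM hMA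
      have e2 := hG.mul_le_of_isUpright hB' hB hκ hM hMB
      have e3 := mul_pos G.pos G.r_pos
      rw [sq ((36 * κ / M) ^ 2)]
      gcongr) (by positivity)
    have hexp : 36 * κ / M = 36 * κ * exp (Real.log (1 / M)) := by
      rw [Real.exp_log (by positivity)]
      ring
    rw [hexp] at h3
    rw [← hout] at hwork
    generalize ⌊logb 2 (4 * (36 * κ * exp (Real.log (1 / M))) ^ 2)⌋₊ = t at *
    have hsum := total_le (S := stepCost) rfl hn₁ hn₂ h3 hn₄ h5
    generalize stepCost = S at *
    generalize reductionCost = R at *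
    refine (Nat.cast_le.2 hsum).trans ?_
    push_cast
    gcongr
    exact hwork
  · intro β hβ ρ₅ out₅ q0 q1 q2
    have hβ := cands_subset_quad hβ
    have hm := act_mem_zomega hβ hb.right
    refine runs_lineProg hb hβ ?_ ?_ q1 q2 (fun x y h => ?_) fun x y h => ?_
    · exact he.congr fun i hi => by rw [q0 i (by omega), l0 i (by omega)]
    · exact hf.congr fun i hi => by rw [q0 i (by omega), l0 i (by omega)]
    · exact hD.line_le (mem_DOmega_fst hm) (mem_DOmega_fst hb.left) hb.ne_zero_fst h
    · exact hE.line_le (mem_DOmega_snd hm) (mem_DOmega_snd hb.left) hb.ne_zero_snd h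

theorem SetData.Presents.one_le_length {D : SetData} {κ : ℝ} {A : Set ℂ} (hD : D.Presents κ A)
    (hA : (interior A).Nonempty) : 1 ≤ D.vertices.length := by
  rw [Nat.one_le_iff_ne_zero, Ne, List.length_eq_zero_iff]
  intro h0
  obtain ⟨z, hz⟩ := hA
  have := hD.subset_polygon (interior_subset hz)
  simp [h0] at this

end Grid

/-- One program enumerates, for all bounded convex sets `A` and `B` with non-empty interior, the
solutions of the two-dimensional grid problem, each of them once. If `A` and `B` are `M`-upright,
it makes `O(log (1/M))` steps, plus a constant number for each solution and for each vertex of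
the given enclosing polygons. The implied constant depends only on the factor `κ` in the
presentations of the two sets. -/
theorem theorem5p18 :
    ∃ P : Grid.Prog, ∀ κ : ℝ, ∃ C : ℝ, ∀ (A B : Set ℂ) (D E : Grid.SetData),
      Convex ℝ A → Bornology.IsBounded A → (interior A).Nonempty →
      Convex ℝ B → Bornology.IsBounded B → (interior B).Nonempty →
      D.Presents κ A → E.Presents κ B →
      ∃ (τ : Grid.State) (T : ℕ), Grid.Exec ![D, E] P Grid.State.init τ T ∧
        (∀ u : Grid.ZOmega, u ∈ τ.out ↔ Grid.IsSolution A B u) ∧ τ.out.Nodup ∧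
        ∀ M : ℝ, 0 < M → Grid.IsUpright M A → Grid.IsUpright M B →
          (T : ℝ) ≤ C * (Real.log (1 / M) + τ.out.length +
            (D.vertices.length + E.vertices.length)) := by
  open Grid in
  refine ⟨gridProg, fun κ => ?_⟩
  obtain ⟨S, hS⟩ : ∃ S : ℝ, S = stepCost := ⟨_, rfl⟩
  obtain ⟨R, hR⟩ : ∃ R : ℝ, R = reductionCost := ⟨_, rfl⟩
  obtain ⟨W, hW⟩ : ∃ W : ℝ, W = workFactor κ := ⟨_, rfl⟩
  obtain ⟨c, hc⟩ : ∃ c : ℝ, c = |Real.logb 2 (4 * (36 * κ) ^ 2)| := ⟨_, rfl⟩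
  obtain ⟨d, hd⟩ : ∃ d : ℝ, d = 2 / Real.log 2 := ⟨_, rfl⟩
  have hS0 : 0 ≤ S := hS ▸ Nat.cast_nonneg _
  have hR0 : 0 ≤ R := hR ▸ Nat.cast_nonneg _
  have hW0 : 0 ≤ W := by
    rw [hW, workFactor]
    positivity
  have hc0 : 0 ≤ c := hc ▸ abs_nonneg _
  have hd0 : 0 ≤ d := by
    have : 0 < Real.log 2 := Real.log_pos (by norm_num)
    rw [hd]
    positivity
  refine ⟨4 * S + R * (c + d + 1) + S * (W + 1), fun A B D E hA hA' hAi hB hB' hBi hD hE => ?_⟩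
  obtain ⟨τ, T, h1, h2, h3, hκ, h4⟩ := runs_gridProg (O := ![D, E]) (κ := κ) hA hA' hAi hB hB' hBi
    hD hE State.init rfl rfl
  refine ⟨τ, T, h1, h2, h3, fun M hM hMA hMB => (h4 M hM hMA hMB).trans ?_⟩
  -- No set is more than `1`-upright, so `log (1 / M)` cannot be negative and may be dropped or
  -- added in the estimates.
  have hM1 : M ≤ 1 := hMA.trans (uprightness_le_one hA')
  have hL : 0 ≤ Real.log (1 / M) := Real.log_nonneg (by rw [le_div_iff₀ hM]; linarith)
  have h5 := logb_le (x := 36 * κ) (by positivity) hL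
  -- Each list has at least one vertex, so every additive constant is absorbed by the term `m + n`.
  have hm : (1 : ℝ) ≤ D.vertices.length := by exact_mod_cast hD.one_le_length hAi
  have hn : (1 : ℝ) ≤ E.vertices.length := by exact_mod_cast hE.one_le_length hBi
  have hN : (0 : ℝ) ≤ τ.out.length := Nat.cast_nonneg _
  rw [← hS, ← hR, ← hW]
  rw [← hc, ← hd] at h5
  simp only [Matrix.cons_val_zero, Matrix.cons_val_one]
  generalize (⌊Real.logb 2 (4 * (36 * κ * Real.exp (Real.log (1 / M))) ^ 2)⌋₊ : ℝ) = t at *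
  generalize Real.log (1 / M) = L at *
  generalize (D.vertices.length : ℝ) = m at *
  generalize (E.vertices.length : ℝ) = n at *
  generalize (τ.out.length : ℝ) = N at *
  have k1 : R * (t + 1) ≤ R * ((c + d + 1) * (L + N + (m + n))) := by
    gcongr
    nlinarith [mul_nonneg hc0 (by linarith : 0 ≤ L + N + (m + n) - 1),
      mul_nonneg hd0 (by linarith : 0 ≤ N + (m + n))]
  have k2 : S * (W * (N + 1) + 1) ≤ S * ((W + 1) * (L + N + (m + n))) := by
    gcongr
    nlinarith [mul_nonneg hW0 (by linarith : 0 ≤ L + (m + n) - 1)]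
  have k3 : S * (m + 1) + S * (n + 1) ≤ S * (4 * (L + N + (m + n))) := by
    rw [← mul_add]
    gcongr
    linarith
  linarith
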